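/- Let $d\in\{2,3\}$, let $\lambda,\mu\in\mathbb R$ satisfy $\mu>0$ and $\lambda+2\mu>0$, put $c_p=(\lambda+2\mu)^{-1/2}$, $c_s=\mu^{-1/2}$, and let $m\in(d-4,d]$. Write $\hat\varphi(\xi)=\int_{\mathbb R^d}e^{-ix\cdot\xi}\varphi(x)\,dx$ (entrywise for matrices), $C_2=e^{i\pi/4}/\sqrt{8\pi}$ and $C_3=1/(4\pi)$. **Source.** Let $f=(f_1,\dots,f_d)$ be a random element of $\mathcal D'(\mathbb R^d;\mathbb C^d)$ on a probability space such that $\langle f,\varphi\rangle$ is a $\mathbb C$-valued centered Gaussian random variable for every $\varphi\in C_0^\infty(\mathbb R^d;\mathbb C^d)$ (real and imaginary parts being jointly Gaussian). Assume that $f$ is generalized microlocally isotropic (GMIG) of order $-m$ in a bounded open set $D\subset\mathbb R^d$: there are matrix symbols $\Sigma^c,\Sigma^r$ such that for all $\varphi,\psi\in C_0^\infty(\mathbb R^d)$ and all $j,l$ $$\mathbb E\big[\langle \overline{f_l},\varphi\rangle\langle f_j,\psi\rangle\big]=\int_{\mathbb R^d}\psi(x)\,\frac1{(2\pi)^d}\int_{\mathbb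 R^d}e^{ix\cdot\xi}\,\Sigma^c_{jl}(x,\xi)\,\hat\varphi(\xi)\,d\xi\,dx,$$ $$\mathbb E\big[\langle f_l,\varphi\rangle\langle f_j,\psi\rangle\big]=\int_{\mathbb R^d}\psi(x)\,\frac1{(2\pi)^d}\int_{\mathbb R^d}e^{ix\cdot\xi}\,\Sigma^r_{jl}(x,\xi)\,\hat\varphi(\xi)\,d\xi\,dx,$$ and, for $\eta\in\{c,r\}$, $\Sigma^\eta\in\mathcal S^{-m}$, $\Sigma^\eta(\cdot,\xi)\in C_0^\infty(D)$ for every $\xi$, and $\Sigma^\eta(x,\xi)=A^\eta(x)|\xi|^{-m}+B^\eta(x,\xi)$ for $|\xi|\ge1$, with $A^\eta\in C_0^\infty(D;\mathbb C^{d\times d})$, $B^\eta\in\mathcal S^{-m-1}$ and $B^\eta(\cdot,\xi)\in C_0^\infty(D)$ for every $\xi$. Here $\mathcal S^{r}$ is the set of smooth $\sigma$ on $\mathbb R^d\times\mathbb R^d$ with $|\partial_\xi^{\alpha}\partial_x^{\beta}\sigma(x,\xi)|\le C_{\alpha,\beta}(1+|\xi|)^{r-|\alpha|}$ for all multi-indices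 $\alpha,\beta$. **Far-field patterns.** For $\hat x\in\mathbb S^{d-1}$ and $\omega>0$, the compressional and shear far-field patterns of the outgoing solution $u$ of the Navier equation $\mu\Delta u+(\lambda+\mu)\nabla\nabla\cdot u+\omega^2u=f$ in $\mathbb R^d$ are the vectors $$u_p^\infty(\hat x,\omega)=-C_dc_p^{\frac{d+1}2}\omega^{\frac{d-3}2}\,\hat x\hat x^\top\!\int_{\mathbb R^d}e^{-ic_p\omega\hat x\cdot y}f(y)\,dy,\qquad u_s^\infty(\hat x,\omega)=-C_dc_s^{\frac{d+1}2}\omega^{\frac{d-3}2}\,(I-\hat x\hat x^\top)\!\int_{\mathbb R^d}e^{-ic_s\omega\hat x\cdot y}f(y)\,dy,$$ where $\int e^{-i\zeta\cdot y}f(y)\,dy$ means $\langle f,\chi e^{-i\zeta\cdot(\cdot)}\rangle$ (componentwise) for any $\chi\in C_0^\infty(\mathbb R^d)$ equal to $1$ in a neighborhood of $\overline D$. **Theorem.** (i) For all $\hat x\in\mathbb S^{d-1}$ and $\tau\ge0$, almost surely $$\begin{aligned}\lim_{Q\to\infty}\frac1Q\int_Q^{2Q}c_s^{m+3-d}\omega^{m+3-d}\Big[&c_p^{-4}u_p^\infty\big(\hat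 x,\tfrac{c_s}{c_p}(\omega+\tau)\big)\overline{u_p^\infty\big(\hat x,\tfrac{c_s}{c_p}\omega\big)}^\top+c_s^{-2}c_p^{-2}u_p^\infty\big(\hat x,\tfrac{c_s}{c_p}(\omega+\tau)\big)\overline{u_s^\infty(\hat x,\omega)}^\top\\&+c_s^{-2}c_p^{-2}u_s^\infty(\hat x,\omega+\tau)\overline{u_p^\infty\big(\hat x,\tfrac{c_s}{c_p}\omega\big)}^\top+c_s^{-4}u_s^\infty(\hat x,\omega+\tau)\overline{u_s^\infty(\hat x,\omega)}^\top\Big]d\omega=|C_d|^2\,\widehat{A^c}(c_s\tau\hat x),\end{aligned}\tag{1}$$ $$\begin{aligned}\lim_{Q\to\infty}\frac1Q\int_Q^{2Q}c_s^{m+3-d}\omega^{m+3-d}\Big[&c_p^{-4}u_p^\infty\big(\hat x,\tfrac{c_s}{c_p}(\omega+\tau)\big)u_p^\infty\big(-\hat x,\tfrac{c_s}{c_p}\omega\big)^\top+c_s^{-2}c_p^{-2}u_p^\infty\big(\hat x,\tfrac{c_s}{c_p}(\omega+\tau)\big)u_s^\infty(-\hat x,\omega)^\top\\&+c_s^{-2}c_p^{-2}u_s^\infty(\hat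 x,\omega+\tau)u_p^\infty\big(-\hat x,\tfrac{c_s}{c_p}\omega\big)^\top+c_s^{-4}u_s^\infty(\hat x,\omega+\tau)u_s^\infty(-\hat x,\omega)^\top\Big]d\omega=C_d^2\,\widehat{A^r}(c_s\tau\hat x).\end{aligned}\tag{2}$$ (ii) Let $\Theta\subset[0,\infty)\times\mathbb S^{d-1}$ be nonempty and (relatively) open. Then a single realization almost surely determines $A^c$ and $A^r$ from the limits in (1) and (2), respectively, with $(\tau,\hat x)\in\Theta$: there are maps $\mathcal R^c,\mathcal R^r$, depending only on $d,\lambda,\mu,m,\Theta$, such that for every source $f$ as above (on any probability space and with any $D$), almost surely, $\mathcal R^c$ applied to the family over $(\tau,\hat x)\in\Theta$ of the realized limits on the left of (1) (recorded as nonexistent where the limit fails to exist) equals $A^c$, and $\mathcal R^r$ applied to the corresponding family for (2) equals $A^r$. -/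

import Mathlib

open MeasureTheory ProbabilityTheory Filter Topology
open scoped Distributions ContDiff NNReal ComplexConjugate Matrix

universe u

noncomputable section

namespace ElasticRandomSource

/-- Physical space `ℝ^d` with its Euclidean norm. -/
abbrev Space (d : ℕ) : Type := EuclideanSpace ℝ (Fin d)

/-- The space `𝓓(ℝ^d; ℂ)` of complex-valued smooth compactly supported test functions. -/
abbrev Test (d : ℕ) : Type := 𝓓((⊤ : TopologicalSpace.Opens (Space d)), ℂ)

/-- The space `𝓓'(ℝ^d; ℂ)` of distributions: continuous linear functionals on test functions. -/
abbrev Distr (d : ℕ) : Type := Test d →L[ℂ] ℂ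

/-! ### Symbols, pseudo-differential operators, Fourier transform -/

/-- The Fourier transform `∫ e^{-i x·ξ} φ(x) dx`. -/
def fourierInt {d : ℕ} (φ : Space d → ℂ) (ξ : Space d) : ℂ :=
  ∫ x, Complex.exp (-(Complex.I * (inner ℝ x ξ : ℝ))) * φ x

/-- The entrywise Fourier transform of a matrix-valued function. -/
def fourierMat {d : ℕ} (A : Space d → Matrix (Fin d) (Fin d) ℂ) (ξ : Space d) :
    Matrix (Fin d) (Fin d) ℂ :=
  Matrix.of fun j l => fourierInt (fun x => A x j l) ξ

/-- The class of smooth functions whose support is a compact subset of `D`. -/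
def IsSmoothCompactIn {d : ℕ} (D : Set (Space d)) (a : Space d → ℂ) : Prop :=
  ContDiff ℝ ∞ a ∧ HasCompactSupport a ∧ tsupport a ⊆ D

/-- The symbol class `S^r(ℝ^d × ℝ^d)`: `σ` is smooth and, for all orders of differentiation,
`|∂_ξ^k ∂_x^l σ(x, ξ)| ≤ C_{k,l} (1 + |ξ|)^{r - k}`. -/
def IsSymbol {d : ℕ} (r : ℝ) (σ : Space d → Space d → ℂ) : Prop :=
  ContDiff ℝ ∞ (fun p : Space d × Space d => σ p.1 p.2) ∧
  ∀ k l : ℕ, ∃ C : ℝ, ∀ x ξ : Space d,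
    ‖iteratedFDeriv ℝ k (fun η => iteratedFDeriv ℝ l (fun y => σ y η) x) ξ‖
      ≤ C * (1 + ‖ξ‖) ^ (r - k)

/-- `σ` is a symbol of order `-m`, supported in `D` with respect to `x`, whose principal part is
`a(x)|ξ|^{-m}` with `a ∈ C_0^∞(D)`. Since `|ξ|^{-m}` is in general not smooth at `ξ = 0`, the
decomposition is required for `|ξ| ≥ 1`. -/
def HasPrincipalSymbol {d : ℕ} (m : ℝ) (D : Set (Space d))
    (σ : Space d → Space d → ℂ) (a : Space d → ℂ) : Prop :=
  IsSymbol (-m) σ ∧ (∀ ξ, IsSmoothCompactIn D (fun x => σ x ξ)) ∧ IsSmoothCompactIn D a ∧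
  ∃ b : Space d → Space d → ℂ,
    IsSymbol (-m - 1) b ∧ (∀ ξ, IsSmoothCompactIn D (fun x => b x ξ)) ∧
    ∀ x ξ, 1 ≤ ‖ξ‖ → σ x ξ = a x * ((‖ξ‖ ^ (-m) : ℝ) : ℂ) + b x ξ

/-- The pseudo-differential operator with symbol `σ`:
`(2π)^{-d} ∫ e^{i x·ξ} σ(x, ξ) φ̂(ξ) dξ`. -/
def pseudoDiff {d : ℕ} (σ : Space d → Space d → ℂ) (φ : Space d → ℂ) (x : Space d) : ℂ :=
  (((2 * Real.pi) ^ d : ℝ) : ℂ)⁻¹ *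
    ∫ ξ, Complex.exp (Complex.I * (inner ℝ x ξ : ℝ)) * σ x ξ * fourierInt φ ξ

/-! ### Generalized microlocally isotropic Gaussian random fields -/

/-- The complex conjugate test function. -/
def conjTest {d : ℕ} (φ : Test d) : Test d :=
  TestFunction.postcompCLM (𝕜 := ℝ) (Complex.conjCLE : ℂ →L[ℝ] ℂ) φ

/-- The pairing `⟨T̄, φ⟩` of the complex conjugate of the distribution `T` with `φ`. -/
def conjPair {d : ℕ} (T : Distr d) (φ : Test d) : ℂ := conj (T (conjTest φ))

/-- `f = (f_1, …, f_d)` is a centered `ℂ^d`-valued generalized microlocally isotropic Gaussian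
random field of order `-m` in the bounded open set `D`, whose covariance and relation operators
have the matrix-valued principal symbols `Ac(x)|ξ|^{-m}` and `Ar(x)|ξ|^{-m}`. -/
structure IsGMIG {d : ℕ} {Ω : Type u} [MeasurableSpace Ω] (P : Measure Ω) (m : ℝ)
    (D : Set (Space d)) (f : Ω → Fin d → Distr d)
    (Ac Ar : Space d → Matrix (Fin d) (Fin d) ℂ) : Prop where
  isOpen_domain : IsOpen D
  isBounded_domain : Bornology.IsBounded D
  /-- For each vector test function `φ`, the pairing `⟨f, φ⟩` is a `ℂ`-valued Gaussian random
  variable (its real and imaginary parts are jointly Gaussian). -/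
  gaussian : ∀ φ : Fin d → Test d, HasGaussianLaw (fun s => ∑ j, f s j (φ j)) P
  centered : ∀ (j : Fin d) (φ : Test d), ∫ s, f s j φ ∂P = 0
  /-- `⟨C_f φ, ψ⟩ = E[⟨f̄, φ⟩⟨f, ψ⟩]`, where the entry `(j, l)` corresponds to `E[f_j(x) f̄_l(y)]`. -/
  covariance : ∃ S : Fin d → Fin d → Space d → Space d → ℂ,
    ∀ j l, HasPrincipalSymbol m D (S j l) (fun x => Ac x j l) ∧
      ∀ φ ψ : Test d,
        ∫ s, conjPair (f s l) φ * f s j ψ ∂P = ∫ x, pseudoDiff (S j l) φ x * ψ x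
  /-- `⟨R_f φ, ψ⟩ = E[⟨f, φ⟩⟨f, ψ⟩]`, where the entry `(j, l)` corresponds to `E[f_j(x) f_l(y)]`. -/
  relation : ∃ S : Fin d → Fin d → Space d → Space d → ℂ,
    ∀ j l, HasPrincipalSymbol m D (S j l) (fun x => Ar x j l) ∧
      ∀ φ ψ : Test d,
        ∫ s, f s l φ * f s j ψ ∂P = ∫ x, pseudoDiff (S j l) φ x * ψ x

/-! ### Far-field patterns -/

/-- `χ` is a cutoff function for `D`: a test function equal to `1` near the closure of `D`. -/
def IsCutoff {d : ℕ} (D : Set (Space d)) (χ : Test d) : Prop :=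
  ∀ᶠ y in 𝓝ˢ (closure D), χ y = 1

/-- The test function `y ↦ χ(y) e^{-i ζ·y}`. -/
def planeWave {d : ℕ} (χ : Test d) (ζ : Space d) : Test d where
  toFun := fun y => χ y * Complex.exp (-(Complex.I * (inner ℝ ζ y : ℝ)))
  contDiff' := by
    have h1 : ContDiff ℝ (⊤ : ℕ∞) (χ : Space d → ℂ) := χ.contDiff
    have h2 : ContDiff ℝ (⊤ : ℕ∞) (fun y : Space d => ((inner ℝ ζ y : ℝ) : ℂ)) :=
      Complex.ofRealCLM.contDiff.comp (contDiff_const.inner ℝ contDiff_id)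
    exact h1.mul ((contDiff_const.mul h2).neg.cexp)
  hasCompactSupport' := χ.hasCompactSupport.mul_right
  tsupport_subset' := fun _ _ => trivial

/-- The vector `∫ e^{-i ζ·y} T(y) dy = (⟨T_j, χ e^{-i ζ·}⟩)_j`; when the `T_j` are supported in
the closure of `D`, it does not depend on the choice of the cutoff `χ` for `D`. -/
def sourceFourier {d : ℕ} (χ : Test d) (T : Fin d → Distr d) (ζ : Space d) : Fin d → ℂ :=
  fun j => T j (planeWave χ ζ)

/-- The constant `C_d` in the far-field expansion of the Helmholtz fundamental solution
(only used for `d = 2` and `d = 3`). -/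
def farFieldConst (d : ℕ) : ℂ :=
  if d = 2 then Complex.exp (Complex.I * (Real.pi / 4 : ℝ)) / (Real.sqrt (8 * Real.pi) : ℝ)
  else 1 / (4 * Real.pi : ℝ)

/-- The compressional slowness `c_p = (λ + 2μ)^{-1/2}`. -/
def cP (lam mu : ℝ) : ℝ := (lam + 2 * mu) ^ (-(1 / 2) : ℝ)

/-- The shear slowness `c_s = μ^{-1/2}`. -/
def cS (mu : ℝ) : ℝ := mu ^ (-(1 / 2) : ℝ)

/-- The projection matrix `x̂ x̂ᵀ`. -/
def projP {d : ℕ} (xhat : Space d) : Matrix (Fin d) (Fin d) ℂ :=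
  Matrix.of fun j l => ((xhat j * xhat l : ℝ) : ℂ)

/-- The compressional far-field pattern at angular frequency `w` generated by the source `T` in
the Navier equation `μΔu + (λ+μ)∇∇·u + w²u = T`:
`-C_d c_p^{(d+1)/2} w^{(d-3)/2} x̂x̂ᵀ ∫ e^{-i c_p w x̂·y} T(y) dy`. -/
def farFieldP {d : ℕ} (lam mu : ℝ) (χ : Test d) (T : Fin d → Distr d)
    (xhat : Space d) (w : ℝ) : Fin d → ℂ :=
  (-(farFieldConst d * ((cP lam mu ^ (((d : ℝ) + 1) / 2) * w ^ (((d : ℝ) - 3) / 2) : ℝ) : ℂ))) •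
    (projP xhat *ᵥ sourceFourier χ T ((cP lam mu * w) • xhat))

/-- The shear far-field pattern at angular frequency `w` generated by the source `T` in the
Navier equation `μΔu + (λ+μ)∇∇·u + w²u = T`:
`-C_d c_s^{(d+1)/2} w^{(d-3)/2} (I - x̂x̂ᵀ) ∫ e^{-i c_s w x̂·y} T(y) dy`. -/
def farFieldS {d : ℕ} (mu : ℝ) (χ : Test d) (T : Fin d → Distr d)
    (xhat : Space d) (w : ℝ) : Fin d → ℂ :=
  (-(farFieldConst d * ((cS mu ^ (((d : ℝ) + 1) / 2) * w ^ (((d : ℝ) - 3) / 2) : ℝ) : ℂ))) •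
    ((1 - projP xhat) *ᵥ sourceFourier χ T ((cS mu * w) • xhat))

/-! ### Cross-correlations averaged over the frequency band -/

/-- The weighted combination
`c_p^{-4} p qᵀ + c_s^{-2}c_p^{-2} p tᵀ + c_s^{-2}c_p^{-2} r qᵀ + c_s^{-4} r tᵀ`
of the products of vectors `p, r` (compressional, shear) with `q, t` (compressional, shear). -/
def combine {d : ℕ} (lam mu : ℝ) (p r q t : Fin d → ℂ) : Matrix (Fin d) (Fin d) ℂ :=
  ((cP lam mu ^ (-4 : ℤ) : ℝ) : ℂ) • Matrix.vecMulVec p q +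
  ((cS mu ^ (-2 : ℤ) * cP lam mu ^ (-2 : ℤ) : ℝ) : ℂ) • Matrix.vecMulVec p t +
  ((cS mu ^ (-2 : ℤ) * cP lam mu ^ (-2 : ℤ) : ℝ) : ℂ) • Matrix.vecMulVec r q +
  ((cS mu ^ (-4 : ℤ) : ℝ) : ℂ) • Matrix.vecMulVec r t

/-- The combination at frequency `w` of the correlations
`u^∞(x̂, w + τ) conj(u^∞(x̂, w))ᵀ`, where compressional patterns are taken at frequencies
rescaled by `c_s / c_p`. -/
def corrC {d : ℕ} (lam mu : ℝ) (χ : Test d) (T : Fin d → Distr d) (xhat : Space d)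
    (τ w : ℝ) : Matrix (Fin d) (Fin d) ℂ :=
  combine lam mu
    (farFieldP lam mu χ T xhat (cS mu * (cP lam mu)⁻¹ * (w + τ)))
    (farFieldS mu χ T xhat (w + τ))
    (fun l => conj (farFieldP lam mu χ T xhat (cS mu * (cP lam mu)⁻¹ * w) l))
    (fun l => conj (farFieldS mu χ T xhat w l))

/-- The combination at frequency `w` of the correlations
`u^∞(x̂, w + τ) u^∞(-x̂, w)ᵀ`, where compressional patterns are taken at frequencies
rescaled by `c_s / c_p`. -/
def corrR {d : ℕ} (lam mu : ℝ) (χ : Test d) (T : Fin d → Distr d) (xhat : Space d)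
    (τ w : ℝ) : Matrix (Fin d) (Fin d) ℂ :=
  combine lam mu
    (farFieldP lam mu χ T xhat (cS mu * (cP lam mu)⁻¹ * (w + τ)))
    (farFieldS mu χ T xhat (w + τ))
    (farFieldP lam mu χ T (-xhat) (cS mu * (cP lam mu)⁻¹ * w))
    (farFieldS mu χ T (-xhat) w)

/-- The entrywise weighted average
`(1/Q) ∫_Q^{2Q} c_s^{m+3-d} w^{m+3-d} M(w) dw` over the frequency band `[Q, 2Q]`. -/
def bandAverage {d : ℕ} (mu m : ℝ) (M : ℝ → Matrix (Fin d) (Fin d) ℂ) (Q : ℝ) :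
    Matrix (Fin d) (Fin d) ℂ :=
  Matrix.of fun j l => ((1 / Q : ℝ) : ℂ) *
    ∫ w in Q..(2 * Q), ((cS mu ^ (m + 3 - d) * w ^ (m + 3 - d) : ℝ) : ℂ) * M w j l

/-- Directions of observation `x̂ ∈ 𝕊^{d-1}`. -/
abbrev Direction (d : ℕ) : Type := Metric.sphere (0 : Space d) 1

/-- The set of limits as `Q → ∞` of a matrix-valued function (at most one element). -/
def limits {d : ℕ} (g : ℝ → Matrix (Fin d) (Fin d) ℂ) : Set (Matrix (Fin d) (Fin d) ℂ) :=
  {L | Tendsto g atTop (𝓝 L)}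

end ElasticRandomSource

end

open ElasticRandomSource

namespace ElasticRandomSource

/-! ### Fourth moments of Gaussian variables -/

/-! Write `F(ζ)` for the Fourier transform of the source at `ζ`. At the rescaled frequencies both
far-field patterns sample `F` at the same point `c_s ω x̂`, and `c_p^{-2} u_p + c_s^{-2} u_s`
carries a common scalar in front of complementary projections (`farField_add`). The four-term
bracket factors, so up to the constant each entry of (1) and (2) is the band average of `a(ω) U(ω)
V(ω)`, with `a` deterministic, `U = F_j(c_s(ω+τ)x̂)`, and `V` either the conjugate of `F_l(c_s ω
x̂)` or `F_l(-c_s ω x̂)`.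

The mean. A second moment of `F` is the bilinear form of a pseudo-differential operator on two plane
waves. Fubini turns it into a convolution of the transform of a cutoff with the `x`-transform of the
symbol (`covKernel_eq`). At high frequency only the principal part survives, and the convolution
collapses to the transform of the strength at the frequency difference (`tendsto_covKernel`). The
same representation bounds the moment by symmetric weights `(1+|ζ|)^{-m/2}` times one power of decay
in `|ζ₁-ζ₂|` (`norm_covKernel_le`).

The fluctuations. By Wick's formula the covariance of `U V` at `ω` and `ω'` is a sum of two products
of two second moments, hence `O((1+|ω-ω'|)^{-2})` after weighting, which is integrable. The centered
integral over `[1,T]` then has variance `O(T)`; sampling at `T = n²` makes the normalized variances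
summable, and the gaps between squares are short enough to be bounded crudely
(`ae_tendsto_band_average`). Sample paths are continuous in the frequency, so all integrals make
sense for each realization.

Recovery. Almost surely the limits hold simultaneously on a countable dense subset of `Θ`.
Continuity extends the known values of the transform to all of `Θ`, whose image under `(τ, x̂) ↦ c_s
τ x̂` contains an open set. The transform of a compactly supported function is entire along lines,
so it is determined everywhere, and Fourier inversion gives the strength. -/

theorem integral_pow_four_gaussianReal (v : ℝ≥0) :
    ∫ x, x ^ 4 ∂(gaussianReal 0 v) = 3 * (v : ℝ) ^ 2 := by
  have h := iteratedDeriv_mgf_zero (X := (id : ℝ → ℝ)) (μ := gaussianReal 0 v)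
    (by simp [integrableExpSet_id_gaussianReal]) 4
  -- Differentiation sends `p e^{vt²/2}` to `(p' + v t p) e^{vt²/2}`; four applications starting
  -- from `p = 1` leave a polynomial whose value at `0` is the fourth moment.
  have hd : ∀ p q r : ℝ → ℝ, (∀ t, HasDerivAt p (q t) t) → (∀ t, q t + p t * (v * t) = r t) →
      deriv (fun t : ℝ => p t * Real.exp (v * t ^ 2 / 2))
        = fun t => r t * Real.exp (v * t ^ 2 / 2) := by
    intro p q r hp hr
    funext t
    have h1 : HasDerivAt (fun t : ℝ => (v : ℝ) * t ^ 2 / 2) (v * t) t :=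
      (((hasDerivAt_pow 2 t).const_mul (v : ℝ)).div_const 2).congr_deriv (by push_cast; ring)
    have h2 : HasDerivAt (fun t : ℝ => p t * Real.exp (v * t ^ 2 / 2)) _ t := (hp t).mul h1.exp
    rw [h2.deriv, ← hr]
    ring
  have hm : mgf (id : ℝ → ℝ) (gaussianReal 0 v) = fun t => 1 * Real.exp (v * t ^ 2 / 2) := by
    rw [mgf_id_gaussianReal]
    simp
  rw [hm, iteratedDeriv_succ', iteratedDeriv_succ', iteratedDeriv_succ', iteratedDeriv_one,
    hd (fun _ => 1) (fun _ => 0) (fun t => v * t) (fun t => hasDerivAt_const t 1)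
      (fun t => by ring),
    hd (fun t => v * t) (fun t => v) (fun t => v + v ^ 2 * t ^ 2) (fun t =>
      ((hasDerivAt_id t).const_mul (v : ℝ)).congr_deriv (by ring)) (fun t => by ring),
    hd (fun t => v + v ^ 2 * t ^ 2) (fun t => 2 * v ^ 2 * t)
      (fun t => 3 * v ^ 2 * t + v ^ 3 * t ^ 3) (fun t =>
      (((hasDerivAt_pow 2 t).const_mul ((v : ℝ) ^ 2)).const_add (v : ℝ)).congr_deriv
        (by push_cast; ring)) (fun t => by ring),
    hd (fun t => 3 * v ^ 2 * t + v ^ 3 * t ^ 3) (fun t => 3 * v ^ 2 + 3 * v ^ 3 * t ^ 2)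
      (fun t => 3 * v ^ 2 + 6 * v ^ 3 * t ^ 2 + v ^ 4 * t ^ 4) (fun t =>
      (((hasDerivAt_id t).const_mul (3 * (v : ℝ) ^ 2)).add
        ((hasDerivAt_pow 3 t).const_mul ((v : ℝ) ^ 3))).congr_deriv (by push_cast; ring))
      (fun t => by ring)] at h
  simp at h
  rw [← h]

theorem integral_pow_four_of_hasGaussianLaw {Ω : Type*} [MeasurableSpace Ω] {P : Measure Ω}
    {X : Ω → ℝ} (hX : HasGaussianLaw X P) (h0 : ∫ s, X s ∂P = 0) :
    ∫ s, X s ^ 4 ∂P = 3 * (∫ s, X s ^ 2 ∂P) ^ 2 := by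
  have := hX.isProbabilityMeasure
  have hv : Var[X; P] = ∫ s, X s ^ 2 ∂P := variance_of_integral_eq_zero hX.aemeasurable h0
  have hmap := hX.map_eq_gaussianReal
  rw [h0] at hmap
  rw [← integral_map (f := fun x : ℝ => x ^ 4) hX.aemeasurable (by fun_prop), hmap,
    integral_pow_four_gaussianReal, ← hv, Real.coe_toNNReal _ (variance_nonneg _ _)]

/-! ### Wick's formula for products of four complex Gaussian variables -/

/-- A complex vector space of random variables, all of whose moments are finite, on which fourth
moments are three times the squares of second moments. -/
structure IsWickSpace {Ω : Type*} [MeasurableSpace Ω] (P : Measure Ω)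
    (W : Submodule ℂ (Ω → ℂ)) : Prop where
  memLp : ∀ Z ∈ W, ∀ p : ENNReal, p ≠ ⊤ → MemLp Z p P
  fourth : ∀ Z ∈ W, ∫ s, Z s ^ 4 ∂P = 3 * (∫ s, Z s ^ 2 ∂P) ^ 2

section Wick

variable {Ω : Type*} [MeasurableSpace Ω] {P : Measure Ω} {W : Submodule ℂ (Ω → ℂ)}

theorem IsWickSpace.memLp_mul (hW : IsWickSpace P W) {Z₁ Z₂ : Ω → ℂ} (h₁ : Z₁ ∈ W) (h₂ : Z₂ ∈ W)
    (p : ENNReal) (hp : p ≠ ⊤) : MemLp (fun s => Z₁ s * Z₂ s) p P := by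
  have : ENNReal.HolderTriple (2 * p) (2 * p) p := by
    constructor
    rw [ENNReal.mul_inv (by simp) (by simp), ← add_mul, ENNReal.inv_two_add_inv_two, one_mul]
  have h2p : 2 * p ≠ ⊤ := ENNReal.mul_ne_top (by simp) hp
  exact (hW.memLp Z₂ h₂ _ h2p).mul (hW.memLp Z₁ h₁ _ h2p)

theorem IsWickSpace.integrable_mul (hW : IsWickSpace P W) {Z₁ Z₂ : Ω → ℂ} (h₁ : Z₁ ∈ W)
    (h₂ : Z₂ ∈ W) : Integrable (fun s => Z₁ s * Z₂ s) P :=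
  memLp_one_iff_integrable.1 (hW.memLp_mul h₁ h₂ 1 (by simp))

theorem IsWickSpace.integrable_mul₄ (hW : IsWickSpace P W) {Z₁ Z₂ Z₃ Z₄ : Ω → ℂ} (h₁ : Z₁ ∈ W)
    (h₂ : Z₂ ∈ W) (h₃ : Z₃ ∈ W) (h₄ : Z₄ ∈ W) :
    Integrable (fun s => Z₁ s * Z₂ s * (Z₃ s * Z₄ s)) P :=
  (hW.memLp_mul h₁ h₂ 2 (by simp)).integrable_mul (hW.memLp_mul h₃ h₄ 2 (by simp))

/-- Polarization: a symmetric 4-linear form is determined by its diagonal, and on the diagonal the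
identity is the defining property of a Wick space. Linear combinations stay in `W`, which is why a
complex subspace is required. -/
theorem IsWickSpace.integral_mul₄ (hW : IsWickSpace P W) {Z₁ Z₂ Z₃ Z₄ : Ω → ℂ} (h₁ : Z₁ ∈ W)
    (h₂ : Z₂ ∈ W) (h₃ : Z₃ ∈ W) (h₄ : Z₄ ∈ W) :
    ∫ s, Z₁ s * Z₂ s * (Z₃ s * Z₄ s) ∂P =
      (∫ s, Z₁ s * Z₂ s ∂P) * (∫ s, Z₃ s * Z₄ s ∂P) +
      (∫ s, Z₁ s * Z₃ s ∂P) * (∫ s, Z₂ s * Z₄ s ∂P) +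
      (∫ s, Z₁ s * Z₄ s ∂P) * (∫ s, Z₂ s * Z₃ s ∂P) := by
  have hi : ∀ Z ∈ W, Integrable (fun s => Z s ^ 4) P := by
    intro Z hZ
    have := hW.integrable_mul₄ hZ hZ hZ hZ
    refine this.congr (Eventually.of_forall fun s => ?_)
    simp only; ring
  have hmem : ∀ b c e : ℂ, (fun s => Z₁ s + b * Z₂ s + c * Z₃ s + e * Z₄ s) ∈ W := fun b c e =>
    W.add_mem (W.add_mem (W.add_mem h₁ (W.smul_mem b h₂)) (W.smul_mem c h₃)) (W.smul_mem e h₄)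
  have hsq : ∀ b c e : ℂ, ∫ s, (Z₁ s + b * Z₂ s + c * Z₃ s + e * Z₄ s) ^ 2 ∂P =
      (∫ s, Z₁ s * Z₁ s ∂P) + b ^ 2 * (∫ s, Z₂ s * Z₂ s ∂P) + c ^ 2 * (∫ s, Z₃ s * Z₃ s ∂P)
      + e ^ 2 * (∫ s, Z₄ s * Z₄ s ∂P) + 2 * b * (∫ s, Z₁ s * Z₂ s ∂P)
      + 2 * c * (∫ s, Z₁ s * Z₃ s ∂P) + 2 * e * (∫ s, Z₁ s * Z₄ s ∂P)
      + 2 * (b * c) * (∫ s, Z₂ s * Z₃ s ∂P) + 2 * (b * e) * (∫ s, Z₂ s * Z₄ s ∂P)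
      + 2 * (c * e) * (∫ s, Z₃ s * Z₄ s ∂P) := by
    intro b c e
    have i11 := hW.integrable_mul h₁ h₁
    have i22 := hW.integrable_mul h₂ h₂
    have i33 := hW.integrable_mul h₃ h₃
    have i44 := hW.integrable_mul h₄ h₄
    have i12 := hW.integrable_mul h₁ h₂
    have i13 := hW.integrable_mul h₁ h₃
    have i14 := hW.integrable_mul h₁ h₄
    have i23 := hW.integrable_mul h₂ h₃
    have i24 := hW.integrable_mul h₂ h₄
    have i34 := hW.integrable_mul h₃ h₄
    simp only [← integral_const_mul]
    iterate 9 rw [← integral_add (by fun_prop) (by fun_prop)]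
    congr 1; funext s; ring
  have h4 := fun b c e => hW.fourth _ (hmem b c e)
  simp only [hsq] at h4
  -- The signed sum over the eight choices of signs of `Z₂, Z₃, Z₄` keeps only the monomial
  -- `Z₁Z₂Z₃Z₄`, with coefficient `8 · 4! = 192`.
  have hexp : ∫ s, Z₁ s * Z₂ s * (Z₃ s * Z₄ s) ∂P = (1 / 192 : ℂ) *
      ((∫ s, (Z₁ s + 1 * Z₂ s + 1 * Z₃ s + 1 * Z₄ s) ^ 4 ∂P)
      - (∫ s, (Z₁ s + 1 * Z₂ s + 1 * Z₃ s + (-1) * Z₄ s) ^ 4 ∂P)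
      - (∫ s, (Z₁ s + 1 * Z₂ s + (-1) * Z₃ s + 1 * Z₄ s) ^ 4 ∂P)
      + (∫ s, (Z₁ s + 1 * Z₂ s + (-1) * Z₃ s + (-1) * Z₄ s) ^ 4 ∂P)
      - (∫ s, (Z₁ s + (-1) * Z₂ s + 1 * Z₃ s + 1 * Z₄ s) ^ 4 ∂P)
      + (∫ s, (Z₁ s + (-1) * Z₂ s + 1 * Z₃ s + (-1) * Z₄ s) ^ 4 ∂P)
      + (∫ s, (Z₁ s + (-1) * Z₂ s + (-1) * Z₃ s + 1 * Z₄ s) ^ 4 ∂P)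
      - (∫ s, (Z₁ s + (-1) * Z₂ s + (-1) * Z₃ s + (-1) * Z₄ s) ^ 4 ∂P)) := by
    have j := fun b c e => hi _ (hmem b c e)
    have j1 := j 1 1 1
    have j2 := j 1 1 (-1)
    have j3 := j 1 (-1) 1
    have j4 := j 1 (-1) (-1)
    have j5 := j (-1) 1 1
    have j6 := j (-1) 1 (-1)
    have j7 := j (-1) (-1) 1
    have j8 := j (-1) (-1) (-1)
    rw [← integral_sub (by fun_prop) (by fun_prop), ← integral_sub (by fun_prop) (by fun_prop),
      ← integral_add (by fun_prop) (by fun_prop), ← integral_sub (by fun_prop) (by fun_prop),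
      ← integral_add (by fun_prop) (by fun_prop), ← integral_add (by fun_prop) (by fun_prop),
      ← integral_sub (by fun_prop) (by fun_prop), ← integral_const_mul]
    congr 1; funext s
    ring
  rw [hexp, h4, h4, h4, h4, h4, h4, h4, h4]
  ring

end Wick

/-- For real `t` the variable `A + tB` is a centered real Gaussian, so both sides with `t` in place
of `I` are polynomials of degree four in `t` that agree on the real line. Their coefficients
coincide, and `t = I` may be substituted. -/
theorem integral_pow_four_of_line {Ω : Type*} [MeasurableSpace Ω] {P : Measure Ω} {A B : Ω → ℝ}
    (hG : ∀ t : ℝ, HasGaussianLaw (fun s => A s + t * B s) P) (hA0 : ∫ s, A s ∂P = 0)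
    (hB0 : ∫ s, B s ∂P = 0) (hA : ∀ p : ENNReal, p ≠ ⊤ → MemLp A p P)
    (hB : ∀ p : ENNReal, p ≠ ⊤ → MemLp B p P) :
    ∫ s, ((A s : ℂ) + Complex.I * B s) ^ 4 ∂P
      = 3 * (∫ s, ((A s : ℂ) + Complex.I * B s) ^ 2 ∂P) ^ 2 := by
  have hm : ∀ {X Y : Ω → ℝ}, (∀ p : ENNReal, p ≠ ⊤ → MemLp X p P) →
      (∀ p : ENNReal, p ≠ ⊤ → MemLp Y p P) → ∀ p : ENNReal, p ≠ ⊤ →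
      MemLp (fun s => X s * Y s) p P := by
    intro X Y hX hY p hp
    have : ENNReal.HolderTriple (2 * p) (2 * p) p := by
      constructor
      rw [ENNReal.mul_inv (by simp) (by simp), ← add_mul, ENNReal.inv_two_add_inv_two, one_mul]
    have h2p : 2 * p ≠ ⊤ := ENNReal.mul_ne_top (by simp) hp
    exact (hY _ h2p).mul (hX _ h2p)
  have hint : ∀ {X : Ω → ℝ}, (∀ p : ENNReal, p ≠ ⊤ → MemLp X p P) → Integrable X P :=
    fun hX => memLp_one_iff_integrable.1 (hX 1 (by simp))
  have hAA := hm hA hA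
  have hAB := hm hA hB
  have hBB := hm hB hB
  have i20 := hint hAA
  have i11 := hint hAB
  have i02 := hint hBB
  have i40 := hint (hm hAA hAA)
  have i31 := hint (hm hAA hAB)
  have i22 := hint (hm hAA hBB)
  have i13 := hint (hm hAB hBB)
  have i04 := hint (hm hBB hBB)
  have iA := hint hA
  have iB := hint hB
  set m20 := ∫ s, A s * A s ∂P with h20
  set m11 := ∫ s, A s * B s ∂P with h11
  set m02 := ∫ s, B s * B s ∂P with h02
  set M40 := ∫ s, A s * A s * (A s * A s) ∂P with h40
  set M31 := ∫ s, A s * A s * (A s * B s) ∂P with h31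
  set M22 := ∫ s, A s * A s * (B s * B s) ∂P with h22
  set M13 := ∫ s, A s * B s * (B s * B s) ∂P with h13
  set M04 := ∫ s, B s * B s * (B s * B s) ∂P with h04
  have key : ∀ t : ℝ, M40 + 4 * t * M31 + 6 * t ^ 2 * M22 + 4 * t ^ 3 * M13 + t ^ 4 * M04
      = 3 * (m20 + 2 * t * m11 + t ^ 2 * m02) ^ 2 := by
    intro t
    have h := integral_pow_four_of_hasGaussianLaw (hG t) (by
      rw [integral_add iA (iB.const_mul t), integral_const_mul, hA0, hB0]; simp)
    have e4 : ∫ s, (A s + t * B s) ^ 4 ∂P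
        = M40 + 4 * t * M31 + 6 * t ^ 2 * M22 + 4 * t ^ 3 * M13 + t ^ 4 * M04 := by
      rw [h40, h31, h22, h13, h04]
      simp only [← integral_const_mul]
      iterate 4 rw [← integral_add (by fun_prop) (by fun_prop)]
      congr 1; funext s; ring
    have e2 : ∫ s, (A s + t * B s) ^ 2 ∂P = m20 + 2 * t * m11 + t ^ 2 * m02 := by
      rw [h20, h11, h02]
      simp only [← integral_const_mul]
      iterate 2 rw [← integral_add (by fun_prop) (by fun_prop)]
      congr 1; funext s; ring
    rw [← e4, h, e2]
  -- Five values of `t` determine the five coefficients.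
  have k0 := key 0
  have k1 := key 1
  have k2 := key (-1)
  have k3 := key 2
  have k4 := key (-2)
  have r0 : M40 = 3 * m20 ^ 2 := by linarith
  have r1 : M31 = 3 * m20 * m11 := by linarith
  have r2 : M22 = m20 * m02 + 2 * m11 ^ 2 := by linarith
  have r3 : M13 = 3 * m11 * m02 := by linarith
  have r4 : M04 = 3 * m02 ^ 2 := by linarith
  have f4 : ∫ s, ((A s : ℂ) + Complex.I * B s) ^ 4 ∂P
      = M40 + 4 * Complex.I * M31 - 6 * M22 - 4 * Complex.I * M13 + M04 := by
    have j40 : Integrable (fun s => ((A s * A s * (A s * A s) : ℝ) : ℂ)) P := i40.ofReal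
    have j31 : Integrable (fun s => ((A s * A s * (A s * B s) : ℝ) : ℂ)) P := i31.ofReal
    have j22 : Integrable (fun s => ((A s * A s * (B s * B s) : ℝ) : ℂ)) P := i22.ofReal
    have j13 : Integrable (fun s => ((A s * B s * (B s * B s) : ℝ) : ℂ)) P := i13.ofReal
    have j04 : Integrable (fun s => ((B s * B s * (B s * B s) : ℝ) : ℂ)) P := i04.ofReal
    rw [h40, h31, h22, h13, h04]
    simp only [← integral_complex_ofReal, ← integral_const_mul]
    rw [← integral_add (by fun_prop) (by fun_prop), ← integral_sub (by fun_prop) (by fun_prop),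
      ← integral_sub (by fun_prop) (by fun_prop), ← integral_add (by fun_prop) (by fun_prop)]
    congr 1; funext s
    push_cast
    linear_combination ((6 : ℂ) * A s ^ 2 * B s ^ 2 + 4 * A s * B s ^ 3 * Complex.I
      + (B s : ℂ) ^ 4 * (Complex.I ^ 2 - 1)) * Complex.I_sq
  have f2 : ∫ s, ((A s : ℂ) + Complex.I * B s) ^ 2 ∂P = m20 + 2 * Complex.I * m11 - m02 := by
    have j20 : Integrable (fun s => ((A s * A s : ℝ) : ℂ)) P := i20.ofReal
    have j11 : Integrable (fun s => ((A s * B s : ℝ) : ℂ)) P := i11.ofReal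
    have j02 : Integrable (fun s => ((B s * B s : ℝ) : ℂ)) P := i02.ofReal
    rw [h20, h11, h02]
    simp only [← integral_complex_ofReal, ← integral_const_mul]
    rw [← integral_add (by fun_prop) (by fun_prop), ← integral_sub (by fun_prop) (by fun_prop)]
    congr 1; funext s
    push_cast
    linear_combination ((B s : ℂ) ^ 2) * Complex.I_sq
  rw [f4, f2, r0, r1, r2, r3, r4]
  push_cast
  linear_combination (-12 * (m11 : ℂ) ^ 2) * Complex.I_sq

/-! ### Pairings of a Gaussian field form a Wick space -/

section Field

variable {d : ℕ} {Ω : Type*} {f : Ω → Fin d → Distr d}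

/-- The pairing of a vector-valued distribution with a vector test function. -/
noncomputable def vecPair (T : Fin d → Distr d) (φ : Fin d → Test d) : ℂ := ∑ j, T j (φ j)

theorem vecPair_add (T : Fin d → Distr d) (φ ψ : Fin d → Test d) :
    vecPair T (φ + ψ) = vecPair T φ + vecPair T ψ := by
  simp [vecPair, Finset.sum_add_distrib]

theorem vecPair_smul (T : Fin d → Distr d) (c : ℂ) (φ : Fin d → Test d) :
    vecPair T (c • φ) = c * vecPair T φ := by
  simp [vecPair, Finset.mul_sum]

theorem vecPair_single (T : Fin d → Distr d) (j : Fin d) (φ : Test d) :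
    vecPair T (Pi.single j φ) = T j φ := by
  rw [vecPair, Finset.sum_eq_single j]
  · simp
  · intro i _ hi
    simp [Pi.single_eq_of_ne hi]
  · simp

/-- The complex vector space spanned by the real and imaginary parts of the pairings of a random
vector-valued distribution with test functions. -/
def fieldSpace (f : Ω → Fin d → Distr d) : Submodule ℂ (Ω → ℂ) where
  carrier := {Z | ∃ a b : Fin d → Test d,
    ∀ s, Z s = ((vecPair (f s) a).re : ℂ) + Complex.I * ((vecPair (f s) b).re : ℂ)}
  add_mem' := by
    rintro Z Z' ⟨a, b, h⟩ ⟨a', b', h'⟩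
    refine ⟨a + a', b + b', fun s => ?_⟩
    simp only [Pi.add_apply, h, h', vecPair_add, Complex.add_re, Complex.ofReal_add]
    ring
  zero_mem' := ⟨0, 0, fun s => by simp [vecPair]⟩
  smul_mem' := by
    rintro c Z ⟨a, b, h⟩
    refine ⟨(c.re : ℂ) • a + (-(c.im : ℂ)) • b, (c.im : ℂ) • a + (c.re : ℂ) • b, fun s => ?_⟩
    simp only [Pi.smul_apply, h, vecPair_add, vecPair_smul, smul_eq_mul, Complex.add_re,
      Complex.ofReal_add, Complex.re_ofReal_mul, neg_mul, Complex.neg_re, Complex.ofReal_neg,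
      Complex.ofReal_mul]
    conv_lhs => rw [← Complex.re_add_im c]
    linear_combination ((c.im : ℂ) * (vecPair (f s) b).re) * Complex.I_sq

/-- Since `Im z = Re(-iz)`, the imaginary part of a pairing is the real part of the pairing with
`-iφ`; the conjugate below uses `iφ` instead. -/
theorem apply_mem_fieldSpace (j : Fin d) (φ : Test d) : (fun s => f s j φ) ∈ fieldSpace f := by
  refine ⟨Pi.single j φ, (-Complex.I) • Pi.single j φ, fun s => ?_⟩
  rw [vecPair_smul, vecPair_single]
  apply Complex.ext <;> simp

theorem conj_apply_mem_fieldSpace (j : Fin d) (φ : Test d) :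
    (fun s => conj (f s j φ)) ∈ fieldSpace f := by
  refine ⟨Pi.single j φ, Complex.I • Pi.single j φ, fun s => ?_⟩
  rw [vecPair_smul, vecPair_single]
  apply Complex.ext <;> simp

/-- For `A = Re⟨f,a⟩` and `B = Re⟨f,b⟩`, the variable `A + tB` is the real part of the pairing with
`a + tb`, hence Gaussian for every real `t`. Gaussianity of each vector pairing thus yields the
joint statement needed for `integral_pow_four_of_line`. -/
theorem isWickSpace_fieldSpace [MeasurableSpace Ω] {P : Measure Ω}
    (hG : ∀ φ : Fin d → Test d, HasGaussianLaw (fun s => ∑ j, f s j (φ j)) P)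
    (h0 : ∀ (j : Fin d) (φ : Test d), ∫ s, f s j φ ∂P = 0) : IsWickSpace P (fieldSpace f) := by
  have hG' : ∀ φ, HasGaussianLaw (fun s => (vecPair (f s) φ).re) P := fun φ =>
    (hG φ).map_fun Complex.reCLM
  have hj : ∀ j φ, Integrable (fun s => f s j φ) P := fun j φ => by
    have := (hG (Pi.single j φ)).integrable
    exact this.congr (Eventually.of_forall fun s => vecPair_single (f s) j φ)
  have hL : ∀ φ, ∀ p : ENNReal, p ≠ ⊤ → MemLp (fun s => (vecPair (f s) φ).re) p P :=
    fun φ p hp => (hG' φ).memLp hp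
  have hm : ∀ φ, ∫ s, (vecPair (f s) φ).re ∂P = 0 := by
    intro φ
    have h1 : ∫ s, (vecPair (f s) φ).re ∂P = (∫ s, vecPair (f s) φ ∂P).re := by
      have hi : Integrable (fun s => vecPair (f s) φ) P := (hG φ).integrable
      exact Complex.reCLM.integral_comp_comm hi
    have h2 : ∫ s, vecPair (f s) φ ∂P = 0 := by
      have h3 : ∫ s, vecPair (f s) φ ∂P = ∑ j, ∫ s, f s j (φ j) ∂P :=
        integral_finsetSum Finset.univ (f := fun j s => f s j (φ j)) fun j _ => hj j (φ j)
      rw [h3]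
      exact Finset.sum_eq_zero fun j _ => h0 j (φ j)
    rw [h1, h2, Complex.zero_re]
  refine ⟨?_, ?_⟩
  · rintro Z ⟨a, b, h⟩ p hp
    rw [funext h]
    have hc : ∀ φ, MemLp (fun s => ((vecPair (f s) φ).re : ℂ)) p P := fun φ =>
      Complex.ofRealCLM.comp_memLp' (hL φ p hp)
    exact MemLp.add (hc a) (MemLp.const_mul (hc b) Complex.I)
  · rintro Z ⟨a, b, h⟩
    simp only [h]
    refine integral_pow_four_of_line (fun t => ?_) (hm a) (hm b) (hL a) (hL b)
    have h := hG' (a + (t : ℂ) • b)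
    simpa only [vecPair_add, vecPair_smul, Complex.add_re, Complex.re_ofReal_mul] using h

end Field

/-! ### Elementary weights -/

/-- Peetre's inequality: `1 + ‖·‖` is submultiplicative over sums; for negative `s` this is applied
to `a = (a + b) - b`. -/
theorem peetre_rpow {E : Type*} [NormedAddCommGroup E] (a b : E) (s : ℝ) :
    (1 + ‖a + b‖) ^ s ≤ (1 + ‖a‖) ^ s * (1 + ‖b‖) ^ |s| := by
  have ha := norm_nonneg a
  have hb := norm_nonneg b
  have hab := norm_nonneg (a + b)
  have h1 : 1 + ‖a + b‖ ≤ (1 + ‖a‖) * (1 + ‖b‖) := by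
    nlinarith [norm_add_le a b, mul_nonneg ha hb]
  have h2 : 1 + ‖a‖ ≤ (1 + ‖a + b‖) * (1 + ‖b‖) := by
    have : ‖a‖ ≤ ‖a + b‖ + ‖b‖ := by simpa using norm_sub_le (a + b) b
    nlinarith [mul_nonneg hab hb]
  rcases le_total 0 s with hs | hs
  · rw [abs_of_nonneg hs, ← Real.mul_rpow (by positivity) (by positivity)]
    exact Real.rpow_le_rpow (by positivity) h1 hs
  · rw [abs_of_nonpos hs, Real.rpow_neg (by positivity), ← div_eq_mul_inv,
      le_div_iff₀ (by positivity), ← Real.mul_rpow (by positivity) (by positivity)]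
    exact Real.rpow_le_rpow_of_nonpos (by positivity) h2 hs

/-! ### Fourier transforms of smooth compactly supported functions -/

section Fourier

variable {d : ℕ}

theorem norm_cexp_neg_I_mul (r : ℝ) : ‖Complex.exp (-(Complex.I * (r : ℂ)))‖ = 1 := by
  rw [← mul_neg, mul_comm, ← Complex.ofReal_neg, Complex.norm_exp_ofReal_mul_I]

open FourierTransform in
theorem fourierInt_eq_fourier (u : Space d → ℂ) (ξ : Space d) :
    fourierInt u ξ = 𝓕 u ((2 * Real.pi)⁻¹ • ξ) := by
  rw [fourierInt, Real.fourier_eq']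
  congr 1
  funext x
  rw [smul_eq_mul, inner_smul_right]
  congr 2
  have : (Real.pi : ℂ) ≠ 0 := by exact_mod_cast Real.pi_ne_zero
  push_cast
  field_simp

theorem norm_fourierInt_le (u : Space d → ℂ) (ξ : Space d) : ‖fourierInt u ξ‖ ≤ ∫ x, ‖u x‖ := by
  refine (norm_integral_le_integral_norm _).trans_eq ?_
  congr 1
  funext x
  rw [norm_mul, norm_cexp_neg_I_mul, one_mul]

theorem integral_norm_le_of_support {F : Type*} [NormedAddCommGroup F] {D : Set (Space d)}
    (hD : Bornology.IsBounded D) {u : Space d → F} {M : ℝ}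
    (hu : tsupport u ⊆ D) (hM : ∀ x, ‖u x‖ ≤ M) :
    ∫ x, ‖u x‖ ≤ volume.real (closure D) * M := by
  have h0 : ∫ x in closure D, ‖u x‖ = ∫ x, ‖u x‖ := by
    refine setIntegral_eq_integral_of_forall_compl_eq_zero fun x hx => ?_
    rw [norm_eq_zero]
    by_contra h
    exact hx (subset_closure (hu (subset_tsupport u h)))
  have hfin : volume (closure D) < ⊤ := hD.closure.measure_lt_top
  rw [← h0, mul_comm]
  have := norm_setIntegral_le_of_norm_le_const (μ := volume) (f := fun x => ‖u x‖) hfin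
    (fun x _ => by simpa using hM x)
  exact (le_abs_self _).trans this

theorem tsupport_iteratedFDeriv_subset' {u : Space d → ℂ} (l : ℕ) :
    tsupport (iteratedFDeriv ℝ l u) ⊆ tsupport u :=
  closure_minimal (support_iteratedFDeriv_subset l) (isClosed_tsupport u)

/-- Integration by parts bounds `|ξ|^N |û|` by `L¹` norms of derivatives, hence by the volume of
`closure D` times their suprema. The constant depends on `D` and `N` only, not on `u`, so the bound
applies uniformly to all frequency slices of a symbol. -/
theorem fourierInt_decay {D : Set (Space d)} (hD : Bornology.IsBounded D) (N : ℕ) :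
    ∃ C : ℝ, 0 ≤ C ∧ ∀ (u : Space d → ℂ) (M : ℝ), IsSmoothCompactIn D u →
      (∀ l ≤ N, ∀ x, ‖iteratedFDeriv ℝ l u x‖ ≤ M) →
      ∀ ξ, (1 + ‖ξ‖) ^ N * ‖fourierInt u ξ‖ ≤ C * M := by
  set V := volume.real (closure D) with hV
  have hV0 : 0 ≤ V := measureReal_nonneg
  refine ⟨2 ^ N * (V + (2 * Real.pi) ^ N * (2 ^ N * ((N + 1) * V))), by positivity, ?_⟩
  rintro u M ⟨hu, huc, huD⟩ hM ξ
  have hM0 : 0 ≤ M := (norm_nonneg _).trans (hM 0 (Nat.zero_le _) 0)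
  have hint : ∀ l ≤ N, ∫ x, ‖iteratedFDeriv ℝ l u x‖ ≤ V * M := fun l hl =>
    integral_norm_le_of_support hD ((tsupport_iteratedFDeriv_subset' l).trans huD) (hM l hl)
  have h0 : ‖fourierInt u ξ‖ ≤ V * M := by
    refine (norm_fourierInt_le u ξ).trans ?_
    have := hint 0 (Nat.zero_le _)
    simpa only [norm_iteratedFDeriv_zero] using this
  have hN : ‖ξ‖ ^ N * ‖fourierInt u ξ‖
      ≤ (2 * Real.pi) ^ N * (2 ^ N * ((N + 1) * (V * M))) := by
    have h := Real.pow_mul_norm_iteratedFDeriv_fourier_le (K := 0) (N := N) (f := u)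
      (hu.of_le (by exact_mod_cast le_top)) (fun k n hk _ => by
        have hk0 : k = 0 := by simpa using hk
        subst hk0
        simp only [pow_zero, one_mul]
        refine Continuous.integrable_of_hasCompactSupport ?_ (huc.iteratedFDeriv n).norm
        exact (hu.continuous_iteratedFDeriv (by exact_mod_cast le_top)).norm)
      (k := 0) (n := N) le_rfl le_rfl ((2 * Real.pi)⁻¹ • ξ)
    rw [norm_iteratedFDeriv_zero, ← fourierInt_eq_fourier, norm_smul, mul_pow] at h
    simp only [pow_zero, one_mul, zero_add, Finset.range_one, Finset.singleton_product,
      Finset.sum_map, CharP.cast_eq_zero, mul_zero] at h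
    have hs : ∑ x ∈ Finset.range (N + 1), ∫ v, ‖iteratedFDeriv ℝ x u v‖ ≤ (N + 1) * (V * M) := by
      refine (Finset.sum_le_card_nsmul _ _ (V * M) fun l hl => hint l ?_).trans_eq ?_
      · exact Nat.lt_succ_iff.1 (Finset.mem_range.1 hl)
      · simp
    have h2 : ‖(2 * Real.pi)⁻¹‖ ^ N * ‖ξ‖ ^ N * ‖fourierInt u ξ‖
        ≤ 2 ^ N * ((N + 1) * (V * M)) := by
      refine h.trans ?_
      simpa using mul_le_mul_of_nonneg_left hs (by positivity : (0 : ℝ) ≤ 2 ^ N)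
    have hpi : (2 * Real.pi) ^ N * ‖(2 * Real.pi)⁻¹‖ ^ N = 1 := by
      rw [← mul_pow, Real.norm_of_nonneg (by positivity), mul_inv_cancel₀ (by positivity), one_pow]
    calc ‖ξ‖ ^ N * ‖fourierInt u ξ‖
        = (2 * Real.pi) ^ N * (‖(2 * Real.pi)⁻¹‖ ^ N * ‖ξ‖ ^ N * ‖fourierInt u ξ‖) := by
          rw [← mul_assoc, ← mul_assoc, hpi, one_mul]
      _ ≤ _ := mul_le_mul_of_nonneg_left h2 (by positivity)
  have hpow : (1 + ‖ξ‖) ^ N ≤ 2 ^ N * (1 + ‖ξ‖ ^ N) := by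
    have h := add_pow_le (zero_le_one (α := ℝ)) (norm_nonneg ξ) N
    rw [one_pow] at h
    refine h.trans ?_
    gcongr
    · norm_num
    · omega
  calc (1 + ‖ξ‖) ^ N * ‖fourierInt u ξ‖ ≤ 2 ^ N * (1 + ‖ξ‖ ^ N) * ‖fourierInt u ξ‖ := by gcongr
    _ = 2 ^ N * (‖fourierInt u ξ‖ + ‖ξ‖ ^ N * ‖fourierInt u ξ‖) := by ring
    _ ≤ 2 ^ N * (V * M + (2 * Real.pi) ^ N * (2 ^ N * ((N + 1) * (V * M)))) := by gcongr
    _ = _ := by ring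

theorem fourierInt_rapid_decay {u : Space d → ℂ} (hu : ContDiff ℝ ∞ u) (huc : HasCompactSupport u)
    (N : ℕ) : ∃ C : ℝ, ∀ ξ, (1 + ‖ξ‖) ^ N * ‖fourierInt u ξ‖ ≤ C := by
  obtain ⟨C, -, h⟩ := fourierInt_decay huc.isBounded N
  have hb : ∀ l : ℕ, ∃ M, ∀ x, ‖iteratedFDeriv ℝ l u x‖ ≤ M := fun l =>
    (huc.iteratedFDeriv l).exists_bound_of_continuous
      (hu.continuous_iteratedFDeriv (by exact_mod_cast le_top))
  choose M hM using hb
  refine ⟨C * ∑ l ∈ Finset.range (N + 1), |M l|, h u _ ⟨hu, huc, subset_rfl⟩ fun l hl x => ?_⟩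
  refine (hM l x).trans ((le_abs_self _).trans ?_)
  exact Finset.single_le_sum (f := fun l => |M l|) (fun _ _ => abs_nonneg _)
    (Finset.mem_range.2 (Nat.lt_succ_of_le hl))

open FourierTransform in
theorem continuous_fourierInt {u : Space d → ℂ} (hu : Integrable u) :
    Continuous (fourierInt u) := by
  have : fourierInt u = fun ξ => 𝓕 u ((2 * Real.pi)⁻¹ • ξ) := funext (fourierInt_eq_fourier u)
  rw [this]
  have hc : Continuous (𝓕 u) := VectorFourier.fourierIntegral_continuous
    Real.continuous_fourierChar (innerSL ℝ).continuous₂ hu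
  exact hc.comp (continuous_const_smul _)

theorem integrable_weight_mul_fourierInt {u : Space d → ℂ} (hu : ContDiff ℝ ∞ u)
    (huc : HasCompactSupport u) (s : ℝ) :
    Integrable (fun η => (1 + ‖η‖) ^ s * ‖fourierInt u η‖) := by
  -- The `d + 1` surplus powers of decay leave the integrable weight `(1+‖η‖)^{-(d+1)}`.
  obtain ⟨N, hN⟩ := exists_nat_ge (s + (d + 1))
  obtain ⟨C, hC⟩ := fourierInt_rapid_decay hu huc N
  have hcont : Continuous (fun η : Space d => (1 + ‖η‖) ^ s * ‖fourierInt u η‖) := by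
    refine Continuous.mul ?_ (continuous_fourierInt
      (hu.continuous.integrable_of_hasCompactSupport huc)).norm
    exact (by fun_prop : Continuous fun η : Space d => 1 + ‖η‖).rpow_const
      fun η => Or.inl (by positivity)
  have hI : Integrable (fun η : Space d => C * (1 + ‖η‖) ^ (-((d : ℝ) + 1))) :=
    (integrable_one_add_norm (by simp)).const_mul C
  refine hI.mono' hcont.aestronglyMeasurable (Eventually.of_forall fun η => ?_)
  have h1 : (0 : ℝ) < 1 + ‖η‖ := by positivity
  rw [Real.norm_of_nonneg (by positivity)]
  calc (1 + ‖η‖) ^ s * ‖fourierInt u η‖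
      ≤ (1 + ‖η‖) ^ (-((d : ℝ) + 1)) * (1 + ‖η‖) ^ N * ‖fourierInt u η‖ := by
        rw [← Real.rpow_natCast, ← Real.rpow_add h1]
        gcongr
        · linarith [norm_nonneg η]
        · linarith
    _ = (1 + ‖η‖) ^ (-((d : ℝ) + 1)) * ((1 + ‖η‖) ^ N * ‖fourierInt u η‖) := by ring
    _ ≤ (1 + ‖η‖) ^ (-((d : ℝ) + 1)) * C := by gcongr; exact hC η
    _ = _ := mul_comm _ _

theorem integrable_fourierInt {u : Space d → ℂ} (hu : ContDiff ℝ ∞ u)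
    (huc : HasCompactSupport u) : Integrable (fourierInt u) := by
  have h := integrable_weight_mul_fourierInt hu huc 0
  simp only [Real.rpow_zero, one_mul] at h
  exact (integrable_norm_iff (continuous_fourierInt
    (hu.continuous.integrable_of_hasCompactSupport huc)).aestronglyMeasurable).1 h

open FourierTransform in
theorem fourierInt_inversion {u : Space d → ℂ} (hu : ContDiff ℝ ∞ u)
    (huc : HasCompactSupport u) (x : Space d) :
    (((2 * Real.pi) ^ d : ℝ) : ℂ)⁻¹ *
      ∫ ξ, Complex.exp (Complex.I * (inner ℝ x ξ : ℝ)) * fourierInt u ξ = u x := by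
  have hpi : (0 : ℝ) < 2 * Real.pi := by positivity
  have hi := integrable_fourierInt hu huc
  have hF : ∀ v, 𝓕 u v = fourierInt u ((2 * Real.pi) • v) := fun v => by
    rw [fourierInt_eq_fourier, smul_smul, inv_mul_cancel₀ hpi.ne', one_smul]
  have hFi : Integrable (𝓕 u) := by
    rw [funext hF]
    exact hi.comp_smul hpi.ne'
  have h := congrFun (hu.continuous.fourierInv_fourier_eq
    (hu.continuous.integrable_of_hasCompactSupport huc) hFi) x
  rw [Real.fourierInv_eq'] at h
  rw [← h]
  have hs := Measure.integral_comp_smul (volume : Measure (Space d))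
    (fun ξ => Complex.exp (Complex.I * (inner ℝ x ξ : ℝ)) * fourierInt u ξ) (2 * Real.pi)
  rw [finrank_euclideanSpace_fin, abs_of_pos (by positivity)] at hs
  have hs' : (((2 * Real.pi) ^ d : ℝ) : ℂ)⁻¹ *
      ∫ ξ, Complex.exp (Complex.I * (inner ℝ x ξ : ℝ)) * fourierInt u ξ
      = ∫ v, Complex.exp (Complex.I * (inner ℝ x ((2 * Real.pi) • v) : ℝ))
        * fourierInt u ((2 * Real.pi) • v) := by
    rw [hs, Complex.real_smul, Complex.ofReal_inv]
  rw [hs']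
  congr 1
  funext v
  rw [← hF, smul_eq_mul, inner_smul_right, real_inner_comm]
  congr 2
  push_cast
  ring

end Fourier

/-! ### The kernel of a pseudo-differential operator tested against plane waves -/

section Kernel

variable {d : ℕ}

/-- The bilinear form of the pseudo-differential operator with symbol `S`, evaluated at
`g e^{i ζ₂·}` and `χ e^{-i ζ₁·}`. -/
noncomputable def covKernel (S : Space d → Space d → ℂ) (g χ : Space d → ℂ) (ζ₁ ζ₂ : Space d) :
    ℂ :=
  ∫ x, pseudoDiff S (fun y => g y * Complex.exp (Complex.I * (inner ℝ ζ₂ y : ℝ))) x *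
    (χ x * Complex.exp (-(Complex.I * (inner ℝ ζ₁ x : ℝ))))

theorem fourierInt_modulate (g : Space d → ℂ) (ζ ξ : Space d) :
    fourierInt (fun y => g y * Complex.exp (Complex.I * (inner ℝ ζ y : ℝ))) ξ
      = fourierInt g (ξ - ζ) := by
  unfold fourierInt
  congr 1
  funext x
  dsimp only
  rw [inner_sub_right, real_inner_comm x ζ, mul_left_comm, ← Complex.exp_add, mul_comm]
  congr 2
  push_cast
  ring

/-- After the translation `ξ = η + ζ` the large frequency `ζ` appears only in the phase and in the
symbol, where its asymptotics are known; the transform of `g` no longer depends on it. -/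
theorem pseudoDiff_modulate (S : Space d → Space d → ℂ) (g : Space d → ℂ) (ζ x : Space d) :
    pseudoDiff S (fun y => g y * Complex.exp (Complex.I * (inner ℝ ζ y : ℝ))) x
      = (((2 * Real.pi) ^ d : ℝ) : ℂ)⁻¹ * ∫ η, Complex.exp (Complex.I * (inner ℝ x (η + ζ) : ℝ)) *
        S x (η + ζ) * fourierInt g η := by
  unfold pseudoDiff
  simp only [fourierInt_modulate]
  rw [← integral_add_right_eq_self _ ζ]
  simp only [add_sub_cancel_right]

/-- The integrability behind Fubini in `covKernel_eq`. Peetre's inequality splits the symbol bound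
into a constant in `ζ₂` and a power of `η`, which the rapid decay of the transform of `g` absorbs;
the `x`-integral runs over a bounded set. -/
theorem integrable_covKernel {D : Set (Space d)} (hD : Bornology.IsBounded D)
    {S : Space d → Space d → ℂ} (hS : Continuous fun p : Space d × Space d => S p.1 p.2)
    (hSD : ∀ x ξ, x ∉ D → S x ξ = 0) {C r : ℝ} (hC : ∀ x ξ, ‖S x ξ‖ ≤ C * (1 + ‖ξ‖) ^ r)
    {g : Space d → ℂ} (hg : ContDiff ℝ ∞ g) (hgc : HasCompactSupport g) (ζ₂ k : Space d) :
    Integrable (fun p : Space d × Space d => fourierInt g p.2 *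
      (Complex.exp (-(Complex.I * (inner ℝ p.1 (k - p.2) : ℝ))) * S p.1 (p.2 + ζ₂)))
      (volume.prod volume) := by
  have hgi := continuous_fourierInt (hg.continuous.integrable_of_hasCompactSupport hgc)
  have h1 : Integrable (fun x : Space d => (closure D).indicator (fun _ => (1 : ℝ)) x) :=
    (integrable_indicator_iff isClosed_closure.measurableSet).2
      (integrableOn_const hD.closure.measure_lt_top.ne)
  have h2 := (integrable_weight_mul_fourierInt hg hgc |r|).const_mul (|C| * (1 + ‖ζ₂‖) ^ r)
  refine (h1.mul_prod h2).mono' ?_ (Eventually.of_forall fun p => ?_)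
  · refine Continuous.aestronglyMeasurable ?_
    have h3 : Continuous fun p : Space d × Space d => S p.1 (p.2 + ζ₂) :=
      hS.comp (by fun_prop : Continuous fun p : Space d × Space d => (p.1, p.2 + ζ₂))
    have h4 : Continuous fun p : Space d × Space d => (inner ℝ p.1 (k - p.2) : ℝ) := by fun_prop
    exact (hgi.comp continuous_snd).mul
      ((Complex.continuous_ofReal.comp h4).const_mul Complex.I |>.neg.cexp.mul h3)
  · rw [norm_mul, norm_mul, norm_cexp_neg_I_mul, one_mul]
    by_cases hp : p.1 ∈ D
    · rw [Set.indicator_of_mem (subset_closure hp), one_mul]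
      have h5 : ‖S p.1 (p.2 + ζ₂)‖ ≤ |C| * ((1 + ‖ζ₂‖) ^ r * (1 + ‖p.2‖) ^ |r|) := by
        refine (hC _ _).trans ?_
        have := peetre_rpow ζ₂ p.2 r
        rw [add_comm ζ₂] at this
        exact mul_le_mul (le_abs_self _) this (by positivity) (abs_nonneg _)
      refine (mul_le_mul_of_nonneg_left h5 (norm_nonneg _)).trans_eq ?_
      ring
    · rw [hSD _ _ hp, norm_zero, mul_zero]
      exact mul_nonneg (Set.indicator_nonneg (fun _ _ => zero_le_one) _) (by positivity)

/-- Integrating in `x` first produces the transform of a slice of `S`. The cutoff `χ` disappears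
because it equals `1` on `D`, while `S` vanishes off `D`. -/
theorem covKernel_eq {D : Set (Space d)} (hD : Bornology.IsBounded D)
    {S : Space d → Space d → ℂ} (hS : Continuous fun p : Space d × Space d => S p.1 p.2)
    (hSD : ∀ x ξ, x ∉ D → S x ξ = 0) {C r : ℝ} (hC : ∀ x ξ, ‖S x ξ‖ ≤ C * (1 + ‖ξ‖) ^ r)
    {g χ : Space d → ℂ} (hg : ContDiff ℝ ∞ g) (hgc : HasCompactSupport g)
    (hχ : ∀ x ∈ D, χ x = 1) (ζ₁ ζ₂ : Space d) :
    covKernel S g χ ζ₁ ζ₂ = (((2 * Real.pi) ^ d : ℝ) : ℂ)⁻¹ *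
      ∫ η, fourierInt g η * fourierInt (fun x => S x (η + ζ₂)) (ζ₁ - ζ₂ - η) := by
  have hI := integrable_covKernel hD hS hSD hC hg hgc ζ₂ (ζ₁ - ζ₂)
  have hsw := integral_integral_swap (μ := (volume : Measure (Space d)))
    (ν := (volume : Measure (Space d))) (f := fun x η => fourierInt g η *
      (Complex.exp (-(Complex.I * (inner ℝ x (ζ₁ - ζ₂ - η) : ℝ))) * S x (η + ζ₂))) hI
  simp only [integral_const_mul] at hsw
  have hrhs : ∀ η, ∫ x, Complex.exp (-(Complex.I * (inner ℝ x (ζ₁ - ζ₂ - η) : ℝ))) * S x (η + ζ₂)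
      = fourierInt (fun x => S x (η + ζ₂)) (ζ₁ - ζ₂ - η) := fun η => rfl
  simp only [hrhs] at hsw
  rw [← hsw, ← integral_const_mul, covKernel]
  congr 1
  funext x
  rw [pseudoDiff_modulate, mul_assoc, ← integral_mul_const]
  congr 2
  funext η
  by_cases hx : x ∈ D
  · have hexp : Complex.exp (-(Complex.I * (inner ℝ x (ζ₁ - ζ₂ - η) : ℝ))) =
        Complex.exp (Complex.I * (inner ℝ x (η + ζ₂) : ℝ))
        * Complex.exp (-(Complex.I * (inner ℝ ζ₁ x : ℝ))) := by
      rw [← Complex.exp_add, inner_add_right, inner_sub_right, inner_sub_right,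
        real_inner_comm x ζ₁]
      congr 1
      push_cast
      ring
    rw [hχ x hx, hexp]
    ring
  · rw [hSD _ _ hx]
    ring

/-- Uniform bounds on the `x`-derivatives of a symbol. -/
theorem IsSymbol.exists_bound {r : ℝ} {σ : Space d → Space d → ℂ} (hσ : IsSymbol r σ) (N : ℕ) :
    ∃ C : ℝ, 0 ≤ C ∧ ∀ l ≤ N, ∀ x ξ,
      ‖iteratedFDeriv ℝ l (fun y => σ y ξ) x‖ ≤ C * (1 + ‖ξ‖) ^ r := by
  have h : ∀ l : ℕ, ∃ C : ℝ, ∀ x ξ,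
      ‖iteratedFDeriv ℝ l (fun y => σ y ξ) x‖ ≤ C * (1 + ‖ξ‖) ^ r := by
    intro l
    obtain ⟨C, hC⟩ := hσ.2 0 l
    refine ⟨C, fun x ξ => ?_⟩
    have := hC x ξ
    rwa [norm_iteratedFDeriv_zero, Nat.cast_zero, sub_zero] at this
  choose C hC using h
  refine ⟨∑ l ∈ Finset.range (N + 1), |C l|, Finset.sum_nonneg fun _ _ => abs_nonneg _,
    fun l hl x ξ => (hC l x ξ).trans ?_⟩
  have : C l ≤ ∑ l ∈ Finset.range (N + 1), |C l| := (le_abs_self _).trans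
    (Finset.single_le_sum (f := fun l => |C l|) (fun _ _ => abs_nonneg _)
      (Finset.mem_range.2 (Nat.lt_succ_of_le hl)))
  gcongr

/-- Derivatives in `x` cost no power of `ξ` in the symbol class, so the transform in `x` decays to
any order with the same growth in `ξ` as the symbol. -/
theorem symbol_fourierInt_decay {D : Set (Space d)} (hD : Bornology.IsBounded D) {r : ℝ}
    {σ : Space d → Space d → ℂ} (hσ : IsSymbol r σ)
    (hσD : ∀ ξ, IsSmoothCompactIn D (fun x => σ x ξ)) (N : ℕ) :
    ∃ C : ℝ, 0 ≤ C ∧ ∀ ξ k,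
      (1 + ‖k‖) ^ N * ‖fourierInt (fun x => σ x ξ) k‖ ≤ C * (1 + ‖ξ‖) ^ r := by
  obtain ⟨C₁, hC₁, h₁⟩ := fourierInt_decay hD N
  obtain ⟨C₂, hC₂, h₂⟩ := hσ.exists_bound N
  refine ⟨C₁ * C₂, by positivity, fun ξ k => ?_⟩
  rw [mul_assoc]
  exact h₁ _ _ (hσD ξ) (fun l hl x => h₂ l hl x ξ) k

theorem IsSmoothCompactIn.eq_zero {D : Set (Space d)} {a : Space d → ℂ}
    (ha : IsSmoothCompactIn D a) {x : Space d} (hx : x ∉ D) : a x = 0 := by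
  by_contra h
  exact hx (ha.2.2 (subset_tsupport a h))

theorem covKernel_eq_of_isSymbol {D : Set (Space d)} (hD : Bornology.IsBounded D) {r : ℝ}
    {S : Space d → Space d → ℂ} (hS : IsSymbol r S)
    (hSD : ∀ ξ, IsSmoothCompactIn D (fun x => S x ξ))
    {g χ : Space d → ℂ} (hg : ContDiff ℝ ∞ g) (hgc : HasCompactSupport g)
    (hχ : ∀ x ∈ D, χ x = 1) (ζ₁ ζ₂ : Space d) :
    covKernel S g χ ζ₁ ζ₂ = (((2 * Real.pi) ^ d : ℝ) : ℂ)⁻¹ *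
      ∫ η, fourierInt g η * fourierInt (fun x => S x (η + ζ₂)) (ζ₁ - ζ₂ - η) := by
  obtain ⟨C, -, hC⟩ := hS.exists_bound 0
  refine covKernel_eq (C := C) (r := r) hD hS.1.continuous (fun x ξ hx => (hSD ξ).eq_zero hx)
    (fun x ξ => ?_) hg hgc hχ ζ₁ ζ₂
  have := hC 0 le_rfl x ξ
  rwa [norm_iteratedFDeriv_zero] at this

/-- In `covKernel_eq`, Peetre's inequality moves all dependence on `η` onto the transform of `g`,
leaving `(1+|ζ₂|)^{-m} (1+|k|)^{-N}` with `k = ζ₁ - ζ₂`. A single power of decay in `k` is kept: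
Wick's formula multiplies two such bounds, which makes the covariance integrable. -/
theorem norm_covKernel_le {D : Set (Space d)} (hD : Bornology.IsBounded D) {m : ℝ}
    {S : Space d → Space d → ℂ} (hS : IsSymbol (-m) S)
    (hSD : ∀ ξ, IsSmoothCompactIn D (fun x => S x ξ))
    {g χ : Space d → ℂ} (hg : ContDiff ℝ ∞ g) (hgc : HasCompactSupport g)
    (hχ : ∀ x ∈ D, χ x = 1) :
    ∃ C : ℝ, 0 ≤ C ∧ ∀ ζ₁ ζ₂, ‖covKernel S g χ ζ₁ ζ₂‖ ≤
      C * ((1 + ‖ζ₁‖) ^ (-m / 2) * (1 + ‖ζ₂‖) ^ (-m / 2) / (1 + ‖ζ₁ - ζ₂‖)) := by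
  -- The powers `|m/2|` pay for moving half of the weight from `ζ₂` to `ζ₁`; the last one is the
  -- decay in the conclusion.
  obtain ⟨N, hN⟩ := exists_nat_ge (|-m / 2| + 1)
  obtain ⟨C, hC0, hC⟩ := symbol_fourierInt_decay hD hS hSD N
  set J := ∫ η, (1 + ‖η‖) ^ (|-m| + N) * ‖fourierInt g η‖ with hJ
  have hJ0 : 0 ≤ J := integral_nonneg fun η => by positivity
  set c : ℝ := ((2 * Real.pi) ^ d)⁻¹ with hc
  have hc0 : 0 < c := by positivity
  refine ⟨c * (C * J), by positivity, fun ζ₁ ζ₂ => ?_⟩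
  rw [covKernel_eq_of_isSymbol hD hS hSD hg hgc hχ, norm_mul, norm_inv, Complex.norm_real,
    Real.norm_of_nonneg (by positivity), ← hc, mul_assoc]
  refine mul_le_mul_of_nonneg_left ?_ hc0.le
  set k := ζ₁ - ζ₂ with hk
  have hk0 : 0 < 1 + ‖k‖ := by positivity
  have hpt : ∀ η, ‖fourierInt g η * fourierInt (fun x => S x (η + ζ₂)) (k - η)‖ ≤
      (C * (1 + ‖ζ₂‖) ^ (-m) * (1 + ‖k‖) ^ (-(N : ℝ))) *
        ((1 + ‖η‖) ^ (|-m| + N) * ‖fourierInt g η‖) := by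
    intro η
    have hη : 0 < 1 + ‖η‖ := by positivity
    have h1 : ‖fourierInt (fun x => S x (η + ζ₂)) (k - η)‖
        ≤ C * (1 + ‖η + ζ₂‖) ^ (-m) * (1 + ‖k - η‖) ^ (-(N : ℝ)) := by
      rw [Real.rpow_neg (by positivity) (N : ℝ), Real.rpow_natCast, ← div_eq_mul_inv,
        le_div_iff₀ (by positivity), mul_comm]
      exact hC _ _
    have h2 := peetre_rpow ζ₂ η (-m)
    rw [add_comm ζ₂] at h2
    have h3 := peetre_rpow k (-η) (-(N : ℝ))
    rw [← sub_eq_add_neg, norm_neg, abs_neg, abs_of_nonneg (Nat.cast_nonneg N)] at h3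
    rw [norm_mul, Real.rpow_add hη]
    calc ‖fourierInt g η‖ * ‖fourierInt (fun x => S x (η + ζ₂)) (k - η)‖
        ≤ ‖fourierInt g η‖ * (C * ((1 + ‖ζ₂‖) ^ (-m) * (1 + ‖η‖) ^ |-m|) *
          ((1 + ‖k‖) ^ (-(N : ℝ)) * (1 + ‖η‖) ^ (N : ℝ))) := by
          refine mul_le_mul_of_nonneg_left (h1.trans ?_) (norm_nonneg _)
          gcongr
      _ = _ := by ring
  have hbound := norm_integral_le_of_norm_le
    ((integrable_weight_mul_fourierInt hg hgc (|-m| + N)).const_mul _)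
    (Eventually.of_forall hpt)
  rw [integral_const_mul] at hbound
  refine hbound.trans ?_
  have h4 : (1 + ‖ζ₂‖) ^ (-m) * (1 + ‖k‖) ^ (-(N : ℝ))
      ≤ (1 + ‖ζ₁‖) ^ (-m / 2) * (1 + ‖ζ₂‖) ^ (-m / 2) / (1 + ‖k‖) := by
    have h5 := peetre_rpow ζ₁ (-k) (-m / 2)
    rw [norm_neg, hk, neg_sub, add_sub_cancel, ← hk] at h5
    have h6 : (1 + ‖ζ₂‖) ^ (-m) = (1 + ‖ζ₂‖) ^ (-m / 2) * (1 + ‖ζ₂‖) ^ (-m / 2) := by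
      rw [← Real.rpow_add (by positivity)]
      ring_nf
    have h7 : (1 + ‖k‖) ^ |-m / 2| * (1 + ‖k‖) ^ (-(N : ℝ)) ≤ (1 + ‖k‖)⁻¹ := by
      rw [← Real.rpow_add hk0, ← Real.rpow_neg_one]
      refine Real.rpow_le_rpow_of_exponent_le ?_ (by linarith)
      linarith [norm_nonneg k]
    calc (1 + ‖ζ₂‖) ^ (-m) * (1 + ‖k‖) ^ (-(N : ℝ))
        = (1 + ‖ζ₂‖) ^ (-m / 2) * ((1 + ‖ζ₂‖) ^ (-m / 2) * (1 + ‖k‖) ^ (-(N : ℝ))) := by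
          rw [h6]; ring
      _ ≤ (1 + ‖ζ₂‖) ^ (-m / 2) *
          ((1 + ‖ζ₁‖) ^ (-m / 2) * (1 + ‖k‖) ^ |-m / 2| * (1 + ‖k‖) ^ (-(N : ℝ))) := by gcongr
      _ = (1 + ‖ζ₂‖) ^ (-m / 2) * (1 + ‖ζ₁‖) ^ (-m / 2) *
          ((1 + ‖k‖) ^ |-m / 2| * (1 + ‖k‖) ^ (-(N : ℝ))) := by ring
      _ ≤ (1 + ‖ζ₂‖) ^ (-m / 2) * (1 + ‖ζ₁‖) ^ (-m / 2) * (1 + ‖k‖)⁻¹ := by gcongr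
      _ = _ := by rw [div_eq_mul_inv]; ring
  calc C * (1 + ‖ζ₂‖) ^ (-m) * (1 + ‖k‖) ^ (-(N : ℝ)) * J
      = C * J * ((1 + ‖ζ₂‖) ^ (-m) * (1 + ‖k‖) ^ (-(N : ℝ))) := by ring
    _ ≤ _ := mul_le_mul_of_nonneg_left h4 (by positivity)

end Kernel

/-! ### High-frequency limit of the kernel -/

section KernelLimit

variable {d : ℕ}

/-- This is `covKernel_eq` for the symbol `a(x)`, whose operator is multiplication by `a`: by
Fourier inversion it sends `g` to `a g`, which is `a` because `g = 1` on `D`. -/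
theorem integral_fourierInt_mul_fourierInt {D : Set (Space d)} (hD : Bornology.IsBounded D)
    {a : Space d → ℂ} (ha : IsSmoothCompactIn D a) {g : Space d → ℂ} (hg : ContDiff ℝ ∞ g)
    (hgc : HasCompactSupport g) (hg1 : ∀ x ∈ D, g x = 1) (k : Space d) :
    (((2 * Real.pi) ^ d : ℝ) : ℂ)⁻¹ * ∫ η, fourierInt g η * fourierInt a (k - η)
      = fourierInt a k := by
  obtain ⟨C, hC⟩ := ha.2.1.exists_bound_of_continuous ha.1.continuous
  have h := covKernel_eq (S := fun x _ => a x) (g := g) (χ := g) hD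
    (ha.1.continuous.comp continuous_fst) (fun x _ hx => ha.eq_zero hx) (C := C) (r := 0)
    (fun x ξ => by simpa using hC x) hg hgc hg1 k 0
  simp only [sub_zero] at h
  rw [← h, covKernel, fourierInt]
  congr 1
  funext x
  rw [pseudoDiff_modulate]
  by_cases hx : x ∈ D
  · have h2 : ∫ η, Complex.exp (Complex.I * (inner ℝ x (η + 0) : ℝ)) * a x * fourierInt g η
        = a x * ∫ η, Complex.exp (Complex.I * (inner ℝ x η : ℝ)) * fourierInt g η := by
      rw [← integral_const_mul]
      congr 1
      funext η
      rw [add_zero]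
      ring
    have h3 := fourierInt_inversion hg hgc x
    rw [hg1 x hx] at h3
    rw [h2, hg1 x hx, real_inner_comm x k]
    linear_combination (a x * Complex.exp (-(Complex.I * (inner ℝ x k : ℝ)))) * h3
  · simp [ha.eq_zero hx]

theorem rpow_le_two_rpow_mul_one_add_rpow {r : ℝ} (hr : 1 ≤ r) (m : ℝ) :
    r ^ m ≤ 2 ^ |m| * (1 + r) ^ m := by
  rcases le_total 0 m with hm | hm
  · calc r ^ m ≤ (1 + r) ^ m := Real.rpow_le_rpow (by linarith) (by linarith) hm
      _ ≤ 2 ^ |m| * (1 + r) ^ m := by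
        refine le_mul_of_one_le_left (by positivity) ?_
        exact Real.one_le_rpow (by norm_num) (abs_nonneg _)
  · rw [abs_of_nonpos hm, Real.rpow_neg (by norm_num), ← Real.inv_rpow (by norm_num),
      ← Real.mul_rpow (by norm_num) (by linarith)]
    exact Real.rpow_le_rpow_of_nonpos (by linarith) (by linarith) hm

theorem tendsto_norm_rpow_mul_norm_add_rpow (η : Space d) (m : ℝ) :
    Tendsto (fun ζ : Space d => ‖ζ‖ ^ m * ‖η + ζ‖ ^ (-m)) (comap norm atTop) (𝓝 1) := by
  have hn : Tendsto (fun ζ : Space d => ‖ζ‖) (comap norm atTop) atTop := tendsto_comap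
  have h1 : Tendsto (fun ζ : Space d => ‖η + ζ‖ / ‖ζ‖) (comap norm atTop) (𝓝 1) := by
    have h0 : Tendsto (fun ζ : Space d => ‖η‖ / ‖ζ‖) (comap norm atTop) (𝓝 0) :=
      hn.const_div_atTop _
    rw [tendsto_iff_dist_tendsto_zero]
    refine squeeze_zero' (Eventually.of_forall fun _ => dist_nonneg) ?_ h0
    filter_upwards [hn.eventually_gt_atTop 0] with ζ hζ
    rw [Real.dist_eq, div_sub_one hζ.ne', abs_div, abs_of_pos hζ]
    gcongr
    simpa using abs_norm_sub_norm_le (η + ζ) ζ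
  have h2 := h1.rpow_const (p := -m) (Or.inl one_ne_zero)
  rw [Real.one_rpow] at h2
  refine h2.congr fun ζ => ?_
  rw [Real.div_rpow (norm_nonneg _) (norm_nonneg _), Real.rpow_neg (norm_nonneg ζ), div_inv_eq_mul,
    mul_comm]

theorem fourierInt_add {u v : Space d → ℂ} (hu : Integrable u) (hv : Integrable v) (k : Space d) :
    fourierInt (fun x => u x + v x) k = fourierInt u k + fourierInt v k := by
  have hi : ∀ w : Space d → ℂ, Integrable w →
      Integrable fun x => Complex.exp (-(Complex.I * (inner ℝ x k : ℝ))) * w x := by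
    intro w hw
    refine hw.bdd_mul (c := 1) (Continuous.aestronglyMeasurable (by fun_prop))
      (Eventually.of_forall fun x => ?_)
    rw [norm_cexp_neg_I_mul]
  unfold fourierInt
  rw [← integral_add (hi u hu) (hi v hv)]
  simp only [mul_add]

theorem fourierInt_mul_const (u : Space d → ℂ) (c : ℂ) (k : Space d) :
    fourierInt (fun x => u x * c) k = fourierInt u k * c := by
  unfold fourierInt
  rw [← integral_mul_const]
  simp only [mul_assoc]

theorem IsSmoothCompactIn.integrable {D : Set (Space d)} {a : Space d → ℂ}
    (ha : IsSmoothCompactIn D a) : Integrable a :=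
  ha.1.continuous.integrable_of_hasCompactSupport ha.2.1

/-- The principal part contributes `(|η+ζ|/|ζ|)^{-m}` times the transform of `a`, and that ratio
tends to `1`; the remainder has one order less and contributes `O(1/|ζ|)`. The filter `comap norm
atTop` expresses `|ζ| → ∞`. -/
theorem tendsto_fourierInt_symbol {D : Set (Space d)} (hD : Bornology.IsBounded D) {m : ℝ}
    {S : Space d → Space d → ℂ} {a : Space d → ℂ} (hS : HasPrincipalSymbol m D S a)
    (η κ : Space d) :
    Tendsto (fun ζ : Space d => ((‖ζ‖ ^ m : ℝ) : ℂ) * fourierInt (fun x => S x (η + ζ)) κ)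
      (comap norm atTop) (𝓝 (fourierInt a κ)) := by
  obtain ⟨-, -, ha, b, hb, hbD, hdec⟩ := hS
  obtain ⟨C, hC0, hC⟩ := symbol_fourierInt_decay hD hb hbD 0
  have hn : Tendsto (fun ζ : Space d => ‖ζ‖) (comap norm atTop) atTop := tendsto_comap
  have h1 : Tendsto (fun ζ : Space d => fourierInt a κ * ((‖ζ‖ ^ m * ‖η + ζ‖ ^ (-m) : ℝ) : ℂ))
      (comap norm atTop) (𝓝 (fourierInt a κ * ((1 : ℝ) : ℂ))) :=
    ((Complex.continuous_ofReal.tendsto 1).comp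
      (tendsto_norm_rpow_mul_norm_add_rpow η m)).const_mul _
  have h2 : Tendsto (fun ζ : Space d =>
      ((‖ζ‖ ^ m : ℝ) : ℂ) * fourierInt (fun x => b x (η + ζ)) κ) (comap norm atTop) (𝓝 0) := by
    have h3 : Tendsto (fun ζ : Space d => (2 ^ |m| * C * (1 + ‖η‖) ^ |-m - 1|) / (1 + ‖ζ‖))
        (comap norm atTop) (𝓝 0) := (tendsto_atTop_add_const_left _ 1 hn).const_div_atTop _
    refine squeeze_zero_norm' ?_ h3
    filter_upwards [hn.eventually_ge_atTop 1] with ζ hζ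
    have h4 := hC (η + ζ) κ
    rw [pow_zero, one_mul] at h4
    have h5 := peetre_rpow ζ η (-m - 1)
    rw [add_comm ζ] at h5
    have h6 := rpow_le_two_rpow_mul_one_add_rpow hζ m
    rw [norm_mul, Complex.norm_real, Real.norm_of_nonneg (by positivity), div_eq_mul_inv]
    calc ‖ζ‖ ^ m * ‖fourierInt (fun x => b x (η + ζ)) κ‖
        ≤ (2 ^ |m| * (1 + ‖ζ‖) ^ m) *
          (C * ((1 + ‖ζ‖) ^ (-m - 1) * (1 + ‖η‖) ^ |-m - 1|)) := by
          refine mul_le_mul h6 (h4.trans ?_) (norm_nonneg _) (by positivity)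
          gcongr
      _ = (2 ^ |m| * C * (1 + ‖η‖) ^ |-m - 1|) * ((1 + ‖ζ‖) ^ m * (1 + ‖ζ‖) ^ (-m - 1)) := by
          ring
      _ = _ := by
          rw [← Real.rpow_add (by positivity), ← Real.rpow_neg_one]
          ring_nf
  have h := h1.add h2
  rw [Complex.ofReal_one, mul_one, add_zero] at h
  refine h.congr' ?_
  -- This forces `‖η + ζ‖ ≥ 1`, where the decomposition of the symbol is available.
  filter_upwards [hn.eventually_ge_atTop (1 + ‖η‖)] with ζ hζ
  have hge : 1 ≤ ‖η + ζ‖ := by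
    have : ‖ζ‖ ≤ ‖η + ζ‖ + ‖η‖ := by simpa using norm_sub_le (η + ζ) η
    linarith
  have hS' : (fun x => S x (η + ζ)) =
      fun x => a x * ((‖η + ζ‖ ^ (-m) : ℝ) : ℂ) + b x (η + ζ) := funext fun x => hdec x _ hge
  rw [hS', fourierInt_add (ha.integrable.mul_const _) (hbD _).integrable, fourierInt_mul_const]
  push_cast
  ring

/-- Dominated convergence in the convolution formula `covKernel_eq`; the limiting convolution is
evaluated by `integral_fourierInt_mul_fourierInt`. -/
theorem tendsto_covKernel {D : Set (Space d)} (hD : Bornology.IsBounded D) {m : ℝ}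
    {S : Space d → Space d → ℂ} {a : Space d → ℂ} (hS : HasPrincipalSymbol m D S a)
    {g χ : Space d → ℂ} (hg : ContDiff ℝ ∞ g) (hgc : HasCompactSupport g)
    (hg1 : ∀ x ∈ D, g x = 1) (hχ : ∀ x ∈ D, χ x = 1) (k : Space d) :
    Tendsto (fun ζ : Space d => ((‖ζ‖ ^ m : ℝ) : ℂ) * covKernel S g χ (ζ + k) ζ)
      (comap norm atTop) (𝓝 (fourierInt a k)) := by
  have hn : Tendsto (fun ζ : Space d => ‖ζ‖) (comap norm atTop) atTop := tendsto_comap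
  obtain ⟨C, hC0, hC⟩ := symbol_fourierInt_decay hD hS.1 hS.2.1 0
  rw [← integral_fourierInt_mul_fourierInt hD hS.2.2.1 hg hgc hg1 k]
  have hlim : Tendsto (fun ζ : Space d => ∫ η, fourierInt g η *
      (((‖ζ‖ ^ m : ℝ) : ℂ) * fourierInt (fun x => S x (η + ζ)) (k - η))) (comap norm atTop)
      (𝓝 (∫ η, fourierInt g η * fourierInt a (k - η))) := by
    refine tendsto_integral_filter_of_dominated_convergence
      (fun η => (2 ^ |m| * C) * ((1 + ‖η‖) ^ |-m| * ‖fourierInt g η‖)) ?_ ?_ ?_ ?_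
    · refine Eventually.of_forall fun ζ => ?_
      obtain ⟨C', -, hC'⟩ := hS.1.exists_bound 0
      have hI := (integrable_covKernel hD hS.1.1.continuous
        (fun x ξ hx => (hS.2.1 ξ).eq_zero hx) (C := C') (r := -m) (fun x ξ => by
          have := hC' 0 le_rfl x ξ
          rwa [norm_iteratedFDeriv_zero] at this) hg hgc ζ k).integral_prod_right
      have hI' := hI.aestronglyMeasurable.const_mul ((‖ζ‖ ^ m : ℝ) : ℂ)
      refine hI'.congr (Eventually.of_forall fun η => ?_)
      simp only [integral_const_mul]
      rw [mul_left_comm]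
      rfl
    · filter_upwards [hn.eventually_ge_atTop 1] with ζ hζ
      refine Eventually.of_forall fun η => ?_
      have h4 := hC (η + ζ) (k - η)
      rw [pow_zero, one_mul] at h4
      have h5 := peetre_rpow ζ η (-m)
      rw [add_comm ζ] at h5
      have h6 := rpow_le_two_rpow_mul_one_add_rpow hζ m
      rw [norm_mul, norm_mul, Complex.norm_real, Real.norm_of_nonneg (by positivity)]
      calc ‖fourierInt g η‖ * (‖ζ‖ ^ m * ‖fourierInt (fun x => S x (η + ζ)) (k - η)‖)
          ≤ ‖fourierInt g η‖ * ((2 ^ |m| * (1 + ‖ζ‖) ^ m) *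
            (C * ((1 + ‖ζ‖) ^ (-m) * (1 + ‖η‖) ^ |-m|))) := by
            refine mul_le_mul_of_nonneg_left ?_ (norm_nonneg _)
            refine mul_le_mul h6 (h4.trans ?_) (norm_nonneg _) (by positivity)
            gcongr
        _ = (2 ^ |m| * C) * ((1 + ‖η‖) ^ |-m| * ‖fourierInt g η‖) *
            ((1 + ‖ζ‖) ^ m * (1 + ‖ζ‖) ^ (-m)) := by ring
        _ = _ := by
            rw [← Real.rpow_add (by positivity), add_neg_cancel, Real.rpow_zero, mul_one]
    · exact (integrable_weight_mul_fourierInt hg hgc _).const_mul _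
    · exact Eventually.of_forall fun η =>
        (tendsto_fourierInt_symbol hD hS η (k - η)).const_mul _
  refine (hlim.const_mul _).congr fun ζ => ?_
  have hw : ∫ η, fourierInt g η *
      (((‖ζ‖ ^ m : ℝ) : ℂ) * fourierInt (fun x => S x (η + ζ)) (k - η)) =
      ((‖ζ‖ ^ m : ℝ) : ℂ) * ∫ η, fourierInt g η * fourierInt (fun x => S x (η + ζ)) (k - η) := by
    rw [← integral_const_mul]
    congr 1
    funext η
    ring
  rw [covKernel_eq_of_isSymbol hD hS.1 hS.2.1 hg hgc hχ, add_sub_cancel_left, hw]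
  ring

end KernelLimit

/-! ### An ergodic theorem for processes with integrable covariance decay -/

section Ergodic

variable {Ω : Type*} [MeasurableSpace Ω] {P : Measure Ω}

/-- By Fubini, `E|∫Y|²` is the double integral of the covariance. The bound `K` on second moments
only supplies absolute integrability on the product; the estimate itself is `R`. -/
theorem integral_norm_sq_integral_le [SFinite P] {ν : Measure ℝ} [IsFiniteMeasure ν]
    {Y : Ω → ℝ → ℂ} (hY : AEStronglyMeasurable (Function.uncurry Y) (P.prod ν)) {K R : ℝ}
    (hmem : ∀ᵐ w ∂ν, MemLp (fun s => Y s w) 2 P) (hK : ∀ᵐ w ∂ν, ∫ s, ‖Y s w‖ ^ 2 ∂P ≤ K)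
    (hR : ∫ p : ℝ × ℝ, ‖∫ s, Y s p.1 * conj (Y s p.2) ∂P‖ ∂(ν.prod ν) ≤ R) :
    Integrable (fun s => ‖∫ w, Y s w ∂ν‖ ^ 2) P ∧ ∫ s, ‖∫ w, Y s w ∂ν‖ ^ 2 ∂P ≤ R := by
  have hm1 : AEStronglyMeasurable (fun q : Ω × (ℝ × ℝ) => Y q.1 q.2.1) (P.prod (ν.prod ν)) :=
    hY.comp_quasiMeasurePreserving
      (QuasiMeasurePreserving.prodMap (Measure.QuasiMeasurePreserving.id P) Measure.quasiMeasurePreserving_fst)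
  have hm2 : AEStronglyMeasurable (fun q : Ω × (ℝ × ℝ) => Y q.1 q.2.2) (P.prod (ν.prod ν)) :=
    hY.comp_quasiMeasurePreserving
      (QuasiMeasurePreserving.prodMap (Measure.QuasiMeasurePreserving.id P) Measure.quasiMeasurePreserving_snd)
  have hm3 : AEStronglyMeasurable (fun q : Ω × (ℝ × ℝ) => Y q.1 q.2.1 * conj (Y q.1 q.2.2))
      (P.prod (ν.prod ν)) := hm1.mul (Complex.continuous_conj.comp_aestronglyMeasurable hm2)
  have hfst : ∀ {p : ℝ → Prop}, (∀ᵐ w ∂ν, p w) → ∀ᵐ q ∂(ν.prod ν), p q.1 := fun h =>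
    Measure.quasiMeasurePreserving_fst.ae h
  have hsnd : ∀ {p : ℝ → Prop}, (∀ᵐ w ∂ν, p w) → ∀ᵐ q ∂(ν.prod ν), p q.2 := fun h =>
    Measure.quasiMeasurePreserving_snd.ae h
  have hZ : Integrable (fun q : Ω × (ℝ × ℝ) => Y q.1 q.2.1 * conj (Y q.1 q.2.2))
      (P.prod (ν.prod ν)) := by
    rw [integrable_prod_iff' hm3]
    have hint : ∀ᵐ q ∂(ν.prod ν), Integrable (fun s => Y s q.1 * conj (Y s q.2)) P := by
      filter_upwards [hfst hmem, hsnd hmem] with q h1 h2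
      exact h1.integrable_mul h2.star
    refine ⟨hint, ?_⟩
    have hfin : Integrable (fun _ : ℝ × ℝ => K) (ν.prod ν) := integrable_const K
    refine hfin.mono' ?_ ?_
    · exact hm3.norm.prod_swap.integral_prod_right'
    · filter_upwards [hfst hmem, hsnd hmem, hfst hK, hsnd hK, hint] with q h1 h2 h3 h4 h5
      rw [Real.norm_of_nonneg (integral_nonneg fun _ => norm_nonneg _)]
      have i1 := (memLp_two_iff_integrable_sq_norm h1.1).1 h1
      have i2 := (memLp_two_iff_integrable_sq_norm h2.1).1 h2
      calc ∫ s, ‖Y s q.1 * conj (Y s q.2)‖ ∂P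
          ≤ ∫ s, (1 / 2 * ‖Y s q.1‖ ^ 2 + 1 / 2 * ‖Y s q.2‖ ^ 2) ∂P := by
            refine integral_mono h5.norm ((i1.const_mul _).add (i2.const_mul _)) fun s => ?_
            simp only [norm_mul, RCLike.norm_conj]
            nlinarith [sq_nonneg (‖Y s q.1‖ - ‖Y s q.2‖)]
        _ ≤ K := by
            rw [integral_add (i1.const_mul _) (i2.const_mul _), integral_const_mul,
              integral_const_mul]
            linarith
  have hprod : ∀ s, ∫ q : ℝ × ℝ, Y s q.1 * conj (Y s q.2) ∂(ν.prod ν)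
      = ((‖∫ w, Y s w ∂ν‖ ^ 2 : ℝ) : ℂ) := by
    intro s
    rw [integral_prod_mul (fun w => Y s w) (fun w => conj (Y s w)), integral_conj,
      Complex.mul_conj, Complex.normSq_eq_norm_sq]
  have hI := hZ.integral_prod_left
  simp only [hprod] at hI
  have hI' : Integrable (fun s => ‖∫ w, Y s w ∂ν‖ ^ 2) P := by
    have := hI.re
    simpa only [RCLike.re_to_complex, Complex.ofReal_re] using this
  refine ⟨hI', ?_⟩
  have hsw := integral_integral_swap (f := fun (s : Ω) (q : ℝ × ℝ) => Y s q.1 * conj (Y s q.2)) hZ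
  simp only [hprod] at hsw
  rw [integral_complex_ofReal] at hsw
  have h0 : 0 ≤ ∫ s, ‖∫ w, Y s w ∂ν‖ ^ 2 ∂P := integral_nonneg fun _ => by positivity
  calc ∫ s, ‖∫ w, Y s w ∂ν‖ ^ 2 ∂P = ‖((∫ s, ‖∫ w, Y s w ∂ν‖ ^ 2 ∂P : ℝ) : ℂ)‖ := by
        rw [Complex.norm_real, Real.norm_of_nonneg h0]
    _ ≤ _ := by
        rw [hsw]
        exact (norm_integral_le_integral_norm _).trans hR

/-- The sum of the `g n` has finite expectation, so it is almost surely finite and its terms tend to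
zero; this plays the role of Chebyshev with Borel–Cantelli. -/
theorem ae_tendsto_zero_of_summable {g : ℕ → Ω → ℝ} (h0 : ∀ n s, 0 ≤ g n s)
    (hi : ∀ n, Integrable (g n) P) {c : ℕ → ℝ} (hc : Summable c) (hgc : ∀ n, ∫ s, g n s ∂P ≤ c n) :
    ∀ᵐ s ∂P, Tendsto (fun n => g n s) atTop (𝓝 0) := by
  have hl : ∀ n, ∫⁻ s, ENNReal.ofReal (g n s) ∂P = ENNReal.ofReal (∫ s, g n s ∂P) := fun n =>
    (ofReal_integral_eq_lintegral_ofReal (hi n) (Eventually.of_forall (h0 n))).symm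
  have hm : ∀ n, AEMeasurable (fun s => ENNReal.ofReal (g n s)) P := fun n =>
    (hi n).aemeasurable.ennreal_ofReal
  have hs : ∫⁻ s, ∑' n, ENNReal.ofReal (g n s) ∂P ≠ ⊤ := by
    rw [lintegral_tsum hm]
    refine ne_top_of_le_ne_top hc.tsum_ofReal_ne_top (ENNReal.tsum_le_tsum fun n => ?_)
    rw [hl]
    exact ENNReal.ofReal_le_ofReal (hgc n)
  filter_upwards [ae_lt_top' (AEMeasurable.tsum hm) hs] with s hs
  have h := ENNReal.tendsto_atTop_zero_of_tsum_ne_top hs.ne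
  have h' := (ENNReal.tendsto_toReal ENNReal.zero_ne_top).comp h
  simpa [Function.comp_def, ENNReal.toReal_ofReal (h0 _ s)] using h'

/-- With `n = ⌊√T⌋`, the integral up to `T` is the one up to `n²` plus a piece dominated by the
integral of `‖y‖` over `[n², (n+1)²]`, while `1/T ≤ 1/n²`. -/
theorem tendsto_average_of_subsequence {y : ℝ → ℂ}
    (hy : ∀ a b, 1 ≤ a → 1 ≤ b → IntervalIntegrable y volume a b)
    (h : Tendsto (fun n : ℕ => (‖∫ w in (1 : ℝ)..((n : ℝ) ^ 2), y w‖ ^ 2 +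
      (∫ w in ((n : ℝ) ^ 2)..(((n : ℝ) + 1) ^ 2), ‖y w‖) ^ 2) / (n : ℝ) ^ 4) atTop (𝓝 0)) :
    Tendsto (fun T : ℝ => ((1 / T : ℝ) : ℂ) * ∫ w in (1 : ℝ)..T, y w) atTop (𝓝 0) := by
  have hsq := h.sqrt
  rw [Real.sqrt_zero] at hsq
  have hfl : Tendsto (fun T : ℝ => ⌊Real.sqrt T⌋₊) atTop atTop :=
    tendsto_nat_floor_atTop.comp Real.tendsto_sqrt_atTop
  have h2 := (hsq.comp hfl).const_mul 2
  rw [mul_zero] at h2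
  refine squeeze_zero_norm' ?_ h2
  filter_upwards [eventually_ge_atTop 1] with T hT
  have hT0 : 0 < T := by linarith
  set n := ⌊Real.sqrt T⌋₊ with hn
  have hs1 : 1 ≤ Real.sqrt T := Real.one_le_sqrt.2 hT
  have hn1 : (1 : ℝ) ≤ n := by
    exact_mod_cast (Nat.one_le_floor_iff _).2 hs1
  have hnT : (n : ℝ) ^ 2 ≤ T := by
    have h1 : (n : ℝ) ≤ Real.sqrt T := Nat.floor_le (Real.sqrt_nonneg _)
    calc (n : ℝ) ^ 2 ≤ Real.sqrt T ^ 2 := by gcongr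
      _ = T := Real.sq_sqrt hT0.le
  have hTn : T ≤ ((n : ℝ) + 1) ^ 2 := by
    have h1 : Real.sqrt T ≤ (n : ℝ) + 1 := (Nat.lt_floor_add_one _).le
    calc T = Real.sqrt T ^ 2 := (Real.sq_sqrt hT0.le).symm
      _ ≤ _ := by gcongr
  have hn2 : (1 : ℝ) ≤ (n : ℝ) ^ 2 := one_le_pow₀ hn1
  set A := ‖∫ w in (1 : ℝ)..((n : ℝ) ^ 2), y w‖ with hA
  set B := ∫ w in ((n : ℝ) ^ 2)..(((n : ℝ) + 1) ^ 2), ‖y w‖ with hB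
  have hA0 : 0 ≤ A := norm_nonneg _
  have hB0 : 0 ≤ B := intervalIntegral.integral_nonneg (hnT.trans hTn) fun _ _ => norm_nonneg _
  have hsplit : ‖∫ w in (1 : ℝ)..T, y w‖ ≤ A + B := by
    rw [← intervalIntegral.integral_add_adjacent_intervals (hy 1 _ le_rfl hn2) (hy _ T hn2 hT)]
    refine (norm_add_le _ _).trans (add_le_add le_rfl ?_)
    refine (intervalIntegral.norm_integral_le_integral_norm hnT).trans ?_
    exact intervalIntegral.integral_mono_interval le_rfl hnT hTn
      (Eventually.of_forall fun _ => norm_nonneg _) (hy _ _ hn2 (hT.trans hTn)).norm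
  have hsqrt : A + B ≤ 2 * Real.sqrt (A ^ 2 + B ^ 2) := by
    have h1 : A ≤ Real.sqrt (A ^ 2 + B ^ 2) := Real.le_sqrt_of_sq_le (by nlinarith)
    have h2 : B ≤ Real.sqrt (A ^ 2 + B ^ 2) := Real.le_sqrt_of_sq_le (by nlinarith)
    linarith
  have hroot : Real.sqrt ((A ^ 2 + B ^ 2) / (n : ℝ) ^ 4)
      = Real.sqrt (A ^ 2 + B ^ 2) / (n : ℝ) ^ 2 := by
    rw [Real.sqrt_div (by positivity), show (n : ℝ) ^ 4 = ((n : ℝ) ^ 2) ^ 2 by ring,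
      Real.sqrt_sq (by positivity)]
  simp only [Function.comp_apply]
  rw [← hn, ← hA, ← hB, hroot, norm_mul, Complex.norm_real, Real.norm_of_nonneg (by positivity)]
  calc 1 / T * ‖∫ w in (1 : ℝ)..T, y w‖
      ≤ 1 / (n : ℝ) ^ 2 * (2 * Real.sqrt (A ^ 2 + B ^ 2)) := by
        gcongr
        exact hsplit.trans hsqrt
    _ = _ := by ring

/-- The band average is twice the average at `2Q` minus the average at `Q`. -/
theorem tendsto_band_average_zero {y : ℝ → ℂ}
    (hy : ∀ a b, 1 ≤ a → 1 ≤ b → IntervalIntegrable y volume a b)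
    (h : Tendsto (fun T : ℝ => ((1 / T : ℝ) : ℂ) * ∫ w in (1 : ℝ)..T, y w) atTop (𝓝 0)) :
    Tendsto (fun Q : ℝ => ((1 / Q : ℝ) : ℂ) * ∫ w in Q..(2 * Q), y w) atTop (𝓝 0) := by
  have h2 := h.comp (tendsto_id.const_mul_atTop (by norm_num : (0 : ℝ) < 2))
  have h3 := (h2.const_mul 2).sub h
  rw [mul_zero, sub_zero] at h3
  refine h3.congr' ?_
  filter_upwards [eventually_ge_atTop 1] with Q hQ
  have hQ0 : (Q : ℂ) ≠ 0 := by exact_mod_cast (by linarith : Q ≠ 0)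
  rw [← intervalIntegral.integral_interval_sub_left (hy 1 (2 * Q) le_rfl (by linarith))
    (hy 1 Q le_rfl hQ)]
  simp only [Function.comp_apply, id]
  push_cast
  field_simp

theorem tendsto_band_average_of_tendsto {y : ℝ → ℂ} {L : ℂ}
    (hy : ∀ a b, 1 ≤ a → 1 ≤ b → IntervalIntegrable y volume a b)
    (h : Tendsto y atTop (𝓝 L)) :
    Tendsto (fun Q : ℝ => ((1 / Q : ℝ) : ℂ) * ∫ w in Q..(2 * Q), y w) atTop (𝓝 L) := by
  rw [Metric.tendsto_atTop] at h ⊢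
  intro ε hε
  obtain ⟨N, hN⟩ := h (ε / 2) (by positivity)
  refine ⟨max N 1, fun Q hQ => ?_⟩
  have hQN : N ≤ Q := (le_max_left _ _).trans hQ
  have hQ1 : 1 ≤ Q := (le_max_right _ _).trans hQ
  have hQ0 : (Q : ℂ) ≠ 0 := by exact_mod_cast (by linarith : Q ≠ 0)
  have hsub : ∫ w in Q..(2 * Q), (y w - L) = (∫ w in Q..(2 * Q), y w) - Q * L := by
    rw [intervalIntegral.integral_sub (hy _ _ hQ1 (by linarith)) (by simp),
      intervalIntegral.integral_const, Complex.real_smul]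
    push_cast
    ring
  have hb : ‖∫ w in Q..(2 * Q), (y w - L)‖ ≤ ε / 2 * |2 * Q - Q| := by
    refine intervalIntegral.norm_integral_le_of_norm_le_const fun w hw => ?_
    rw [Set.uIoc_of_le (by linarith)] at hw
    rw [← dist_eq_norm]
    exact (hN w (hQN.trans hw.1.le)).le
  rw [hsub, show 2 * Q - Q = Q by ring, abs_of_pos (by linarith)] at hb
  have he : ((1 / Q : ℝ) : ℂ) * (∫ w in Q..(2 * Q), y w) - L
      = ((1 / Q : ℝ) : ℂ) * ((∫ w in Q..(2 * Q), y w) - Q * L) := by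
    push_cast
    field_simp
  rw [dist_eq_norm, he, norm_mul, Complex.norm_real, Real.norm_of_nonneg (by positivity)]
  calc 1 / Q * ‖(∫ w in Q..(2 * Q), y w) - Q * L‖ ≤ 1 / Q * (ε / 2 * Q) := by gcongr
    _ = ε / 2 := by field_simp
    _ < ε := by linarith

/-- Each inner integral is at most the integral over the whole line, so the growth in `b - a` is
linear rather than quadratic. -/
theorem integral_prod_decay_le {C a b : ℝ} (hC : 0 ≤ C) (hab : a ≤ b) :
    ∫ p : ℝ × ℝ, C * (1 + ‖p.1 - p.2‖) ^ (-2 : ℝ)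
      ∂((volume.restrict (Set.Ioc a b)).prod (volume.restrict (Set.Ioc a b)))
      ≤ C * (∫ t : ℝ, (1 + ‖t‖) ^ (-2 : ℝ)) * (b - a) := by
  have hi : Integrable (fun t : ℝ => (1 + ‖t‖) ^ (-2 : ℝ)) :=
    integrable_one_add_norm (by simp)
  have hcont : Continuous fun p : ℝ × ℝ => C * (1 + ‖p.1 - p.2‖) ^ (-2 : ℝ) := by
    refine continuous_const.mul (Continuous.rpow_const (by fun_prop) fun p => Or.inl ?_)
    positivity
  rw [integral_prod]
  · have hin : ∀ w, ∫ w' in Set.Ioc a b, C * (1 + ‖w - w'‖) ^ (-2 : ℝ)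
        ≤ C * ∫ t : ℝ, (1 + ‖t‖) ^ (-2 : ℝ) := by
      intro w
      rw [integral_const_mul]
      refine mul_le_mul_of_nonneg_left ?_ hC
      rw [← integral_sub_left_eq_self (fun t : ℝ => (1 + ‖t‖) ^ (-2 : ℝ)) volume w]
      exact setIntegral_le_integral (hi.comp_sub_left w)
        (Eventually.of_forall fun t => by positivity)
    have h := norm_setIntegral_le_of_norm_le_const (μ := volume) (s := Set.Ioc a b)
      (f := fun w => ∫ w' in Set.Ioc a b, C * (1 + ‖w - w'‖) ^ (-2 : ℝ))
      measure_Ioc_lt_top (C := C * ∫ t : ℝ, (1 + ‖t‖) ^ (-2 : ℝ)) (fun w _ => by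
        rw [Real.norm_of_nonneg (integral_nonneg fun _ => by positivity)]
        exact hin w)
    rw [Real.volume_real_Ioc_of_le hab] at h
    exact (le_abs_self _).trans h
  · refine Integrable.mono' (integrable_const C) hcont.aestronglyMeasurable
      (Eventually.of_forall fun p => ?_)
    rw [Real.norm_of_nonneg (by positivity)]
    refine mul_le_of_le_one_right hC (Real.rpow_le_one_of_one_le_of_nonpos ?_ (by norm_num))
    linarith [norm_nonneg (p.1 - p.2)]

/-- For the centered process `Y`, the second moments of `∫ Y` over `[1, n²]` and of `∫ ‖Y‖` over
`[n², (n+1)²]` are both `O(n²)`. Divided by `n⁴` they are summable, so `Y` averages to zero almost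
surely; the mean is handled by its deterministic limit. -/
theorem ae_tendsto_band_average [IsProbabilityMeasure P] {X : Ω → ℝ → ℂ}
    (hX : AEStronglyMeasurable (Function.uncurry X) (P.prod volume))
    (hcont : ∀ s, ContinuousOn (X s) (Set.Ici 1))
    (hmem : ∀ w, 1 ≤ w → MemLp (fun s => X s w) 2 P) {C B : ℝ} {L : ℂ}
    (hB : ∀ w, 1 ≤ w → ‖∫ s, X s w ∂P‖ ≤ B)
    (hcov : ∀ w w', 1 ≤ w → 1 ≤ w' →
      ‖∫ s, (X s w - ∫ r, X r w ∂P) * conj (X s w' - ∫ r, X r w' ∂P) ∂P‖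
        ≤ C * (1 + ‖w - w'‖) ^ (-2 : ℝ))
    (hlim : Tendsto (fun w => ∫ s, X s w ∂P) atTop (𝓝 L)) :
    ∀ᵐ s ∂P, Tendsto (fun Q : ℝ => ((1 / Q : ℝ) : ℂ) * ∫ w in Q..(2 * Q), X s w) atTop (𝓝 L) := by
  set M : ℝ → ℂ := fun w => ∫ s, X s w ∂P with hM
  set Y : Ω → ℝ → ℂ := fun s w => X s w - M w with hY
  have hC : 0 ≤ C := by
    have := hcov 1 1 le_rfl le_rfl
    simp only [sub_self, norm_zero, add_zero, Real.one_rpow, mul_one] at this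
    exact (norm_nonneg _).trans this
  have hMm : AEStronglyMeasurable M volume := hX.prod_swap.integral_prod_right'
  have hYm : AEStronglyMeasurable (Function.uncurry Y) (P.prod volume) := hX.sub hMm.comp_snd
  have hYr : ∀ S : Set ℝ, AEStronglyMeasurable (Function.uncurry Y)
      (P.prod (volume.restrict S)) := fun S =>
    hYm.mono_ac (Measure.AbsolutelyContinuous.rfl.prod Measure.restrict_le_self.absolutelyContinuous)
  have hYmem : ∀ w, 1 ≤ w → MemLp (fun s => Y s w) 2 P := fun w hw =>
    (hmem w hw).sub (memLp_const _)
  have hYK : ∀ w, 1 ≤ w → ∫ s, ‖Y s w‖ ^ 2 ∂P ≤ C := by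
    intro w hw
    have h := hcov w w hw hw
    have he : ∀ s, (X s w - ∫ r, X r w ∂P) * conj (X s w - ∫ r, X r w ∂P)
        = ((‖Y s w‖ ^ 2 : ℝ) : ℂ) := fun s => by
      rw [Complex.mul_conj, Complex.normSq_eq_norm_sq]
    simp only [he, sub_self, norm_zero, add_zero, Real.one_rpow, mul_one] at h
    rw [integral_complex_ofReal, Complex.norm_real] at h
    exact (le_abs_self _).trans h
  have hMi : ∀ a b, 1 ≤ a → 1 ≤ b → IntervalIntegrable M volume a b := by
    intro a b ha hb
    refine (intervalIntegrable_const (c := B)).mono_fun' hMm.restrict ?_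
    refine (ae_restrict_iff' measurableSet_uIoc).2 (Eventually.of_forall fun w hw => hB w ?_)
    exact (le_min ha hb).trans hw.1.le
  have hXi : ∀ s a b, 1 ≤ a → 1 ≤ b → IntervalIntegrable (X s) volume a b := by
    intro s a b ha hb
    exact ((hcont s).mono fun w hw => (le_min ha hb).trans hw.1).intervalIntegrable
  have hYi : ∀ s a b, 1 ≤ a → 1 ≤ b → IntervalIntegrable (Y s) volume a b := fun s a b ha hb =>
    (hXi s a b ha hb).sub (hMi a b ha hb)
  set J := ∫ t : ℝ, (1 + ‖t‖) ^ (-2 : ℝ) with hJ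
  have hJ0 : 0 ≤ J := integral_nonneg fun _ => by positivity
  have hae : ∀ {a b : ℝ} {p : ℝ → Prop}, 1 ≤ a → (∀ w, 1 ≤ w → p w) →
      ∀ᵐ w ∂(volume.restrict (Set.Ioc a b)), p w := fun ha h =>
    (ae_restrict_iff' measurableSet_Ioc).2
      (Eventually.of_forall fun w hw => h w (ha.trans hw.1.le))
  have hae2 : ∀ {a b : ℝ} {p : ℝ × ℝ → Prop}, 1 ≤ a → (∀ w w', 1 ≤ w → 1 ≤ w' → p (w, w')) →
      ∀ᵐ q ∂((volume.restrict (Set.Ioc a b)).prod (volume.restrict (Set.Ioc a b))), p q := by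
    intro a b p ha h
    rw [Measure.prod_restrict]
    refine (ae_restrict_iff' (measurableSet_Ioc.prod measurableSet_Ioc)).2
      (Eventually.of_forall fun q hq => ?_)
    exact h q.1 q.2 (ha.trans hq.1.1.le) (ha.trans hq.2.1.le)
  have hI : ∀ T : ℝ, 1 ≤ T → Integrable (fun s => ‖∫ w in (1 : ℝ)..T, Y s w‖ ^ 2) P ∧
      ∫ s, ‖∫ w in (1 : ℝ)..T, Y s w‖ ^ 2 ∂P ≤ C * J * (T - 1) := by
    intro T hT
    simp only [intervalIntegral.integral_of_le hT]
    refine integral_norm_sq_integral_le (hYr _) (hae le_rfl hYmem) (hae le_rfl hYK) ?_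
    refine le_trans ?_ (integral_prod_decay_le hC hT)
    refine integral_mono_of_nonneg (Eventually.of_forall fun _ => norm_nonneg _) ?_
      (hae2 le_rfl fun w w' hw hw' => hcov w w' hw hw')
    refine Integrable.mono' (integrable_const C) ?_ (Eventually.of_forall fun p => ?_)
    · refine (continuous_const.mul (Continuous.rpow_const (by fun_prop) fun p =>
        Or.inl ?_)).aestronglyMeasurable
      positivity
    · rw [Real.norm_of_nonneg (by positivity)]
      refine mul_le_of_le_one_right hC (Real.rpow_le_one_of_one_le_of_nonpos ?_ (by norm_num))
      linarith [norm_nonneg (p.1 - p.2)]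
  -- No decorrelation is available for `‖Y‖`, so only `2xy ≤ x² + y²` is used; the quadratic bound
  -- suffices because the gaps have length `2n + 1`.
  have hT : ∀ a b : ℝ, 1 ≤ a → a ≤ b → Integrable (fun s => (∫ w in a..b, ‖Y s w‖) ^ 2) P ∧
      ∫ s, (∫ w in a..b, ‖Y s w‖) ^ 2 ∂P ≤ C * (b - a) ^ 2 := by
    intro a b ha hab
    have h := integral_norm_sq_integral_le (P := P) (ν := volume.restrict (Set.Ioc a b))
      (Y := fun s w => ((‖Y s w‖ : ℝ) : ℂ)) (K := C) (R := C * (b - a) ^ 2)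
      (Complex.continuous_ofReal.comp_aestronglyMeasurable (hYr _).norm)
      (hae ha fun w hw => (hYmem w hw).norm.ofReal) (hae ha fun w hw => by simpa using hYK w hw) ?_
    · simp only [integral_complex_ofReal, Complex.norm_real, Real.norm_eq_abs, sq_abs] at h
      simpa only [intervalIntegral.integral_of_le hab] using h
    · have hb : ∀ᵐ q ∂((volume.restrict (Set.Ioc a b)).prod (volume.restrict (Set.Ioc a b))),
          ‖∫ s, ((‖Y s q.1‖ : ℝ) : ℂ) * conj ((‖Y s q.2‖ : ℝ) : ℂ) ∂P‖ ≤ C := by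
        refine hae2 ha fun w w' hw hw' => ?_
        have i1 := (memLp_two_iff_integrable_sq_norm (hYmem w hw).1).1 (hYmem w hw)
        have i2 := (memLp_two_iff_integrable_sq_norm (hYmem w' hw').1).1 (hYmem w' hw')
        have h5 := (hYmem w hw).norm.integrable_mul (hYmem w' hw').norm
        simp only [Complex.conj_ofReal, ← Complex.ofReal_mul]
        rw [integral_complex_ofReal, Complex.norm_real,
          Real.norm_of_nonneg (integral_nonneg fun _ => by positivity)]
        calc ∫ s, ‖Y s w‖ * ‖Y s w'‖ ∂P
            ≤ ∫ s, (1 / 2 * ‖Y s w‖ ^ 2 + 1 / 2 * ‖Y s w'‖ ^ 2) ∂P := by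
              refine integral_mono h5 ((i1.const_mul _).add (i2.const_mul _)) fun s => ?_
              simp only
              nlinarith [sq_nonneg (‖Y s w‖ - ‖Y s w'‖)]
          _ ≤ C := by
              rw [integral_add (i1.const_mul _) (i2.const_mul _), integral_const_mul,
                integral_const_mul]
              linarith [hYK w hw, hYK w' hw']
      have h6 := integral_mono_of_nonneg (Eventually.of_forall fun _ => norm_nonneg _)
        (integrable_const C) hb
      refine h6.trans_eq ?_
      rw [integral_const, smul_eq_mul, mul_comm, measureReal_def, Measure.prod_restrict,
        Measure.restrict_apply_univ, Measure.prod_prod, Real.volume_Ioc, ENNReal.toReal_mul,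
        ENNReal.toReal_ofReal (by linarith)]
      ring
  -- The index starts at `n + 1` so that every interval lies in `[1, ∞)`, where the moment bounds
  -- hold.
  have hae0 : ∀ᵐ s ∂P, Tendsto (fun n : ℕ => (‖∫ w in (1 : ℝ)..(((n + 1 : ℕ) : ℝ) ^ 2), Y s w‖ ^ 2 +
      (∫ w in (((n + 1 : ℕ) : ℝ) ^ 2)..((((n + 1 : ℕ) : ℝ) + 1) ^ 2), ‖Y s w‖) ^ 2)
        / ((n + 1 : ℕ) : ℝ) ^ 4) atTop (𝓝 0) := by
    refine ae_tendsto_zero_of_summable (c := fun n : ℕ => (C * J + 9 * C) *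
      (1 / ((n + 1 : ℕ) : ℝ) ^ 2)) (fun n s => by positivity) (fun n => ?_) ?_ (fun n => ?_)
    · have hn : (1 : ℝ) ≤ ((n + 1 : ℕ) : ℝ) := by simp
      exact ((hI _ (one_le_pow₀ hn)).1.add (hT _ _ (one_le_pow₀ hn) (by gcongr; simp)).1).div_const _
    · exact (((summable_nat_add_iff 1).2
        (Real.summable_one_div_nat_pow.2 (by norm_num : 1 < 2))).mul_left _)
    · have hn : (1 : ℝ) ≤ ((n + 1 : ℕ) : ℝ) := by simp
      obtain ⟨i1, e1⟩ := hI _ (one_le_pow₀ hn (n := 2))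
      obtain ⟨i2, e2⟩ := hT (((n + 1 : ℕ) : ℝ) ^ 2) ((((n + 1 : ℕ) : ℝ) + 1) ^ 2)
        (one_le_pow₀ hn) (by gcongr; simp)
      rw [integral_div, integral_add i1 i2, mul_one_div, div_le_div_iff₀ (by positivity)
        (by positivity)]
      set N : ℝ := ((n + 1 : ℕ) : ℝ) with hN
      have h9 : ((N + 1) ^ 2 - N ^ 2) ^ 2 ≤ 9 * N ^ 2 := by nlinarith
      have hCJ : 0 ≤ C * J := mul_nonneg hC hJ0
      have e3 : C * ((N + 1) ^ 2 - N ^ 2) ^ 2 ≤ C * (9 * N ^ 2) :=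
        mul_le_mul_of_nonneg_left h9 hC
      have e4 := add_le_add e1 (e2.trans e3)
      refine (mul_le_mul_of_nonneg_right e4 (by positivity : 0 ≤ N ^ 2)).trans ?_
      have hN2 : 0 ≤ N ^ 2 := by positivity
      nlinarith [mul_nonneg hCJ hN2]
  filter_upwards [hae0] with s hs
  have hs' := (tendsto_add_atTop_iff_nat (f := fun n : ℕ =>
    (‖∫ w in (1 : ℝ)..((n : ℝ) ^ 2), Y s w‖ ^ 2 +
      (∫ w in ((n : ℝ) ^ 2)..(((n : ℝ) + 1) ^ 2), ‖Y s w‖) ^ 2) / (n : ℝ) ^ 4) 1).1 hs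
  have h1 := tendsto_band_average_zero (hYi s) (tendsto_average_of_subsequence (hYi s) hs')
  have h2 := h1.add (tendsto_band_average_of_tendsto hMi hlim)
  rw [zero_add] at h2
  refine h2.congr' ?_
  filter_upwards [eventually_ge_atTop 1] with Q hQ
  rw [← mul_add, ← intervalIntegral.integral_add (hYi s _ _ hQ (by linarith))
    (hMi _ _ hQ (by linarith))]
  simp only [hY, sub_add_cancel]

end Ergodic

/-! ### Regularity of the source transform in the frequency variable -/

section PlaneWave

variable {d : ℕ}

/-- A derivative of the slice is the derivative of the joint function restricted to directions in
the second factor, hence jointly continuous. -/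
theorem continuous_iteratedFDeriv_slice {E F G : Type*} [NormedAddCommGroup E] [NormedSpace ℝ E]
    [NormedAddCommGroup F] [NormedSpace ℝ F] [NormedAddCommGroup G] [NormedSpace ℝ G]
    {Φ : E × F → G} (hΦ : ContDiff ℝ ∞ Φ) (i : ℕ) :
    Continuous fun p : E × F => iteratedFDeriv ℝ i (fun x => Φ (p.1, x)) p.2 := by
  have h : (fun p : E × F => iteratedFDeriv ℝ i (fun x => Φ (p.1, x)) p.2) = fun p =>
      (iteratedFDeriv ℝ i Φ p).compContinuousLinearMap
        fun _ => ContinuousLinearMap.inr ℝ E F := by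
    funext p
    have hs : (fun x => Φ (p.1, x)) =
        (fun q => Φ ((p.1, (0 : F)) + q)) ∘ ContinuousLinearMap.inr ℝ E F := by
      funext x
      simp
    have ht : ContDiff ℝ ∞ fun q => Φ ((p.1, (0 : F)) + q) :=
      hΦ.comp (contDiff_const.add contDiff_id)
    rw [hs, ContinuousLinearMap.iteratedFDeriv_comp_right _ ht _ (by exact_mod_cast le_top),
      iteratedFDeriv_comp_add_left]
    simp
  rw [h]
  have hL := (ContinuousMultilinearMap.compContinuousLinearMapL (𝕜 := ℝ) (F := G)
    (fun _ : Fin i => ContinuousLinearMap.inr ℝ E F)).continuous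
  exact hL.comp (hΦ.continuous_iteratedFDeriv (by exact_mod_cast le_top))

/-- The topology is uniform convergence of every derivative. Joint continuity gives this uniformly
on the compact `K`, and off `K` all derivatives vanish. -/
theorem continuous_contDiffMapSupportedIn {X E F : Type*} [TopologicalSpace X]
    [NormedAddCommGroup E] [NormedSpace ℝ E] [NormedAddCommGroup F] [NormedSpace ℝ F]
    {K : TopologicalSpace.Compacts E} {φ : X → 𝓓_{K}(E, F)}
    (h : ∀ i, Continuous fun p : X × E => iteratedFDeriv ℝ i (φ p.1) p.2) : Continuous φ := by
  rw [ContDiffMapSupportedIn.continuous_iff_comp]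
  intro i
  let G : X → C(E, ContinuousMultilinearMap ℝ (fun _ : Fin i => E) F) := fun ζ =>
    ⟨fun x => iteratedFDeriv ℝ i (φ ζ) x, (h i).comp (by fun_prop : Continuous fun x : E => (ζ, x))⟩
  have hG : Continuous G := ContinuousMap.continuous_of_continuous_uncurry G (h i)
  refine continuous_iff_continuousAt.2 fun ζ => ?_
  rw [ContinuousAt, BoundedContinuousFunction.tendsto_iff_tendstoUniformly,
    Metric.tendstoUniformly_iff]
  intro ε hε
  have h1 := ContinuousMap.tendsto_iff_forall_isCompact_tendstoUniformlyOn.1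
    (hG.tendsto ζ) (K : Set E) K.isCompact
  rw [Metric.tendstoUniformlyOn_iff] at h1
  filter_upwards [h1 ε hε] with ζ' hζ' x
  have he : ∀ ζ, ContDiffMapSupportedIn.structureMapCLM ℝ ⊤ i (φ ζ) x
      = iteratedFDeriv ℝ i (φ ζ) x := fun ζ => by
    rw [ContDiffMapSupportedIn.structureMapCLM_top_apply]
  simp only [Function.comp_apply, he]
  by_cases hx : x ∈ K
  · exact hζ' x hx
  · rw [(φ ζ).iteratedFDeriv_zero_on_compl hx, (φ ζ').iteratedFDeriv_zero_on_compl hx]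
    simpa using hε

theorem contDiff_planeWave_uncurry (χ : Test d) :
    ContDiff ℝ ∞ fun p : Space d × Space d =>
      χ p.2 * Complex.exp (-(Complex.I * (inner ℝ p.1 p.2 : ℝ))) := by
  have h1 : ContDiff ℝ ∞ (χ : Space d → ℂ) := χ.contDiff
  have h2 : ContDiff ℝ ∞ (fun p : Space d × Space d => ((inner ℝ p.1 p.2 : ℝ) : ℂ)) :=
    Complex.ofRealCLM.contDiff.comp (contDiff_fst.inner ℝ contDiff_snd)
  exact (h1.comp contDiff_snd).mul ((contDiff_const.mul h2).neg.cexp)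

/-- All the functions `χ e^{-iζ·}` are supported in the fixed compact `tsupport χ`, so continuity
can be checked there. It makes each realization of the source transform continuous in the frequency.
-/
theorem continuous_planeWave (χ : Test d) : Continuous (planeWave χ) := by
  let K : TopologicalSpace.Compacts (Space d) := ⟨tsupport χ, χ.hasCompactSupport⟩
  let φ : Space d → 𝓓_{K}(Space d, ℂ) := fun ζ =>
    ContDiffMapSupportedIn.of_support_subset (planeWave χ ζ).contDiff (by
      intro x hx
      refine subset_tsupport _ fun h => hx ?_
      change χ x * _ = 0
      rw [h, zero_mul])
  have hφ : planeWave χ = TestFunction.ofSupportedIn (Ω := ⊤) (fun _ _ => trivial) ∘ φ := by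
    funext ζ
    ext x
    rfl
  rw [hφ]
  exact (TestFunction.continuous_ofSupportedIn _).comp (continuous_contDiffMapSupportedIn fun i =>
    continuous_iteratedFDeriv_slice (contDiff_planeWave_uncurry χ) i)

/-- Each `U · w` is only almost everywhere measurable, with an exceptional set depending on `w`.
Measurable versions at rational `w` share one null set; after zeroing the process there, continuity
reaches all `w` and gives a jointly measurable version. -/
theorem aestronglyMeasurable_uncurry_of_continuous {Ω : Type*} [MeasurableSpace Ω]
    {P : Measure Ω} [SFinite P] {ν : Measure ℝ} [SFinite ν] {U : Ω → ℝ → ℂ}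
    (hm : ∀ w, AEMeasurable (fun s => U s w) P) (hc : ∀ s, Continuous (U s)) :
    AEStronglyMeasurable (Function.uncurry U) (P.prod ν) := by
  have hq : ∀ᵐ s ∂P, ∀ q : ℚ, U s q = (hm q).mk _ s := ae_all_iff.2 fun q => (hm q).ae_eq_mk
  set A := (toMeasurable P {s | ¬ ∀ q : ℚ, U s q = (hm q).mk _ s})ᶜ with hA_def
  have hAm : MeasurableSet A := (measurableSet_toMeasurable _ _).compl
  have hA : ∀ s ∈ A, ∀ q : ℚ, U s q = (hm q).mk _ s := by
    intro s hs
    by_contra hn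
    exact hs (subset_toMeasurable _ _ hn)
  have hA0 : P Aᶜ = 0 := by
    rw [hA_def, compl_compl, measure_toMeasurable]
    exact hq
  let G : Ω → ℝ → ℂ := fun s w => A.indicator (fun s => U s w) s
  have hGq : ∀ q : ℚ, Measurable fun s => G s q := by
    intro q
    have : (fun s => G s q) = A.indicator ((hm q).mk _) := by
      funext s
      by_cases hs : s ∈ A
      · simp only [G, Set.indicator_of_mem hs]
        exact hA s hs q
      · simp only [G, Set.indicator_of_notMem hs]
    rw [this]
    exact (hm q).measurable_mk.indicator hAm
  have hGc : ∀ s, Continuous (G s) := by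
    intro s
    by_cases hs : s ∈ A
    · simpa only [G, Set.indicator_of_mem hs] using hc s
    · simpa only [G, Set.indicator_of_notMem hs] using continuous_const
  have hGm : ∀ w, Measurable fun s => G s w := by
    intro w
    obtain ⟨x, hx, hxw⟩ := mem_closure_iff_seq_limit.1 (Rat.denseRange_cast (𝕜 := ℝ) w)
    choose q hq using hx
    refine measurable_of_tendsto_metrizable (fun n => hGq (q n)) (tendsto_pi_nhds.2 fun s => ?_)
    simp only [hq]
    exact ((hGc s).tendsto w).comp hxw
  have hGu : Measurable (Function.uncurry G) :=
    (measurable_uncurry_of_continuous_of_measurable (u := fun w s => G s w) hGc hGm).comp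
      measurable_swap
  refine ⟨Function.uncurry G, hGu.stronglyMeasurable, ?_⟩
  have hAae : ∀ᵐ s ∂P, s ∈ A := hA0
  filter_upwards [Measure.quasiMeasurePreserving_fst.ae hAae] with p hp
  simp only [Function.uncurry, G, Set.indicator_of_mem hp]

end PlaneWave

/-! ### Recovery of a function from its Fourier transform on an open cone -/

section Recovery

variable {d : ℕ}

/-- On the support of `a` the exponent has real part at most `|z| K`, so one may differentiate under
the integral: the transform along a line extends to an entire function. -/
theorem differentiable_fourierInt_line {a : Space d → ℂ} (ha : Continuous a)
    (hac : HasCompactSupport a) (ξ v : Space d) :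
    Differentiable ℂ fun z : ℂ => ∫ x, Complex.exp (-(Complex.I * ((inner ℝ x ξ : ℝ) +
      z * (inner ℝ x v : ℝ)))) * a x := by
  intro z₀
  obtain ⟨R, hR⟩ := hac.isBounded.exists_norm_le
  set K := |R| * ‖v‖ with hK
  have hin : ∀ x, a x ≠ 0 → |(inner ℝ x v : ℝ)| ≤ K := fun x hx =>
    (abs_real_inner_le_norm x v).trans (mul_le_mul_of_nonneg_right
      ((hR x (subset_tsupport a hx)).trans (le_abs_self R)) (norm_nonneg v))
  have hK0 : 0 ≤ K := by positivity
  have hcont : ∀ z : ℂ, Continuous fun x : Space d =>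
      Complex.exp (-(Complex.I * ((inner ℝ x ξ : ℝ) + z * (inner ℝ x v : ℝ)))) * a x := by
    intro z
    fun_prop
  have hd : ∀ x (z : ℂ), HasDerivAt (fun z : ℂ =>
      Complex.exp (-(Complex.I * ((inner ℝ x ξ : ℝ) + z * (inner ℝ x v : ℝ)))) * a x)
      (Complex.exp (-(Complex.I * ((inner ℝ x ξ : ℝ) + z * (inner ℝ x v : ℝ)))) *
        (-(Complex.I * (inner ℝ x v : ℝ))) * a x) z := by
    intro x z
    have h1 : HasDerivAt (fun z : ℂ => -(Complex.I * ((inner ℝ x ξ : ℝ) +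
        z * (inner ℝ x v : ℝ)))) (-(Complex.I * (1 * (inner ℝ x v : ℝ)))) z :=
      ((((hasDerivAt_id z).mul_const _).const_add _).const_mul _).neg
    rw [one_mul] at h1
    exact h1.cexp.mul_const _
  refine (hasDerivAt_integral_of_dominated_loc_of_deriv_le (μ := volume)
    (F' := fun z x => Complex.exp (-(Complex.I * ((inner ℝ x ξ : ℝ) + z * (inner ℝ x v : ℝ)))) *
        (-(Complex.I * (inner ℝ x v : ℝ))) * a x)
    (bound := fun x => Real.exp ((‖z₀‖ + 1) * K) * K * ‖a x‖)
    (Metric.ball_mem_nhds z₀ one_pos)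
    (Eventually.of_forall fun z => (hcont z).aestronglyMeasurable) ?_ ?_ ?_ ?_ ?_).2.differentiableAt
  · exact (hcont z₀).integrable_of_hasCompactSupport hac.mul_left
  · exact Continuous.aestronglyMeasurable (by fun_prop)
  · refine Eventually.of_forall fun x z hz => ?_
    by_cases hx : a x = 0
    · simp [hx]
    rw [norm_mul, norm_mul, Complex.norm_exp, norm_neg, norm_mul, Complex.norm_I, one_mul,
      Complex.norm_real, Real.norm_eq_abs]
    have hz' : ‖z‖ ≤ ‖z₀‖ + 1 := by
      have h1 : ‖z - z₀‖ < 1 := by simpa [dist_eq_norm] using hz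
      have h2 : ‖z‖ ≤ ‖z₀‖ + ‖z - z₀‖ := by simpa using norm_add_le z₀ (z - z₀)
      linarith
    have hre : (-(Complex.I * ((inner ℝ x ξ : ℝ) + z * (inner ℝ x v : ℝ)))).re
        ≤ (‖z₀‖ + 1) * K := by
      have h1 : (-(Complex.I * ((inner ℝ x ξ : ℝ) + z * (inner ℝ x v : ℝ)))).re
          = z.im * (inner ℝ x v : ℝ) := by simp
      rw [h1]
      refine (le_abs_self _).trans ?_
      rw [abs_mul]
      exact mul_le_mul ((Complex.abs_im_le_norm z).trans hz') (hin x hx) (abs_nonneg _)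
        (by positivity)
    gcongr
    exact hin x hx
  · exact ((ha.norm.integrable_of_hasCompactSupport hac.norm).const_mul _)
  · exact Eventually.of_forall fun x z _ => hd x z

/-- On the line from `ξ₀` to any `ξ` the entire extension vanishes near `0` on the real axis, hence
identically, in particular at `1`. Inversion then gives `a = 0`. -/
theorem eq_zero_of_fourierInt_eventually_eq_zero {a : Space d → ℂ} (ha : ContDiff ℝ ∞ a)
    (hac : HasCompactSupport a) {ξ₀ : Space d} (h : ∀ᶠ ξ in 𝓝 ξ₀, fourierInt a ξ = 0) :
    a = 0 := by
  have hz : ∀ ξ, fourierInt a ξ = 0 := by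
    intro ξ
    set v := ξ - ξ₀ with hv
    set H : ℂ → ℂ := fun z => ∫ x, Complex.exp (-(Complex.I * ((inner ℝ x ξ₀ : ℝ) +
      z * (inner ℝ x v : ℝ)))) * a x with hH
    have hHt : ∀ t : ℝ, H t = fourierInt a (ξ₀ + t • v) := by
      intro t
      simp only [hH]
      rw [fourierInt]
      congr 1
      funext x
      rw [inner_add_right, inner_smul_right]
      push_cast
      rfl
    have hHd : Differentiable ℂ H := differentiable_fourierInt_line ha.continuous hac ξ₀ v
    have hHa : AnalyticOnNhd ℂ H Set.univ := fun z _ => hHd.analyticAt z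
    have hev : ∀ᶠ t : ℝ in 𝓝[≠] 0, H t = 0 := by
      have hc : Tendsto (fun t : ℝ => ξ₀ + t • v) (𝓝 0) (𝓝 ξ₀) := by
        have : Continuous fun t : ℝ => ξ₀ + t • v := by fun_prop
        simpa using this.tendsto 0
      filter_upwards [nhdsWithin_le_nhds (hc.eventually h)] with t ht
      rw [hHt, ht]
    have hto : Tendsto (fun t : ℝ => (t : ℂ)) (𝓝[≠] 0) (𝓝[≠] 0) := by
      refine tendsto_nhdsWithin_of_tendsto_nhds_of_eventually_within _ ?_ ?_
      · have := Complex.continuous_ofReal.tendsto 0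
        rw [Complex.ofReal_zero] at this
        exact this.mono_left nhdsWithin_le_nhds
      · filter_upwards [self_mem_nhdsWithin] with t ht
        simpa using ht
    have hfr : ∃ᶠ z in 𝓝[≠] (0 : ℂ), H z = (fun _ => (0 : ℂ)) z := hto.frequently hev.frequently
    have hall := hHa.eq_of_frequently_eq (fun z _ => analyticAt_const) hfr
    have h1 := hHt 1
    rw [hall, one_smul, hv, add_sub_cancel] at h1
    exact h1.symm
  funext x
  rw [← fourierInt_inversion ha hac x]
  simp [hz]

theorem fourierInt_sub {u v : Space d → ℂ} (hu : Integrable u) (hv : Integrable v) (k : Space d) :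
    fourierInt (fun x => u x - v x) k = fourierInt u k - fourierInt v k := by
  have h := fourierInt_add hu (hv.mul_const (-1)) k
  rw [fourierInt_mul_const] at h
  simpa [sub_eq_add_neg] using h

theorem eventually_mem_cone {Θ : Set (ℝ≥0 × Direction d)} (hΘ : IsOpen Θ) (hne : Θ.Nonempty)
    {c : ℝ} (hc : 0 < c) :
    ∃ ξ₀ : Space d, ∀ᶠ ξ in 𝓝 ξ₀, ∃ θ ∈ Θ, ξ = (c * (θ.1 : ℝ)) • (θ.2 : Space d) := by
  obtain ⟨⟨τ₀, e⟩, hθ⟩ := hne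
  obtain ⟨U, V, hU, hV, hτU, heV, hUV⟩ := isOpen_prod_iff.1 hΘ τ₀ e hθ
  obtain ⟨V', hV', rfl⟩ := isOpen_induced_iff.1 hV
  -- The given `τ₀` may be `0`, where polar coordinates degenerate; openness of `U` allows a
  -- positive radius.
  obtain ⟨τ, hτU, hτ⟩ : ∃ τ ∈ U, 0 < τ := by
    have h1 : ∀ᶠ ε : ℝ≥0 in 𝓝[>] 0, τ₀ + ε ∈ U := by
      have hct : Tendsto (fun ε : ℝ≥0 => τ₀ + ε) (𝓝 0) (𝓝 τ₀) := by
        have : Continuous fun ε : ℝ≥0 => τ₀ + ε := by fun_prop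
        simpa using this.tendsto 0
      exact nhdsWithin_le_nhds (hct.eventually (hU.mem_nhds hτU))
    obtain ⟨ε, h2, h3⟩ := (h1.and self_mem_nhdsWithin).exists
    exact ⟨τ₀ + ε, h2, add_pos_of_nonneg_of_pos zero_le h3⟩
  have he : ‖(e : Space d)‖ = 1 := by simp
  have hτ' : (0 : ℝ) < τ := hτ
  set ξ₀ : Space d := (c * (τ : ℝ)) • (e : Space d) with hξ₀
  have hn0 : ‖ξ₀‖ = c * τ := by
    rw [hξ₀, norm_smul, he, mul_one, Real.norm_of_nonneg (by positivity)]
  have hξ0 : ξ₀ ≠ 0 := norm_ne_zero_iff.1 (by rw [hn0]; positivity)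
  have hcU : ContinuousAt (fun ξ : Space d => Real.toNNReal (‖ξ‖ / c)) ξ₀ := by
    exact (continuous_real_toNNReal.comp (by fun_prop)).continuousAt
  have hcV : ContinuousAt (fun ξ : Space d => ‖ξ‖⁻¹ • ξ) ξ₀ :=
    (continuousAt_id.norm.inv₀ (norm_ne_zero_iff.2 hξ0)).smul continuousAt_id
  have hU0 : Real.toNNReal (‖ξ₀‖ / c) = τ := by
    rw [hn0, mul_div_cancel_left₀ _ hc.ne', Real.toNNReal_coe]
  have hV0 : ‖ξ₀‖⁻¹ • ξ₀ = e := by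
    rw [hn0, hξ₀, smul_smul, inv_mul_cancel₀ (by positivity), one_smul]
  refine ⟨ξ₀, ?_⟩
  filter_upwards [hcU.eventually_mem (hU.mem_nhds (hU0 ▸ hτU)),
    hcV.eventually_mem (hV'.mem_nhds (by rw [hV0]; exact heV)),
    eventually_ne_nhds hξ0] with ξ h1 h2 h3
  have hξn : ‖ξ‖ ≠ 0 := norm_ne_zero_iff.2 h3
  have hmem : ‖ξ‖⁻¹ • ξ ∈ Metric.sphere (0 : Space d) 1 := by
    rw [mem_sphere_zero_iff_norm, norm_smul, norm_inv, norm_norm, inv_mul_cancel₀ hξn]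
  refine ⟨(Real.toNNReal (‖ξ‖ / c), ⟨_, hmem⟩), hUV ⟨h1, h2⟩, ?_⟩
  rw [Real.coe_toNNReal _ (by positivity), mul_div_cancel₀ _ hc.ne', smul_smul,
    mul_inv_cancel₀ hξn, one_smul]

theorem eq_of_fourierInt_eq_on_cone {Θ : Set (ℝ≥0 × Direction d)} (hΘ : IsOpen Θ)
    (hne : Θ.Nonempty) {c : ℝ} (hc : 0 < c) {S : Set Θ} (hS : Dense S) {a b : Space d → ℂ}
    (ha : ContDiff ℝ ∞ a) (hac : HasCompactSupport a) (hb : ContDiff ℝ ∞ b)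
    (hbc : HasCompactSupport b)
    (h : ∀ θ ∈ S, fourierInt a ((c * (θ.1.1 : ℝ)) • (θ.1.2 : Space d))
      = fourierInt b ((c * (θ.1.1 : ℝ)) • (θ.1.2 : Space d))) : a = b := by
  have hai := ha.continuous.integrable_of_hasCompactSupport hac (μ := volume)
  have hbi := hb.continuous.integrable_of_hasCompactSupport hbc (μ := volume)
  have hcone : Continuous fun θ : Θ => (c * (θ.1.1 : ℝ)) • (θ.1.2 : Space d) := by fun_prop
  have hext := Continuous.ext_on hS ((continuous_fourierInt hai).comp hcone)
    ((continuous_fourierInt hbi).comp hcone) h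
  obtain ⟨ξ₀, hξ₀⟩ := eventually_mem_cone hΘ hne hc
  have h0 := eq_zero_of_fourierInt_eventually_eq_zero (a := fun x => a x - b x) (ξ₀ := ξ₀)
    (ha.sub hb) (hac.sub hbc) (by
      filter_upwards [hξ₀] with ξ hξ
      obtain ⟨θ, hθ, rfl⟩ := hξ
      rw [fourierInt_sub hai hbi, sub_eq_zero]
      exact congrFun hext ⟨θ, hθ⟩)
  funext x
  exact sub_eq_zero.1 (congrFun h0 x)

/-- The map chooses any smooth compactly supported field compatible with the data on `S`; by
`eq_of_fourierInt_eq_on_cone` there is at most one. Data outside `S` are not constrained, so an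
empty limit set there does no harm. -/
theorem exists_recovery {Θ : Set (ℝ≥0 × Direction d)} (hΘ : IsOpen Θ) (hne : Θ.Nonempty)
    {c : ℝ} (hc : 0 < c) {S : Set Θ} (hS : Dense S) {k : ℂ} (hk : k ≠ 0) :
    ∃ R : (Θ → Set (Matrix (Fin d) (Fin d) ℂ)) → (Space d → Matrix (Fin d) (Fin d) ℂ),
      ∀ (F : Θ → Set (Matrix (Fin d) (Fin d) ℂ)) (A : Space d → Matrix (Fin d) (Fin d) ℂ),
        (∀ θ, (F θ).Subsingleton) →
        (∀ j l, ContDiff ℝ ∞ (fun x => A x j l) ∧ HasCompactSupport (fun x => A x j l)) →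
        (∀ θ ∈ S, k • fourierMat A ((c * (θ.1.1 : ℝ)) • (θ.1.2 : Space d)) ∈ F θ) → R F = A := by
  classical
  let good : (Θ → Set (Matrix (Fin d) (Fin d) ℂ)) → (Space d → Matrix (Fin d) (Fin d) ℂ) → Prop :=
    fun F A =>
      (∀ j l, ContDiff ℝ ∞ (fun x => A x j l) ∧ HasCompactSupport (fun x => A x j l)) ∧
      ∀ θ ∈ S, k • fourierMat A ((c * (θ.1.1 : ℝ)) • (θ.1.2 : Space d)) ∈ F θ
  refine ⟨fun F => if h : ∃ A, good F A then h.choose else 0, fun F A hF hA hAF => ?_⟩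
  have hex : ∃ A, good F A := ⟨A, hA, hAF⟩
  simp only [dif_pos hex]
  obtain ⟨hB, hBF⟩ := hex.choose_spec
  set B := hex.choose
  funext x
  ext j l
  refine congrFun (eq_of_fourierInt_eq_on_cone hΘ hne hc hS (hB j l).1 (hB j l).2 (hA j l).1
    (hA j l).2 fun θ hθ => ?_) x
  have h1 := smul_right_injective _ hk (hF θ (hBF θ hθ) (hAF θ hθ))
  exact congrFun (congrFun h1 j) l

end Recovery

/-! ### Averages of products of Gaussian processes -/

section Products

variable {Ω : Type*} [MeasurableSpace Ω] {P : Measure Ω} [IsProbabilityMeasure P]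

/-- By Wick's formula the covariance of `UV` at `w, w'` is `E[UŪ']E[VV̄'] + E[UV̄']E[VŪ']`. Each
factor decays like `(1+|w-w'|)^{-1}`, so each product has the decay required by
`ae_tendsto_band_average`; the weight `a` compensates the sizes `p` and `q`. -/
theorem ae_tendsto_band_average_mul {W : Submodule ℂ (Ω → ℂ)} (hW : IsWickSpace P W)
    {U V : Ω → ℝ → ℂ} (hUW : ∀ w, (fun s => U s w) ∈ W) (hVW : ∀ w, (fun s => V s w) ∈ W)
    (hUW' : ∀ w, (fun s => conj (U s w)) ∈ W) (hVW' : ∀ w, (fun s => conj (V s w)) ∈ W)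
    (hUc : ∀ s, Continuous (U s)) (hVc : ∀ s, Continuous (V s)) {a : ℝ → ℝ} (ham : Measurable a)
    (hac : ContinuousOn a (Set.Ici 1)) (ha0 : ∀ w, 1 ≤ w → 0 ≤ a w) {p q : ℝ → ℝ}
    (hp : ∀ w, 1 ≤ w → 0 ≤ p w) (hq : ∀ w, 1 ≤ w → 0 ≤ q w) {C K : ℝ} (hC : 0 ≤ C)
    (hapq : ∀ w, 1 ≤ w → a w * (p w * q w) ≤ K) {L : ℂ}
    (hUU : ∀ w w', 1 ≤ w → 1 ≤ w' →
      ‖∫ s, U s w * conj (U s w') ∂P‖ ≤ C * (p w * p w' * (1 + ‖w - w'‖)⁻¹))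
    (hVV : ∀ w w', 1 ≤ w → 1 ≤ w' →
      ‖∫ s, V s w * conj (V s w') ∂P‖ ≤ C * (q w * q w' * (1 + ‖w - w'‖)⁻¹))
    (hUV : ∀ w w', 1 ≤ w → 1 ≤ w' →
      ‖∫ s, U s w * conj (V s w') ∂P‖ ≤ C * (p w * q w' * (1 + ‖w - w'‖)⁻¹))
    (hM : ∀ w, 1 ≤ w → ‖∫ s, U s w * V s w ∂P‖ ≤ C * (p w * q w))
    (hlim : Tendsto (fun w => (a w : ℂ) * ∫ s, U s w * V s w ∂P) atTop (𝓝 L)) :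
    ∀ᵐ s ∂P, Tendsto (fun Q : ℝ => ((1 / Q : ℝ) : ℂ) *
      ∫ w in Q..(2 * Q), (a w : ℂ) * (U s w * V s w)) atTop (𝓝 L) := by
  have hK : 0 ≤ K := (mul_nonneg (ha0 1 le_rfl) (mul_nonneg (hp 1 le_rfl) (hq 1 le_rfl))).trans
    (hapq 1 le_rfl)
  have hmeas : ∀ {Z : Ω → ℝ → ℂ}, (∀ w, (fun s => Z s w) ∈ W) → (∀ s, Continuous (Z s)) →
      AEStronglyMeasurable (Function.uncurry Z) (P.prod volume) := fun hZ hZc =>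
    aestronglyMeasurable_uncurry_of_continuous
      (fun w => (hW.memLp _ (hZ w) 2 (by simp)).1.aemeasurable) hZc
  have hmean : ∀ w, ∫ s, (a w : ℂ) * (U s w * V s w) ∂P = (a w : ℂ) * ∫ s, U s w * V s w ∂P :=
    fun w => integral_const_mul _ _
  -- Two Wick pairings, each with two moment constants `C` and a bound `K` for the weighted sizes at
  -- `w` and at `w'`.
  refine ae_tendsto_band_average (X := fun s w => (a w : ℂ) * (U s w * V s w)) (C := 2 * C ^ 2 * K ^ 2)
    (B := C * K) ?_ (fun s => ?_) (fun w _ => ?_) (fun w hw => ?_) (fun w w' hw hw' => ?_) ?_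
  · have h1 : AEStronglyMeasurable (fun r : Ω × ℝ => ((a r.2 : ℝ) : ℂ)) (P.prod volume) :=
      (Complex.measurable_ofReal.comp (ham.comp measurable_snd)).aestronglyMeasurable
    exact h1.mul ((hmeas hUW hUc).mul (hmeas hVW hVc))
  · exact (Complex.continuous_ofReal.comp_continuousOn hac).mul
      ((hUc s).mul (hVc s)).continuousOn
  · exact (hW.memLp_mul (hUW w) (hVW w) 2 (by simp)).const_mul _
  · rw [hmean, norm_mul, Complex.norm_real, Real.norm_of_nonneg (ha0 w hw)]
    calc a w * ‖∫ s, U s w * V s w ∂P‖ ≤ a w * (C * (p w * q w)) :=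
          mul_le_mul_of_nonneg_left (hM w hw) (ha0 w hw)
      _ = C * (a w * (p w * q w)) := by ring
      _ ≤ C * K := mul_le_mul_of_nonneg_left (hapq w hw) hC
  · simp only [hmean]
    set M := ∫ s, U s w * V s w ∂P with hMw
    set M' := ∫ s, U s w' * V s w' ∂P with hMw'
    have hconjM' : ∫ s, conj (U s w') * conj (V s w') ∂P = conj M' := by
      rw [hMw', ← integral_conj]
      simp only [map_mul]
    have hswap : ∫ s, V s w * conj (U s w') ∂P = conj (∫ s, U s w' * conj (V s w) ∂P) := by
      rw [← integral_conj]
      congr 1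
      funext s
      simp [mul_comm]
    have hwick := hW.integral_mul₄ (hUW w) (hVW w) (hUW' w') (hVW' w')
    rw [hconjM', hswap] at hwick
    have hcov : ∫ s, ((a w : ℂ) * (U s w * V s w) - a w * M) *
          conj ((a w' : ℂ) * (U s w' * V s w') - a w' * M') ∂P =
        (a w : ℂ) * a w' * ((∫ s, U s w * conj (U s w') ∂P) * (∫ s, V s w * conj (V s w') ∂P) +
          (∫ s, U s w * conj (V s w') ∂P) * conj (∫ s, U s w' * conj (V s w) ∂P)) := by
      have i4 := hW.integrable_mul₄ (hUW w) (hVW w) (hUW' w') (hVW' w')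
      have i2 := hW.integrable_mul (hUW w) (hVW w)
      have i2' := hW.integrable_mul (hUW' w') (hVW' w')
      have hexp : ∀ s, ((a w : ℂ) * (U s w * V s w) - a w * M) *
          conj ((a w' : ℂ) * (U s w' * V s w') - a w' * M') =
          (a w : ℂ) * a w' * (U s w * V s w * (conj (U s w') * conj (V s w')) -
            conj M' * (U s w * V s w) - M * (conj (U s w') * conj (V s w')) + M * conj M') := by
        intro s
        simp only [map_sub, map_mul, Complex.conj_ofReal]
        ring
      simp only [hexp]
      rw [integral_const_mul, integral_add (by fun_prop) (by fun_prop),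
        integral_sub (by fun_prop) (by fun_prop), integral_sub (by fun_prop) (by fun_prop),
        integral_const_mul, integral_const_mul, hwick, hconjM', ← hMw]
      simp only [integral_const, probReal_univ, one_smul]
      ring
    rw [hcov, norm_mul, norm_mul, Complex.norm_real, Complex.norm_real,
      Real.norm_of_nonneg (ha0 w hw), Real.norm_of_nonneg (ha0 w' hw')]
    have hD : 0 < (1 + ‖w - w'‖)⁻¹ := by positivity
    have hp1 := hp w hw
    have hp2 := hp w' hw'
    have hq1 := hq w hw
    have hq2 := hq w' hw'
    have hin : ‖(∫ s, U s w * conj (U s w') ∂P) * (∫ s, V s w * conj (V s w') ∂P) +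
          (∫ s, U s w * conj (V s w') ∂P) * conj (∫ s, U s w' * conj (V s w) ∂P)‖ ≤
        2 * C ^ 2 * ((p w * q w) * (p w' * q w')) * ((1 + ‖w - w'‖)⁻¹) ^ 2 := by
      have h3 := hUV w' w hw' hw
      rw [norm_sub_rev w' w] at h3
      refine (norm_add_le _ _).trans ?_
      rw [norm_mul, norm_mul, RCLike.norm_conj]
      calc _ ≤ (C * (p w * p w' * (1 + ‖w - w'‖)⁻¹)) * (C * (q w * q w' * (1 + ‖w - w'‖)⁻¹)) +
            (C * (p w * q w' * (1 + ‖w - w'‖)⁻¹)) * (C * (p w' * q w * (1 + ‖w - w'‖)⁻¹)) :=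
            add_le_add
              (mul_le_mul (hUU w w' hw hw') (hVV w w' hw hw') (norm_nonneg _) (by positivity))
              (mul_le_mul (hUV w w' hw hw') h3 (norm_nonneg _) (by positivity))
        _ = _ := by ring
    have hpow : (1 + ‖w - w'‖) ^ (-2 : ℝ) = ((1 + ‖w - w'‖)⁻¹) ^ 2 := by
      rw [Real.rpow_neg (by positivity), inv_pow]
      norm_cast
    have haa := mul_nonneg (ha0 w hw) (ha0 w' hw')
    rw [hpow]
    calc _ ≤ a w * a w' *
          (2 * C ^ 2 * ((p w * q w) * (p w' * q w')) * ((1 + ‖w - w'‖)⁻¹) ^ 2) :=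
          mul_le_mul_of_nonneg_left hin haa
      _ = 2 * C ^ 2 * ((a w * (p w * q w)) * (a w' * (p w' * q w'))) *
          ((1 + ‖w - w'‖)⁻¹) ^ 2 := by ring
      _ ≤ 2 * C ^ 2 * (K * K) * ((1 + ‖w - w'‖)⁻¹) ^ 2 := by
          refine mul_le_mul_of_nonneg_right (mul_le_mul_of_nonneg_left ?_ (by positivity))
            (by positivity)
          exact mul_le_mul (hapq w hw) (hapq w' hw')
            (mul_nonneg (ha0 w' hw') (mul_nonneg hp2 hq2)) hK
      _ = _ := by ring
  · simpa only [hmean] using hlim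

end Products

/-! ### Second moments of the source transform -/

/-- The component `j` of the Fourier transform of the cut-off random source at `ζ`. -/
noncomputable def sourceMode {d : ℕ} {Ω : Type*} (χ : Test d) (f : Ω → Fin d → Distr d) (j : Fin d) (ζ : Space d)
    (s : Ω) : ℂ := sourceFourier χ (f s) ζ j

theorem continuous_sourceMode {d : ℕ} {Ω : Type*} (χ : Test d) (f : Ω → Fin d → Distr d) (j : Fin d) (s : Ω) :
    Continuous fun ζ => sourceMode χ f j ζ s :=
  (f s j).continuous.comp (continuous_planeWave χ)

section Moments

variable {d : ℕ} {Ω : Type*} [MeasurableSpace Ω] {P : Measure Ω} {m : ℝ} {D : Set (Space d)}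
  {f : Ω → Fin d → Distr d} {Ac Ar : Space d → Matrix (Fin d) (Fin d) ℂ}

theorem IsCutoff.eq_one {χ : Test d} (hχ : IsCutoff D χ) : ∀ x ∈ D, χ x = 1 := fun x hx =>
  Filter.Eventually.self_of_nhdsSet hχ x (subset_closure hx)

theorem conjTest_apply (φ : Test d) (x : Space d) : conjTest φ x = conj (φ x) := rfl

theorem conjTest_conjTest (φ : Test d) : conjTest (conjTest φ) = φ := by
  ext x
  simp [conjTest_apply]

theorem planeWave_apply (χ : Test d) (ζ y : Space d) :
    planeWave χ ζ y = χ y * Complex.exp (-(Complex.I * (inner ℝ ζ y : ℝ))) := rfl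

theorem conj_planeWave_eq (χ : Test d) (ζ : Space d) :
    (conjTest (planeWave χ ζ) : Space d → ℂ) =
      fun y => conjTest χ y * Complex.exp (Complex.I * (inner ℝ ζ y : ℝ)) := by
  funext y
  rw [conjTest_apply, planeWave_apply, map_mul, ← Complex.exp_conj, conjTest_apply]
  simp

theorem integral_sourceMode_mul_conj {S : Space d → Space d → ℂ} {j l : Fin d}
    (h : ∀ φ ψ : Test d, ∫ s, conjPair (f s l) φ * f s j ψ ∂P = ∫ x, pseudoDiff S φ x * ψ x)
    (χ : Test d) (ζ₁ ζ₂ : Space d) :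
    ∫ s, sourceMode χ f j ζ₁ s * conj (sourceMode χ f l ζ₂ s) ∂P
      = covKernel S (conjTest χ) χ ζ₁ ζ₂ := by
  have h1 := h (conjTest (planeWave χ ζ₂)) (planeWave χ ζ₁)
  simp only [conjPair, conjTest_conjTest, conj_planeWave_eq, planeWave_apply] at h1
  rw [covKernel, ← h1]
  congr 1
  funext s
  rw [mul_comm]
  rfl

/-- Without a conjugation the second plane wave must itself be `e^{iζ₂·y}`, hence the mode at `-ζ₂`:
this is why the relation is seen by correlating opposite directions. -/
theorem integral_sourceMode_mul {S : Space d → Space d → ℂ} {j l : Fin d}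
    (h : ∀ φ ψ : Test d, ∫ s, f s l φ * f s j ψ ∂P = ∫ x, pseudoDiff S φ x * ψ x)
    (χ : Test d) (ζ₁ ζ₂ : Space d) :
    ∫ s, sourceMode χ f j ζ₁ s * sourceMode χ f l (-ζ₂) s ∂P = covKernel S χ χ ζ₁ ζ₂ := by
  have h1 := h (planeWave χ (-ζ₂)) (planeWave χ ζ₁)
  have h2 : (planeWave χ (-ζ₂) : Space d → ℂ) =
      fun y => χ y * Complex.exp (Complex.I * (inner ℝ ζ₂ y : ℝ)) := by
    funext y
    rw [planeWave_apply, inner_neg_left]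
    simp
  rw [h2] at h1
  simp only [planeWave_apply] at h1
  rw [covKernel, ← h1]
  congr 1
  funext s
  rw [mul_comm]
  rfl

theorem conjTest_eq_one {χ : Test d} (hχ : IsCutoff D χ) : ∀ x ∈ D, conjTest χ x = 1 := by
  intro x hx
  rw [conjTest_apply, hχ.eq_one x hx, map_one]

theorem exists_covariance_bound (hf : IsGMIG P m D f Ac Ar) {χ : Test d} (hχ : IsCutoff D χ)
    (j l : Fin d) : ∃ C : ℝ, 0 ≤ C ∧ ∀ ζ₁ ζ₂,
      ‖∫ s, sourceMode χ f j ζ₁ s * conj (sourceMode χ f l ζ₂ s) ∂P‖ ≤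
        C * ((1 + ‖ζ₁‖) ^ (-m / 2) * (1 + ‖ζ₂‖) ^ (-m / 2) / (1 + ‖ζ₁ - ζ₂‖)) := by
  obtain ⟨S, hS⟩ := hf.covariance
  obtain ⟨hsym, hmom⟩ := hS j l
  obtain ⟨C, hC, h⟩ := norm_covKernel_le hf.isBounded_domain hsym.1 hsym.2.1
    (conjTest χ).contDiff (conjTest χ).hasCompactSupport hχ.eq_one
  refine ⟨C, hC, fun ζ₁ ζ₂ => ?_⟩
  rw [integral_sourceMode_mul_conj hmom]
  exact h ζ₁ ζ₂

theorem exists_relation_bound (hf : IsGMIG P m D f Ac Ar) {χ : Test d} (hχ : IsCutoff D χ)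
    (j l : Fin d) : ∃ C : ℝ, 0 ≤ C ∧ ∀ ζ₁ ζ₂,
      ‖∫ s, sourceMode χ f j ζ₁ s * sourceMode χ f l (-ζ₂) s ∂P‖ ≤
        C * ((1 + ‖ζ₁‖) ^ (-m / 2) * (1 + ‖ζ₂‖) ^ (-m / 2) / (1 + ‖ζ₁ - ζ₂‖)) := by
  obtain ⟨S, hS⟩ := hf.relation
  obtain ⟨hsym, hmom⟩ := hS j l
  obtain ⟨C, hC, h⟩ := norm_covKernel_le hf.isBounded_domain hsym.1 hsym.2.1
    χ.contDiff χ.hasCompactSupport hχ.eq_one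
  refine ⟨C, hC, fun ζ₁ ζ₂ => ?_⟩
  rw [integral_sourceMode_mul hmom]
  exact h ζ₁ ζ₂

theorem tendsto_covariance (hf : IsGMIG P m D f Ac Ar) {χ : Test d} (hχ : IsCutoff D χ)
    (j l : Fin d) (k : Space d) :
    Tendsto (fun ζ : Space d => ((‖ζ‖ ^ m : ℝ) : ℂ) *
      ∫ s, sourceMode χ f j (ζ + k) s * conj (sourceMode χ f l ζ s) ∂P)
      (comap norm atTop) (𝓝 (fourierMat Ac k j l)) := by
  obtain ⟨S, hS⟩ := hf.covariance
  obtain ⟨hsym, hmom⟩ := hS j l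
  simp only [integral_sourceMode_mul_conj hmom]
  exact tendsto_covKernel hf.isBounded_domain hsym (conjTest χ).contDiff
    (conjTest χ).hasCompactSupport (conjTest_eq_one hχ) hχ.eq_one k

theorem tendsto_relation (hf : IsGMIG P m D f Ac Ar) {χ : Test d} (hχ : IsCutoff D χ)
    (j l : Fin d) (k : Space d) :
    Tendsto (fun ζ : Space d => ((‖ζ‖ ^ m : ℝ) : ℂ) *
      ∫ s, sourceMode χ f j (ζ + k) s * sourceMode χ f l (-ζ) s ∂P)
      (comap norm atTop) (𝓝 (fourierMat Ar k j l)) := by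
  obtain ⟨S, hS⟩ := hf.relation
  obtain ⟨hsym, hmom⟩ := hS j l
  simp only [integral_sourceMode_mul hmom]
  exact tendsto_covKernel hf.isBounded_domain hsym χ.contDiff
    χ.hasCompactSupport hχ.eq_one hχ.eq_one k

theorem IsGMIG.smooth_covariance (hf : IsGMIG P m D f Ac Ar) (j l : Fin d) :
    ContDiff ℝ ∞ (fun x => Ac x j l) ∧ HasCompactSupport (fun x => Ac x j l) := by
  obtain ⟨S, hS⟩ := hf.covariance
  exact ⟨(hS j l).1.2.2.1.1, (hS j l).1.2.2.1.2.1⟩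

theorem IsGMIG.smooth_relation (hf : IsGMIG P m D f Ac Ar) (j l : Fin d) :
    ContDiff ℝ ∞ (fun x => Ar x j l) ∧ HasCompactSupport (fun x => Ar x j l) := by
  obtain ⟨S, hS⟩ := hf.relation
  exact ⟨(hS j l).1.2.2.1.1, (hS j l).1.2.2.1.2.1⟩

end Moments

/-! ### Algebra of the far-field correlations -/

section FarField

variable {d : ℕ}

theorem cS_pos {mu : ℝ} (hmu : 0 < mu) : 0 < cS mu := Real.rpow_pos_of_pos hmu _

theorem cP_pos {lam mu : ℝ} (h : 0 < lam + 2 * mu) : 0 < cP lam mu := Real.rpow_pos_of_pos h _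

theorem farFieldConst_ne_zero (d : ℕ) : farFieldConst d ≠ 0 := by
  have hpi := Real.pi_pos
  unfold farFieldConst
  split_ifs
  · refine div_ne_zero (Complex.exp_ne_zero _) ?_
    exact_mod_cast (Real.sqrt_pos.2 (by positivity)).ne'
  · refine div_ne_zero one_ne_zero ?_
    exact_mod_cast (by positivity : 4 * Real.pi ≠ 0)

/-- The four coefficients are the products of `c_p^{-2}` and `c_s^{-2}`, so the bracket is a single
outer product. -/
theorem combine_apply (lam mu : ℝ) (p r q t : Fin d → ℂ) (j l : Fin d) :
    combine lam mu p r q t j l =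
      (((cP lam mu ^ (-2 : ℤ) : ℝ) : ℂ) * p j + ((cS mu ^ (-2 : ℤ) : ℝ) : ℂ) * r j) *
      (((cP lam mu ^ (-2 : ℤ) : ℝ) : ℂ) * q l + ((cS mu ^ (-2 : ℤ) : ℝ) : ℂ) * t l) := by
  have h4 : ∀ c : ℝ, c ^ (-4 : ℤ) = c ^ (-2 : ℤ) * c ^ (-2 : ℤ) := fun c => by
    rw [← sq, ← zpow_natCast, ← zpow_mul]
    norm_num
  simp only [combine, Matrix.add_apply, Matrix.smul_apply, Matrix.vecMulVec_apply, smul_eq_mul,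
    h4, Complex.ofReal_mul]
  ring

theorem rpow_slowness {c w e : ℝ} (hc : 0 < c) (hw : 0 < w) :
    c ^ (-2 : ℤ) * (c ^ (e + 2) * (c⁻¹ * w) ^ e) = w ^ e := by
  have h2 : c ^ (-2 : ℤ) = c ^ (-2 : ℝ) := by
    rw [← Real.rpow_intCast]
    norm_num
  rw [Real.mul_rpow (by positivity) hw.le, Real.inv_rpow hc.le, ← Real.rpow_neg hc.le, h2,
    ← mul_assoc, ← mul_assoc, ← Real.rpow_add hc, ← Real.rpow_add hc]
  ring_nf
  simp

/-- Both patterns evaluate the source transform at `c_s w x`. With `e = (d-3)/2` one has `(d+1)/2 =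
e + 2`, so the factors `c^{-2}` reduce both prefactors to `(c_s w)^e`, and the projections add to
the identity. -/
theorem farField_add {lam mu : ℝ} (hmu : 0 < mu) (hlam : 0 < lam + 2 * mu) (χ : Test d)
    (T : Fin d → Distr d) (x : Space d) {w : ℝ} (hw : 0 < w) (j : Fin d) :
    ((cP lam mu ^ (-2 : ℤ) : ℝ) : ℂ) *
        farFieldP lam mu χ T x (cS mu * (cP lam mu)⁻¹ * w) j +
      ((cS mu ^ (-2 : ℤ) : ℝ) : ℂ) * farFieldS mu χ T x w j =
    -(farFieldConst d * (((cS mu * w) ^ (((d : ℝ) - 3) / 2) : ℝ) : ℂ)) *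
      sourceFourier χ T ((cS mu * w) • x) j := by
  have hs := cS_pos hmu
  have hp := cP_pos hlam
  set e : ℝ := ((d : ℝ) - 3) / 2 with he
  have he2 : ((d : ℝ) + 1) / 2 = e + 2 := by rw [he]; ring
  have hfreq : cP lam mu * (cS mu * (cP lam mu)⁻¹ * w) = cS mu * w := by field_simp
  have h1 : cP lam mu ^ (-2 : ℤ) * (cP lam mu ^ (e + 2) * (cS mu * (cP lam mu)⁻¹ * w) ^ e)
      = (cS mu * w) ^ e := by
    rw [show cS mu * (cP lam mu)⁻¹ * w = (cP lam mu)⁻¹ * (cS mu * w) by ring]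
    exact rpow_slowness hp (by positivity)
  have h2 : cS mu ^ (-2 : ℤ) * (cS mu ^ (e + 2) * w ^ e) = (cS mu * w) ^ e := by
    have := rpow_slowness (e := e) hs (by positivity : 0 < cS mu * w)
    rwa [inv_mul_cancel_left₀ hs.ne'] at this
  have h1' : ((cP lam mu ^ (-2 : ℤ) : ℝ) : ℂ) *
      ((cP lam mu ^ (e + 2) * (cS mu * (cP lam mu)⁻¹ * w) ^ e : ℝ) : ℂ)
      = (((cS mu * w) ^ e : ℝ) : ℂ) := by rw [← Complex.ofReal_mul, h1]
  have h2' : ((cS mu ^ (-2 : ℤ) : ℝ) : ℂ) * ((cS mu ^ (e + 2) * w ^ e : ℝ) : ℂ)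
      = (((cS mu * w) ^ e : ℝ) : ℂ) := by rw [← Complex.ofReal_mul, h2]
  simp only [farFieldP, farFieldS, Pi.smul_apply, smul_eq_mul, hfreq, he2, ← he]
  rw [Matrix.sub_mulVec, Matrix.one_mulVec, Pi.sub_apply]
  generalize (projP x *ᵥ sourceFourier χ T ((cS mu * w) • x)) j = G
  generalize sourceFourier χ T ((cS mu * w) • x) j = F
  linear_combination (-farFieldConst d * G) * h1' - (farFieldConst d * (F - G)) * h2'

/-- The deterministic weight of the frequency average after normalization of the modes. -/
noncomputable def bandWeight (c m e τ w : ℝ) : ℝ := (c * w) ^ m * ((w + τ) / w) ^ e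

theorem bandWeight_eq {c m τ w : ℝ} (hc : 0 < c) (hw : 0 < w) (hτ : 0 ≤ τ) (d : ℕ) :
    c ^ (m + 3 - d) * w ^ (m + 3 - d) *
      ((c * (w + τ)) ^ (((d : ℝ) - 3) / 2) * (c * w) ^ (((d : ℝ) - 3) / 2))
      = bandWeight c m (((d : ℝ) - 3) / 2) τ w := by
  have hwτ : 0 < w + τ := by linarith
  have hcw : 0 < c * w := by positivity
  set e : ℝ := ((d : ℝ) - 3) / 2 with he
  have hexp : m + 3 - d = m - e - e := by rw [he]; ring
  rw [bandWeight, ← Real.mul_rpow hc.le hw.le, hexp, Real.rpow_sub hcw, Real.rpow_sub hcw,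
    Real.div_rpow hwτ.le hw.le, Real.mul_rpow hc.le hwτ.le, Real.mul_rpow hc.le hw.le]
  have := Real.rpow_pos_of_pos hc e
  have := Real.rpow_pos_of_pos hw e
  field_simp
  exact (Real.mul_rpow hc.le hw.le).symm

theorem weight_mul_corrC {lam mu m : ℝ} (hmu : 0 < mu) (hlam : 0 < lam + 2 * mu) (χ : Test d)
    (T : Fin d → Distr d) (x : Space d) {τ w : ℝ} (hτ : 0 ≤ τ) (hw : 0 < w) (j l : Fin d) :
    ((cS mu ^ (m + 3 - d) * w ^ (m + 3 - d) : ℝ) : ℂ) * corrC lam mu χ T x τ w j l =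
      ((‖farFieldConst d‖ ^ 2 : ℝ) : ℂ) *
        ((bandWeight (cS mu) m (((d : ℝ) - 3) / 2) τ w : ℂ) *
          (sourceFourier χ T ((cS mu * (w + τ)) • x) j *
            conj (sourceFourier χ T ((cS mu * w) • x) l))) := by
  have h2 := congrArg conj (farField_add hmu hlam χ T x hw l)
  simp only [map_add, map_mul, map_neg, Complex.conj_ofReal] at h2
  rw [corrC, combine_apply, farField_add hmu hlam χ T x (by linarith : 0 < w + τ) j, h2,
    ← bandWeight_eq (cS_pos hmu) hw hτ d, ← Complex.normSq_eq_norm_sq, Complex.normSq_eq_conj_mul_self]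
  push_cast
  ring

theorem weight_mul_corrR {lam mu m : ℝ} (hmu : 0 < mu) (hlam : 0 < lam + 2 * mu) (χ : Test d)
    (T : Fin d → Distr d) (x : Space d) {τ w : ℝ} (hτ : 0 ≤ τ) (hw : 0 < w) (j l : Fin d) :
    ((cS mu ^ (m + 3 - d) * w ^ (m + 3 - d) : ℝ) : ℂ) * corrR lam mu χ T x τ w j l =
      farFieldConst d ^ 2 *
        ((bandWeight (cS mu) m (((d : ℝ) - 3) / 2) τ w : ℂ) *
          (sourceFourier χ T ((cS mu * (w + τ)) • x) j *
            sourceFourier χ T (-((cS mu * w) • x)) l)) := by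
  rw [corrR, combine_apply, farField_add hmu hlam χ T x (by linarith : 0 < w + τ) j,
    farField_add hmu hlam χ T (-x) hw l, ← bandWeight_eq (cS_pos hmu) hw hτ d, smul_neg]
  push_cast
  ring

end FarField

/-! ### Estimates for the weights -/

section Weights

theorem rpow_le_of_mem_Icc {lo hi x : ℝ} (hlo : 0 < lo) (h1 : lo ≤ x) (h2 : x ≤ hi) (s : ℝ) :
    x ^ s ≤ lo ^ s + hi ^ s := by
  have hx : 0 < x := hlo.trans_le h1
  rcases le_total 0 s with hs | hs
  · have := Real.rpow_le_rpow hx.le h2 hs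
    have := Real.rpow_nonneg hlo.le s
    linarith
  · have := Real.rpow_le_rpow_of_nonpos hlo h1 hs
    have := Real.rpow_nonneg (hx.le.trans h2) s
    linarith

theorem bandWeight_nonneg {c m e τ w : ℝ} (hc : 0 < c) (hτ : 0 ≤ τ) (hw : 1 ≤ w) :
    0 ≤ bandWeight c m e τ w := by
  unfold bandWeight
  positivity

theorem measurable_bandWeight (c m e τ : ℝ) : Measurable (bandWeight c m e τ) := by
  unfold bandWeight
  fun_prop

theorem continuousOn_bandWeight {c m e τ : ℝ} (hc : 0 < c) (hτ : 0 ≤ τ) :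
    ContinuousOn (bandWeight c m e τ) (Set.Ici 1) := by
  have hpos : ∀ w ∈ Set.Ici (1 : ℝ), 0 < w := fun w hw => one_pos.trans_le hw
  refine ContinuousOn.mul ?_ ?_
  · refine ContinuousOn.rpow_const (by fun_prop) fun w hw => Or.inl ?_
    exact (mul_pos hc (hpos w hw)).ne'
  · refine ContinuousOn.rpow_const (ContinuousOn.div (by fun_prop) (by fun_prop)
      fun w hw => (hpos w hw).ne') fun w hw => Or.inl ?_
    have := hpos w hw
    positivity

theorem tendsto_ratio_rpow (τ e : ℝ) :
    Tendsto (fun w : ℝ => ((w + τ) / w) ^ e) atTop (𝓝 1) := by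
  have h0 : Tendsto (fun w : ℝ => 1 + τ / w) atTop (𝓝 (1 + 0)) :=
    (tendsto_id.const_div_atTop τ).const_add 1
  rw [add_zero] at h0
  have h1 : Tendsto (fun w : ℝ => (w + τ) / w) atTop (𝓝 1) := by
    refine h0.congr' ?_
    filter_upwards [eventually_gt_atTop 0] with w hw
    field_simp
  simpa using h1.rpow_const (p := e) (Or.inl one_ne_zero)

/-- The power `(cw)^m` cancels the two factors of order `-m/2`. What remains are powers of ratios
confined to `[c/(1+c), 1]` and `[1, 1+τ]`; summing the powers of both endpoints covers either sign
of the exponent. -/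
theorem exists_bandWeight_bound {c : ℝ} (hc : 0 < c) (m e : ℝ) {τ : ℝ} (hτ : 0 ≤ τ) :
    ∃ K : ℝ, ∀ w, 1 ≤ w → bandWeight c m e τ w *
      ((1 + c * (w + τ)) ^ (-m / 2) * (1 + c * w) ^ (-m / 2)) ≤ K := by
  refine ⟨((c / (1 + c)) ^ m + 1 ^ m) * (1 ^ e + (1 + τ) ^ e) * (1 + c * τ) ^ |-m / 2|,
    fun w hw => ?_⟩
  have hw0 : 0 < w := by linarith
  have hcw : 0 < c * w := by positivity
  have h1 : (1 + c * (w + τ)) ^ (-m / 2) ≤ (1 + c * w) ^ (-m / 2) * (1 + c * τ) ^ |-m / 2| := by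
    have h := peetre_rpow (c * w) (c * τ) (-m / 2)
    rwa [Real.norm_of_nonneg (by positivity), Real.norm_of_nonneg (by positivity),
      Real.norm_of_nonneg (by positivity), ← mul_add] at h
  have h2 : (c * w) ^ m * ((1 + c * w) ^ (-m / 2) * (1 + c * w) ^ (-m / 2))
      = (c * w / (1 + c * w)) ^ m := by
    rw [← Real.rpow_add (by positivity), show -m / 2 + -m / 2 = -m by ring,
      Real.rpow_neg (by positivity), Real.div_rpow hcw.le (by positivity), div_eq_mul_inv]
  have h3 : (c * w / (1 + c * w)) ^ m ≤ (c / (1 + c)) ^ m + 1 ^ m := by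
    refine rpow_le_of_mem_Icc (by positivity) ?_ ?_ m
    · rw [div_le_div_iff₀ (by positivity) (by positivity)]
      nlinarith
    · rw [div_le_one (by positivity)]
      linarith
  have h4 : ((w + τ) / w) ^ e ≤ 1 ^ e + (1 + τ) ^ e := by
    refine rpow_le_of_mem_Icc one_pos ?_ ?_ e
    · rw [le_div_iff₀ hw0]
      linarith
    · rw [div_le_iff₀ hw0]
      nlinarith
  calc bandWeight c m e τ w * ((1 + c * (w + τ)) ^ (-m / 2) * (1 + c * w) ^ (-m / 2))
      ≤ bandWeight c m e τ w * (((1 + c * w) ^ (-m / 2) * (1 + c * τ) ^ |-m / 2|) *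
        (1 + c * w) ^ (-m / 2)) := by
        have := bandWeight_nonneg (m := m) (e := e) hc hτ hw
        gcongr
    _ = (c * w / (1 + c * w)) ^ m * ((w + τ) / w) ^ e * (1 + c * τ) ^ |-m / 2| := by
        rw [← h2, bandWeight]
        ring
    _ ≤ _ := by gcongr

/-- Converts decay in the distance `X` of two wave vectors into decay in the frequency difference
`δ`, since `1 + δ ≤ (1 + c⁻¹)(1 + X)`. -/
theorem div_one_add_le {c C C' ρ δ X : ℝ} (hc : 0 < c) (hC : 0 ≤ C) (hρ : 0 ≤ ρ) (hδ : 0 ≤ δ)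
    (hX : c * δ ≤ X) (hCC : (1 + c⁻¹) * C ≤ C') : C * (ρ / (1 + X)) ≤ C' * (ρ * (1 + δ)⁻¹) := by
  have hX0 : 0 ≤ X := (by positivity : 0 ≤ c * δ).trans hX
  have h1 : 1 + δ ≤ (1 + c⁻¹) * (1 + X) := by
    have h2 : δ ≤ c⁻¹ * X := by
      rw [← div_eq_inv_mul, le_div_iff₀ hc]
      linarith
    have h3 : 0 < c⁻¹ := by positivity
    nlinarith
  have h2 : (1 + X)⁻¹ ≤ (1 + c⁻¹) * (1 + δ)⁻¹ := by
    rw [← div_eq_mul_inv, le_div_iff₀ (by positivity), inv_mul_le_iff₀ (by positivity), mul_comm]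
    exact h1
  calc C * (ρ / (1 + X)) = C * ρ * (1 + X)⁻¹ := by rw [div_eq_mul_inv]; ring
    _ ≤ C * ρ * ((1 + c⁻¹) * (1 + δ)⁻¹) := by gcongr
    _ = ((1 + c⁻¹) * C) * (ρ * (1 + δ)⁻¹) := by ring
    _ ≤ C' * (ρ * (1 + δ)⁻¹) := by gcongr

end Weights

/-! ### The recovery formulas -/

section Formulas

variable {d : ℕ} {Ω : Type*} [MeasurableSpace Ω] {P : Measure Ω} [IsProbabilityMeasure P] {m : ℝ}
  {D : Set (Space d)} {f : Ω → Fin d → Distr d} {Ac Ar : Space d → Matrix (Fin d) (Fin d) ℂ}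

theorem tendsto_smul_comap_norm {c : ℝ} (hc : 0 < c) {x : Space d} (hx : ‖x‖ = 1) :
    Tendsto (fun w : ℝ => (c * w) • x) atTop (comap norm atTop) := by
  rw [tendsto_comap_iff]
  refine (tendsto_id.const_mul_atTop hc).congr' ?_
  filter_upwards [eventually_ge_atTop 0] with w hw
  rw [Function.comp_apply, norm_smul, hx, mul_one, Real.norm_of_nonneg (mul_nonneg hc.le hw), id]

theorem tendsto_bandWeight_mul {c : ℝ} (hc : 0 < c) {x : Space d} (hx : ‖x‖ = 1) (e τ : ℝ)
    {E : Space d → ℂ} {L : ℂ}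
    (hE : Tendsto (fun ζ : Space d => ((‖ζ‖ ^ m : ℝ) : ℂ) * E ζ) (comap norm atTop) (𝓝 L)) :
    Tendsto (fun w : ℝ => (bandWeight c m e τ w : ℂ) * E ((c * w) • x)) atTop (𝓝 L) := by
  have h1 := (hE.comp (tendsto_smul_comap_norm hc hx)).mul
    ((Complex.continuous_ofReal.tendsto 1).comp (tendsto_ratio_rpow τ e))
  rw [Complex.ofReal_one, mul_one] at h1
  refine h1.congr' ?_
  filter_upwards [eventually_ge_atTop 0] with w hw
  simp only [Function.comp_apply, bandWeight]
  rw [norm_smul, hx, mul_one, Real.norm_of_nonneg (mul_nonneg hc.le hw)]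
  push_cast
  ring

/-- Each formula needs both operators: for (1) the mean is a covariance and the cross pairing
`E[UV̄']` a relation moment, and for (2) the roles are exchanged. -/
theorem ae_tendsto_modes (hf : IsGMIG P m D f Ac Ar) {χ : Test d} (hχ : IsCutoff D χ) {c : ℝ}
    (hc : 0 < c) {x : Space d} (hx : ‖x‖ = 1) (e : ℝ) {τ : ℝ} (hτ : 0 ≤ τ) (j l : Fin d) :
    ∀ᵐ s ∂P,
      Tendsto (fun Q : ℝ => ((1 / Q : ℝ) : ℂ) * ∫ w in Q..(2 * Q), (bandWeight c m e τ w : ℂ) *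
        (sourceMode χ f j ((c * (w + τ)) • x) s * conj (sourceMode χ f l ((c * w) • x) s)))
        atTop (𝓝 (fourierMat Ac ((c * τ) • x) j l)) ∧
      Tendsto (fun Q : ℝ => ((1 / Q : ℝ) : ℂ) * ∫ w in Q..(2 * Q), (bandWeight c m e τ w : ℂ) *
        (sourceMode χ f j ((c * (w + τ)) • x) s * sourceMode χ f l (-((c * w) • x)) s))
        atTop (𝓝 (fourierMat Ar ((c * τ) • x) j l)) := by
  have hW := isWickSpace_fieldSpace hf.gaussian hf.centered
  have hmem : ∀ i ζ, (fun s => sourceMode χ f i ζ s) ∈ fieldSpace f := fun i ζ =>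
    apply_mem_fieldSpace i _
  have hmem' : ∀ i ζ, (fun s => conj (sourceMode χ f i ζ s)) ∈ fieldSpace f := fun i ζ =>
    conj_apply_mem_fieldSpace i _
  have hcont := continuous_sourceMode χ f
  obtain ⟨C₁, hC₁, b₁⟩ := exists_covariance_bound hf hχ j j
  obtain ⟨C₂, hC₂, b₂⟩ := exists_covariance_bound hf hχ l l
  obtain ⟨C₃, hC₃, b₃⟩ := exists_covariance_bound hf hχ j l
  obtain ⟨C₄, hC₄, b₄⟩ := exists_relation_bound hf hχ j l
  obtain ⟨K, hK⟩ := exists_bandWeight_bound hc m e hτ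
  set C := (1 + c⁻¹) * (C₁ + C₂ + C₃ + C₄) with hC
  have hc' : 0 < c⁻¹ := by positivity
  have hC0 : 0 ≤ C := by positivity
  have hle : ∀ {C'}, C' ≤ C₁ + C₂ + C₃ + C₄ → (1 + c⁻¹) * C' ≤ C := fun h =>
    mul_le_mul_of_nonneg_left h (by positivity)
  set p : ℝ → ℝ := fun w => (1 + c * (w + τ)) ^ (-m / 2) with hp
  set q : ℝ → ℝ := fun w => (1 + c * w) ^ (-m / 2) with hq
  have hp0 : ∀ w, 1 ≤ w → 0 ≤ p w := fun w hw => by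
    have : 0 ≤ c * (w + τ) := by positivity
    positivity
  have hq0 : ∀ w, 1 ≤ w → 0 ≤ q w := fun w hw => by positivity
  have hpn : ∀ w, 1 ≤ w → (1 + ‖(c * (w + τ)) • x‖) ^ (-m / 2) = p w := fun w hw => by
    rw [norm_smul, hx, mul_one, Real.norm_of_nonneg (by positivity)]
  have hqn : ∀ w, 1 ≤ w → (1 + ‖(c * w) • x‖) ^ (-m / 2) = q w := fun w hw => by
    rw [norm_smul, hx, mul_one, Real.norm_of_nonneg (by positivity)]
  have hdp : ∀ w w' : ℝ, c * ‖w - w'‖ ≤ ‖(c * (w + τ)) • x - (c * (w' + τ)) • x‖ := by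
    intro w w'
    rw [← sub_smul, norm_smul, hx, mul_one, ← mul_sub, add_sub_add_right_eq_sub, norm_mul,
      Real.norm_of_nonneg hc.le]
  have hdq : ∀ w w' : ℝ, c * ‖w - w'‖ ≤ ‖(c * w) • x - (c * w') • x‖ := by
    intro w w'
    rw [← sub_smul, norm_smul, hx, mul_one, ← mul_sub, norm_mul, Real.norm_of_nonneg hc.le]
  -- In the cross pairings the wave vectors point in opposite directions, so their distance `c(w + τ
  -- + w')` dominates `c|w - w'|`.
  have hsum : ∀ w w' : ℝ, 1 ≤ w → 1 ≤ w' →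
      c * ‖w - w'‖ ≤ ‖(c * (w + τ)) • x - -((c * w') • x)‖ := by
    intro w w' hw hw'
    rw [sub_neg_eq_add, ← add_smul, norm_smul, hx, mul_one, ← mul_add, norm_mul,
      Real.norm_of_nonneg hc.le]
    refine mul_le_mul_of_nonneg_left ?_ hc.le
    rw [Real.norm_eq_abs, Real.norm_of_nonneg (by positivity), abs_le]
    constructor <;> linarith
  have hUU : ∀ w w', 1 ≤ w → 1 ≤ w' →
      ‖∫ s, sourceMode χ f j ((c * (w + τ)) • x) s *
        conj (sourceMode χ f j ((c * (w' + τ)) • x) s) ∂P‖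
        ≤ C * (p w * p w' * (1 + ‖w - w'‖)⁻¹) := by
    intro w w' hw hw'
    refine (b₁ _ _).trans ?_
    rw [hpn w hw, hpn w' hw']
    exact div_one_add_le hc hC₁ (mul_nonneg (hp0 w hw) (hp0 w' hw')) (norm_nonneg _) (hdp w w')
      (hle (by linarith))
  have hdrop : ∀ {C' ρ X : ℝ}, 0 ≤ C' → C' ≤ C₁ + C₂ + C₃ + C₄ → 0 ≤ ρ → 0 ≤ X →
      C' * (ρ / (1 + X)) ≤ C * ρ := by
    intro C' ρ X h1 h2 h3 h4
    have h := div_one_add_le (δ := 0) hc h1 h3 le_rfl (by simpa using h4) (hle h2)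
    simpa using h
  have hshift : ∀ w : ℝ, (c * (w + τ)) • x = (c * w) • x + (c * τ) • x := fun w => by
    rw [mul_add, add_smul]
  have hcp : ∀ s, Continuous fun w : ℝ => sourceMode χ f j ((c * (w + τ)) • x) s := fun s =>
    (hcont j s).comp (by fun_prop)
  have hcov := ae_tendsto_band_average_mul (P := P) hW
    (U := fun s w => sourceMode χ f j ((c * (w + τ)) • x) s)
    (V := fun s w => conj (sourceMode χ f l ((c * w) • x) s))
    (fun w => hmem _ _) (fun w => hmem' _ _) (fun w => hmem' _ _)
    (fun w => by simpa only [Complex.conj_conj] using hmem _ _) hcp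
    (fun s => Complex.continuous_conj.comp ((hcont l s).comp (by fun_prop)))
    (measurable_bandWeight c m e τ) (continuousOn_bandWeight hc hτ)
    (fun w hw => bandWeight_nonneg hc hτ hw) hp0 hq0 hC0 hK
    (L := fourierMat Ac ((c * τ) • x) j l) hUU
    (fun w w' hw hw' => by
      have he : ∀ s, conj (sourceMode χ f l ((c * w) • x) s) *
          conj (conj (sourceMode χ f l ((c * w') • x) s)) =
          sourceMode χ f l ((c * w') • x) s * conj (sourceMode χ f l ((c * w) • x) s) :=
        fun s => by rw [Complex.conj_conj, mul_comm]
      simp only [he]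
      refine (b₂ _ _).trans ?_
      rw [hqn w hw, hqn w' hw', mul_comm (q w')]
      refine div_one_add_le hc hC₂ (mul_nonneg (hq0 w hw) (hq0 w' hw')) (norm_nonneg _) ?_
        (hle (by linarith))
      rw [norm_sub_rev w w']
      exact hdq w' w)
    (fun w w' hw hw' => by
      have h := b₄ ((c * (w + τ)) • x) (-((c * w') • x))
      simp only [Complex.conj_conj]
      rw [neg_neg, norm_neg, hpn w hw, hqn w' hw'] at h
      exact h.trans (div_one_add_le hc hC₄ (mul_nonneg (hp0 w hw) (hq0 w' hw')) (norm_nonneg _)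
        (hsum w w' hw hw') (hle (by linarith))))
    (fun w hw => by
      refine (b₃ _ _).trans ?_
      rw [hpn w hw, hqn w hw]
      exact hdrop hC₃ (by linarith) (mul_nonneg (hp0 w hw) (hq0 w hw)) (norm_nonneg _))
    (by
      simp only [hshift]
      exact tendsto_bandWeight_mul hc hx e τ (E := fun ζ => ∫ s, sourceMode χ f j (ζ + (c * τ) • x) s
        * conj (sourceMode χ f l ζ s) ∂P) (tendsto_covariance hf hχ j l _))
  have hrel := ae_tendsto_band_average_mul (P := P) hW
    (U := fun s w => sourceMode χ f j ((c * (w + τ)) • x) s)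
    (V := fun s w => sourceMode χ f l (-((c * w) • x)) s)
    (fun w => hmem _ _) (fun w => hmem _ _) (fun w => hmem' _ _) (fun w => hmem' _ _) hcp
    (fun s => (hcont l s).comp (by fun_prop))
    (measurable_bandWeight c m e τ) (continuousOn_bandWeight hc hτ)
    (fun w hw => bandWeight_nonneg hc hτ hw) hp0 hq0 hC0 hK
    (L := fourierMat Ar ((c * τ) • x) j l) hUU
    (fun w w' hw hw' => by
      refine (b₂ _ _).trans ?_
      rw [norm_neg, norm_neg, hqn w hw, hqn w' hw']
      refine div_one_add_le hc hC₂ (mul_nonneg (hq0 w hw) (hq0 w' hw')) (norm_nonneg _) ?_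
        (hle (by linarith))
      rw [← neg_sub', norm_neg]
      exact hdq w w')
    (fun w w' hw hw' => by
      refine (b₃ _ _).trans ?_
      rw [norm_neg, hpn w hw, hqn w' hw']
      exact div_one_add_le hc hC₃ (mul_nonneg (hp0 w hw) (hq0 w' hw')) (norm_nonneg _)
        (hsum w w' hw hw') (hle (by linarith)))
    (fun w hw => by
      refine (b₄ _ _).trans ?_
      rw [hpn w hw, hqn w hw]
      exact hdrop hC₄ (by linarith) (mul_nonneg (hp0 w hw) (hq0 w hw)) (norm_nonneg _))
    (by
      simp only [hshift]
      exact tendsto_bandWeight_mul hc hx e τ (E := fun ζ => ∫ s, sourceMode χ f j (ζ + (c * τ) • x) s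
        * sourceMode χ f l (-ζ) s ∂P) (tendsto_relation hf hχ j l _))
  filter_upwards [hcov, hrel] with s h1 h2
  exact ⟨h1, h2⟩

theorem tendsto_bandAverage {mu m : ℝ} {M : ℝ → Matrix (Fin d) (Fin d) ℂ} {k : ℂ}
    {L : Matrix (Fin d) (Fin d) ℂ} {y : Fin d → Fin d → ℝ → ℂ}
    (hM : ∀ j l w, 0 < w →
      ((cS mu ^ (m + 3 - d) * w ^ (m + 3 - d) : ℝ) : ℂ) * M w j l = k * y j l w)
    (hy : ∀ j l, Tendsto (fun Q : ℝ => ((1 / Q : ℝ) : ℂ) * ∫ w in Q..(2 * Q), y j l w) atTop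
      (𝓝 (L j l))) :
    Tendsto (bandAverage mu m M) atTop (𝓝 (k • L)) := by
  refine tendsto_pi_nhds.2 fun j => tendsto_pi_nhds.2 fun l => ?_
  refine ((hy j l).const_mul k).congr' ?_
  filter_upwards [eventually_ge_atTop 1] with Q hQ
  have hint : ∫ w in Q..(2 * Q), ((cS mu ^ (m + 3 - d) * w ^ (m + 3 - d) : ℝ) : ℂ) * M w j l
      = k * ∫ w in Q..(2 * Q), y j l w := by
    rw [← intervalIntegral.integral_const_mul]
    refine intervalIntegral.integral_congr fun w hw => ?_
    rw [Set.uIcc_of_le (by linarith)] at hw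
    exact hM j l w (by linarith [hw.1])
  rw [bandAverage, Matrix.of_apply, hint]
  ring

theorem ae_tendsto_corr (hf : IsGMIG P m D f Ac Ar) {χ : Test d} (hχ : IsCutoff D χ)
    {lam mu : ℝ} (hmu : 0 < mu) (hlam : 0 < lam + 2 * mu) (x : Direction d) (τ : ℝ≥0) :
    ∀ᵐ s ∂P,
      Tendsto (bandAverage mu m (corrC lam mu χ (f s) x τ)) atTop
        (𝓝 (((‖farFieldConst d‖ ^ 2 : ℝ) : ℂ) •
          fourierMat Ac ((cS mu * (τ : ℝ)) • (x : Space d)))) ∧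
      Tendsto (bandAverage mu m (corrR lam mu χ (f s) x τ)) atTop
        (𝓝 ((farFieldConst d ^ 2) • fourierMat Ar ((cS mu * (τ : ℝ)) • (x : Space d)))) := by
  have hx : ‖(x : Space d)‖ = 1 := by simp
  have h : ∀ᵐ s ∂P, ∀ j l, _ := ae_all_iff.2 fun j => ae_all_iff.2 fun l =>
    ae_tendsto_modes hf hχ (cS_pos hmu) hx (((d : ℝ) - 3) / 2) τ.2 j l
  filter_upwards [h] with s hs
  exact ⟨tendsto_bandAverage (fun j l w hw => weight_mul_corrC hmu hlam χ (f s) x τ.2 hw j l)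
      fun j l => (hs j l).1,
    tendsto_bandAverage (fun j l w hw => weight_mul_corrR hmu hlam χ (f s) x τ.2 hw j l)
      fun j l => (hs j l).2⟩

theorem limits_subsingleton (g : ℝ → Matrix (Fin d) (Fin d) ℂ) : (limits g).Subsingleton :=
  fun _ h _ h' => tendsto_nhds_unique h h'

end Formulas

end ElasticRandomSource

theorem mainTheorem4 (d : ℕ) (hd : d = 2 ∨ d = 3) (lam mu m : ℝ)
    (hmu : 0 < mu) (hlam : 0 < lam + 2 * mu) (hm : m ∈ Set.Ioc ((d : ℝ) - 4) (d : ℝ)) :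
    -- the recovery formulas, almost surely for each direction and each frequency shift
    (∀ {Ω : Type u} [MeasurableSpace Ω] (P : Measure Ω) [IsProbabilityMeasure P]
        (D : Set (Space d)) (f : Ω → Fin d → Distr d)
        (Ac Ar : Space d → Matrix (Fin d) (Fin d) ℂ), IsGMIG P m D f Ac Ar →
      ∀ χ : Test d, IsCutoff D χ →
      ∀ (xhat : Direction d) (τ : ℝ≥0), ∀ᵐ s ∂P,
        Tendsto (bandAverage mu m (corrC lam mu χ (f s) xhat τ)) atTop
          (𝓝 (((‖farFieldConst d‖ ^ 2 : ℝ) : ℂ) •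
            fourierMat Ac ((cS mu * (τ : ℝ)) • (xhat : Space d)))) ∧
        Tendsto (bandAverage mu m (corrR lam mu χ (f s) xhat τ)) atTop
          (𝓝 ((farFieldConst d ^ 2) •
            fourierMat Ar ((cS mu * (τ : ℝ)) • (xhat : Space d))))) ∧
    -- a single realization determines the strengths from the limits on any open set
    (∀ Θ : Set (ℝ≥0 × Direction d), IsOpen Θ → Θ.Nonempty →
      ∃ recC recR : (Θ → Set (Matrix (Fin d) (Fin d) ℂ)) →
          (Space d → Matrix (Fin d) (Fin d) ℂ),
      ∀ {Ω : Type u} [MeasurableSpace Ω] (P : Measure Ω) [IsProbabilityMeasure P]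
        (D : Set (Space d)) (f : Ω → Fin d → Distr d)
        (Ac Ar : Space d → Matrix (Fin d) (Fin d) ℂ), IsGMIG P m D f Ac Ar →
      ∀ χ : Test d, IsCutoff D χ → ∀ᵐ s ∂P,
        recC (fun θ => limits (bandAverage mu m
          (corrC lam mu χ (f s) (θ.1.2 : Space d) (θ.1.1 : ℝ)))) = Ac ∧
        recR (fun θ => limits (bandAverage mu m
          (corrR lam mu χ (f s) (θ.1.2 : Space d) (θ.1.1 : ℝ)))) = Ar) := by
  refine ⟨fun P _ D f Ac Ar hf χ hχ xhat τ => ae_tendsto_corr hf hχ hmu hlam xhat τ,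
    fun Θ hΘ hne => ?_⟩
  -- The exceptional null set of the recovery formulas depends on `(τ, x̂)`; countability of `S`
  -- allows one null set for all its points, and density suffices for recovery.
  obtain ⟨S, hSc, hSd⟩ := TopologicalSpace.exists_countable_dense Θ
  have hC := farFieldConst_ne_zero d
  obtain ⟨recC, hrecC⟩ := exists_recovery hΘ hne (cS_pos hmu) hSd
    (k := ((‖farFieldConst d‖ ^ 2 : ℝ) : ℂ)) (by
      exact_mod_cast pow_ne_zero 2 (norm_ne_zero_iff.2 hC))
  obtain ⟨recR, hrecR⟩ := exists_recovery hΘ hne (cS_pos hmu) hSd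
    (k := farFieldConst d ^ 2) (pow_ne_zero 2 hC)
  refine ⟨recC, recR, fun P _ D f Ac Ar hf χ hχ => ?_⟩
  have h := (ae_ball_iff hSc).2 fun θ _ => ae_tendsto_corr hf hχ hmu hlam θ.1.2 θ.1.1
  filter_upwards [h] with s hs
  exact ⟨hrecC _ _ (fun θ => limits_subsingleton _) hf.smooth_covariance
      fun θ hθ => (hs θ hθ).1,
    hrecR _ _ (fun θ => limits_subsingleton _) hf.smooth_relation fun θ hθ => (hs θ hθ).2⟩
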